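/- Let $M=G/K$ be a flag manifold, i.e. $G$ is a compact connected simple Lie group with Lie algebra $\mathfrak g$ and $K$ is the centralizer of a torus in $G$. Let $B$ be the Killing form of $\mathfrak g$, $Q:=-B$, and $\mathfrak g=\mathfrak k\oplus\mathfrak p$ the $Q$-orthogonal reductive decomposition, so $T_oM\equiv\mathfrak p$. Assume that $G/K$ has exactly two isotropy summands, i.e. $\mathfrak p$ is the direct sum of two $\mathrm{Ad}(K)$-irreducible subspaces. Then these can be labelled $\mathfrak p_1,\mathfrak p_2$, with $d_i:=\dim\mathfrak p_i$, so that the following holds. 1. Put $[ijk]:=\sum_{\alpha,\beta,\gamma}Q([e^i_\alpha,e^j_\beta],e^k_\gamma)^2$, where $\{e^i_\alpha\}$ is a $Q$-orthonormal basis of $\mathfrak p_i$. Then $[112]=\frac{d_1d_2}{d_1+4d_2}$ and $[111]=[122]=[222]=0$. 2. The $G$-invariant Riemannian metrics on $M$ are exactly the metrics $(x_1,x_2):=x_1Q|_{\mathfrak p_1}+x_2Q|_{\mathfrak p_2}$ with $x_1,x_2>0$. The Ricci operator of $(x_1,x_2)$ is $\rho_1 I$ on $\mathfrak p_1$ and $\rho_2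 I$ on $\mathfrak p_2$, where $$\rho_1=\tfrac{1}{2x_1}-\tfrac{[112]x_2}{2d_1x_1^2},\qquad \rho_2=\tfrac1{2x_2}-\tfrac{[112](2x_1^2-x_2^2)}{4d_2x_1^2x_2}.$$ For an invariant metric $g$ let $\mu_{\mathfrak p}:\mathfrak p\times\mathfrak p\to\mathfrak p$ be the $\mathfrak p$-component of the Lie bracket, $\theta(A)\mu:=A\mu(\cdot,\cdot)-\mu(A\cdot,\cdot)-\mu(\cdot,A\cdot)$, and let $\mathrm M_{\mu_{\mathfrak p}}$ be given by $\operatorname{tr}(\mathrm M_{\mu_{\mathfrak p}}A^t)=\frac14\langle\theta(A)\mu_{\mathfrak p},\mu_{\mathfrak p}\rangle$ for $A\in\mathfrak{gl}(\mathfrak p)$. Let $\mathrm L_{\mathfrak p}$ be the self-adjoint operator (the Lichnerowicz Laplacian) on the space $\mathrm{sym}(\mathfrak p)$ of $g$-symmetric endomorphisms given by $\langle \mathrm L_{\mathfrak p}A,C\rangle=\frac12\langle\theta(A)\mu_{\mathfrak p},\theta(C)\mu_{\mathfrak p}\rangle+2\operatorname{tr}(\mathrm M_{\mu_{\mathfrak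 p}}AC)$, and let $\lambda_{\mathfrak p}$ be its smallest eigenvalue on the space $\mathcal{TT}^G_g$ of $G$-invariant divergence-free, trace-free symmetric $2$-tensors $T=g(A\cdot,\cdot)$. For $g=(x_1,x_2)$ the only eigenvalue there is $$\lambda_{\mathfrak p}=\frac{(d_1+d_2)x_2}{(d_1+4d_2)x_1^2}.$$ 3. Up to scaling there are exactly two $G$-invariant Einstein metrics on $M$, namely $g_0=(1,2)$ and $g_1=\left(1,\frac{4d_2}{d_1+2d_2}\right)$, and these are not multiples of each other. The metric $g_0$ is Kähler with respect to a $G$-invariant complex structure, and $g_1$ is not Kähler with respect to any complex structure on $M$. 4. Call an Einstein metric $g$ $G$-stable if the second variation $\mathrm{scal}''_g$ of the scalar curvature, on the space $\mathcal M^G_1$ of invariant metrics of the same volume as $g$, is negative definite on $\mathcal{TT}^G_g$, and $G$-unstable if $\mathrm{scal}''_g(T,T)>0$ for some $T\in\mathcal{TT}^G_g$. Then every positive multiple of $g_0$ is $G$-stable, satisfies $2\rho<\lambda_{\mathfrak p}$ (where $\mathrm{Ric}=\rho g$), and is a local maximum of $\mathrm{scal}|_{\mathcal M_1^G}$. Every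 positive multiple of $g_1$ is $G$-unstable, satisfies $\lambda_{\mathfrak p}<2\rho$, and is a local minimum of $\mathrm{scal}|_{\mathcal M_1^G}$. -/

import Mathlib

noncomputable section

namespace FlagManifold

/-! ### The adjoint group of a real Lie algebra -/

section AdjointGroup

variable {L : Type*} [LieRing L] [LieAlgebra ℝ L] [FiniteDimensional ℝ L]

/-- `exp (ad x)` as an endomorphism of `L`, computed as a matrix exponential in a basis of `L`. -/
def expAd (x : L) : L →ₗ[ℝ] L :=
  Matrix.toLin (Module.finBasis ℝ L) (Module.finBasis ℝ L)
    (NormedSpace.exp (LinearMap.toMatrix (Module.finBasis ℝ L) (Module.finBasis ℝ L)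
      (LieAlgebra.ad ℝ L x)))

variable (L) in
/-- The adjoint group `Int(L)`: the group generated by all `exp (ad x)`. For `L` compact and simple
this is the compact connected simple Lie group with trivial centre and Lie algebra `L`. -/
def adjointGroup : Subgroup (L ≃ₗ[ℝ] L) :=
  Subgroup.closure {φ | ∃ x : L, φ.toLinearMap = expAd x}

theorem exp_bilin {V : Type*} [NormedAddCommGroup V] [NormedSpace ℝ V] [CompleteSpace V]
    (D : V →L[ℝ] V) (m : V →L[ℝ] V →L[ℝ] V)
    (h : ∀ y z, D (m y z) = m (D y) z + m y (D z)) (y z : V) :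
    NormedSpace.exp D (m y z) = m (NormedSpace.exp D y) (NormedSpace.exp D z) := by
  let _ : NormedAlgebra ℚ (V →L[ℝ] V) := NormedAlgebra.restrictScalars ℚ ℝ (V →L[ℝ] V)
  let E : ℝ → V →L[ℝ] V := fun s => NormedSpace.exp (s • D)
  have hE : ∀ s, HasDerivAt E (E s * D) s := fun s => hasDerivAt_exp_smul_const D s
  have hE' : ∀ s, HasDerivAt E (D * E s) s := fun s => hasDerivAt_exp_smul_const' D s
  have hneg : ∀ s, HasDerivAt (fun s => E (-s)) (-(E (-s) * D)) s := fun s => by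
    have := (hE (-s)).scomp s (hasDerivAt_neg s)
    rw [neg_one_smul] at this
    exact this
  have happ : ∀ (v : V) (s : ℝ), HasDerivAt (fun s => E s v) (D (E s v)) s := fun v s => by
    simpa using (hE' s).clm_apply (hasDerivAt_const s v)
  let f : ℝ → V := fun s => E (-s) (m (E s y) (E s z))
  have hf : ∀ s, HasDerivAt f 0 s := fun s => by
    have h1 : HasDerivAt (fun s => m (E s y) (E s z))
        (m (D (E s y)) (E s z) + m (E s y) (D (E s z))) s := by
      have h2 : HasDerivAt (fun s => m (E s y)) (m (D (E s y))) s :=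
        m.hasFDerivAt.comp_hasDerivAt s (happ y s)
      exact h2.clm_apply (happ z s)
    have := (hneg s).clm_apply h1
    rw [← h] at this
    simpa [f] using this
  have hc : f 1 = f 0 := is_const_of_deriv_eq_zero (fun s => (hf s).differentiableAt)
    (fun s => (hf s).deriv) 1 0
  have h0 : f 0 = m y z := by simp [f, E]
  have h1 : E 1 * E (-1) = 1 := by
    have hcomm : Commute ((1 : ℝ) • D) ((-1 : ℝ) • D) := by simp [Commute.refl]
    have := NormedSpace.exp_add_of_commute hcomm
    simp only [E]
    rw [← this]; simp
  have h2 : E 1 (f 1) = m (E 1 y) (E 1 z) := by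
    show (E 1 * E (-1)) _ = _
    rw [h1]; rfl
  rw [hc, h0] at h2
  simpa [E] using h2

open scoped Matrix.Norms.Operator in
theorem expAd_lie (x y z : L) : expAd x ⁅y, z⁆ = ⁅expAd x y, expAd x z⁆ := by
  let n := Module.finrank ℝ L
  let V := Fin n → ℝ
  let b := Module.finBasis ℝ L
  let e : L ≃ₗ[ℝ] V := b.equivFun
  let c : Matrix (Fin n) (Fin n) ℝ ≃ₐ[ℝ] (V →L[ℝ] V) :=
    Matrix.toLinAlgEquiv'.trans (Module.End.toContinuousLinearMap V)
  have hcapp : ∀ A v, c A v = A.mulVec v := fun A v => rfl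
  have hccont : Continuous c := c.toLinearMap.continuous_of_finiteDimensional
  let A := LinearMap.toMatrix b b (LieAlgebra.ad ℝ L x)
  have hA : ∀ v, c A (e v) = e ⁅x, v⁆ := fun v => by
    rw [hcapp]
    exact LinearMap.toMatrix_mulVec_repr b b (LieAlgebra.ad ℝ L x) v
  let _ : NormedAlgebra ℚ (Matrix (Fin n) (Fin n) ℝ) :=
    NormedAlgebra.restrictScalars ℚ ℝ _
  let _ : NormedAlgebra ℚ (V →L[ℝ] V) := NormedAlgebra.restrictScalars ℚ ℝ _
  have hexp : ∀ v, NormedSpace.exp (c A) (e v) = e (expAd x v) := fun v => by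
    have hmap : c (NormedSpace.exp A) = NormedSpace.exp (c A) :=
      NormedSpace.map_exp c hccont A
    rw [← hmap, hcapp]
    have := LinearMap.toMatrix_mulVec_repr b b (expAd x) v
    rw [expAd, LinearMap.toMatrix_toLin] at this
    exact this
  let m₀ : V →ₗ[ℝ] V →ₗ[ℝ] V := LinearMap.mk₂ ℝ (fun u v => e ⁅e.symm u, e.symm v⁆)
    (by intros; simp) (by intros; simp) (by intros; simp) (by intros; simp)
  let m : V →L[ℝ] V →L[ℝ] V :=
    LinearMap.toContinuousLinearMap
      ((LinearMap.toContinuousLinearMap (E := V) (F' := V) (𝕜 := ℝ)).toLinearMap ∘ₗ m₀)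
  have hm : ∀ u v, m u v = e ⁅e.symm u, e.symm v⁆ := fun u v => rfl
  have key := exp_bilin (c A) m (by
    intro u v
    obtain ⟨u, rfl⟩ := e.surjective u
    obtain ⟨v, rfl⟩ := e.surjective v
    simp only [hm, hA, LinearEquiv.symm_apply_apply]
    rw [← map_add, ← leibniz_lie]) (e y) (e z)
  simp only [hm, hexp, LinearEquiv.symm_apply_apply] at key
  exact e.injective key

theorem lie_of_mem_adjointGroup {φ : L ≃ₗ[ℝ] L} (hφ : φ ∈ adjointGroup L) (y z : L) :
    φ ⁅y, z⁆ = ⁅φ y, φ z⁆ := by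
  induction hφ using Subgroup.closure_induction generalizing y z with
  | mem φ h =>
    obtain ⟨x, hx⟩ := h
    have : ∀ v, φ v = expAd x v := fun v => by rw [← hx]; rfl
    simp only [this, expAd_lie]
  | one => rfl
  | mul φ ψ _ _ h₁ h₂ => simp only [LinearEquiv.mul_apply, h₁, h₂]
  | inv φ _ h =>
    apply φ.injective
    have hφ : ∀ v, φ (φ⁻¹ v) = v := fun v => φ.apply_symm_apply v
    rw [h, hφ, hφ, hφ]

theorem killingForm_of_mem_adjointGroup {φ : L ≃ₗ[ℝ] L} (hφ : φ ∈ adjointGroup L) (y z : L) :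
    killingForm ℝ L (φ y) (φ z) = killingForm ℝ L y z :=
  LieAlgebra.killingForm_of_equiv_apply
    ({ φ with map_lie' := fun {y z} => lie_of_mem_adjointGroup hφ y z } : L ≃ₗ⁅ℝ⁆ L) y z

end AdjointGroup

end FlagManifold

/-- A flag manifold `G/K`: `G` is the compact connected simple Lie group `Int(L)` of a simple real
Lie algebra `L` with negative definite Killing form, and `K` is the centralizer in `G` of the torus
`closure (exp 𝔱)` for an abelian subalgebra `𝔱 = torus` of `L` (see `isotropyGroup`); every torus is
of this form. Since the centre of a compact connected `G` lies in the centralizer `K` of a torus and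
acts trivially on `G/K`, taking `G` of adjoint type is no restriction. -/
structure FlagManifold (L : Type*) [LieRing L] [LieAlgebra ℝ L] [FiniteDimensional ℝ L] where
  simple : LieAlgebra.IsSimple ℝ L
  compact : ∀ x : L, x ≠ 0 → killingForm ℝ L x x < 0
  torus : LieSubalgebra ℝ L
  abelian : ∀ s ∈ torus, ∀ t ∈ torus, ⁅s, t⁆ = 0

namespace FlagManifold

variable {L : Type*} [LieRing L] [LieAlgebra ℝ L] [FiniteDimensional ℝ L]

/-! ### The isotropy group and the reductive decomposition -/

/-- `K`: the centralizer of the torus in `G`, as a group acting on `L` by `Ad`. As `φ (exp (ad t)) φ⁻¹ = exp (ad (φ t))`, an element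
`φ` commutes with the torus if and only if it fixes the Lie algebra of the torus pointwise. -/
def isotropyGroup (M : FlagManifold L) : Subgroup (L ≃ₗ[ℝ] L) where
  carrier := {φ | φ ∈ adjointGroup L ∧ ∀ t ∈ M.torus, φ t = t}
  one_mem' := ⟨one_mem _, fun _ _ => rfl⟩
  mul_mem' := by
    rintro φ ψ ⟨h₁, h₂⟩ ⟨h₃, h₄⟩
    refine ⟨mul_mem h₁ h₃, fun t ht => ?_⟩
    rw [LinearEquiv.mul_apply, h₄ t ht, h₂ t ht]
  inv_mem' := by
    rintro φ ⟨h₁, h₂⟩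
    refine ⟨inv_mem h₁, fun t ht => ?_⟩
    conv_lhs => rw [← h₂ t ht]
    exact φ.symm_apply_apply t

/-- `𝔨`, the Lie algebra of `K`: the centralizer of `torus` in `L`. -/
def isotropyAlgebra (M : FlagManifold L) : Submodule ℝ L where
  carrier := {x | ∀ t ∈ M.torus, ⁅t, x⁆ = 0}
  zero_mem' := by simp
  add_mem' := by
    intro x y hx hy t ht
    rw [lie_add, hx t ht, hy t ht, add_zero]
  smul_mem' := by
    intro c x hx t ht
    rw [lie_smul, hx t ht, smul_zero]

/-- `𝔭`, the orthogonal complement of `𝔨` with respect to the Killing form; it is identified with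
the tangent space of `G/K` at the origin `o = eK`. -/
def tangent (M : FlagManifold L) : Submodule ℝ L :=
  (killingForm ℝ L).orthogonal M.isotropyAlgebra

theorem isCompl (M : FlagManifold L) : IsCompl M.tangent M.isotropyAlgebra := by
  refine IsCompl.symm ?_
  rw [tangent, LinearMap.BilinForm.isCompl_orthogonal_iff_disjoint
    (LieModule.traceForm_isSymm ℝ L L).isRefl, Submodule.disjoint_def]
  intro x hx hx'
  by_contra hne
  exact (M.compact x hne).ne (hx' x hx)

/-- The projection of `L = 𝔭 ⊕ 𝔨` onto `𝔭`. -/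
def proj (M : FlagManifold L) : L →ₗ[ℝ] M.tangent :=
  Submodule.projectionOnto M.tangent M.isotropyAlgebra M.isCompl

theorem isotropy_map_mem (M : FlagManifold L) {φ : L ≃ₗ[ℝ] L} (hφ : φ ∈ M.isotropyGroup)
    {x : L} (hx : x ∈ M.tangent) : φ x ∈ M.tangent := by
  intro y hy
  have hφi := inv_mem hφ
  have hy' : φ⁻¹ y ∈ M.isotropyAlgebra := fun t ht => by
    conv_lhs => rw [← hφi.2 t ht]
    rw [← lie_of_mem_adjointGroup hφi.1, hy t ht, map_zero]
  have h := hx _ hy'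
  have hyy : φ (φ⁻¹ y) = y := φ.apply_symm_apply y
  change killingForm ℝ L (φ⁻¹ y) x = 0 at h
  change killingForm ℝ L y (φ x) = 0
  rw [← hyy, killingForm_of_mem_adjointGroup hφ.1, h]

/-- The isotropy representation of `K` on `𝔭`. -/
def Ad (M : FlagManifold L) (k : M.isotropyGroup) : M.tangent →ₗ[ℝ] M.tangent :=
  (k : L ≃ₗ[ℝ] L).toLinearMap.restrict fun _ hx => M.isotropy_map_mem k.2 hx

/-- `p` is an `Ad(K)`-invariant, `Ad(K)`-irreducible (in particular nonzero) subspace of `𝔭`. -/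
def IsIrreducibleSummand (M : FlagManifold L) (p : Submodule ℝ M.tangent) : Prop :=
  p ≠ ⊥ ∧ (∀ k, ∀ X ∈ p, M.Ad k X ∈ p) ∧
    ∀ q : Submodule ℝ M.tangent, q ≤ p → (∀ k, ∀ X ∈ q, M.Ad k X ∈ q) → q = ⊥ ∨ q = p

/-- The background metric `Q = -B` on `𝔭`, where `B` is the Killing form of `L`. -/
def Q (M : FlagManifold L) : LinearMap.BilinForm ℝ M.tangent :=
  -(killingForm ℝ L).restrict M.tangent

/-- `𝔭`-component of the Lie bracket, `μ_𝔭 : 𝔭 × 𝔭 → 𝔭`. -/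
def bracket (M : FlagManifold L) : M.tangent →ₗ[ℝ] M.tangent →ₗ[ℝ] M.tangent :=
  LinearMap.mk₂ ℝ (fun X Y => M.proj ⁅(X : L), (Y : L)⁆)
    (by intros; simp) (by intros; simp) (by intros; simp) (by intros; simp)

/-- The structural constant `[ijk] = ∑ Q([e_α, f_β], h_γ)²` of three families in `𝔭` (used for
`Q`-orthonormal bases of `𝔭_i`, `𝔭_j`, `𝔭_k`). -/
def structConst (M : FlagManifold L) {ι κ ν : Type*} [Fintype ι] [Fintype κ] [Fintype ν]
    (e : ι → M.tangent) (f : κ → M.tangent) (h : ν → M.tangent) : ℝ :=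
  ∑ α, ∑ β, ∑ γ, (M.Q (M.bracket (e α) (f β)) (h γ)) ^ 2

/-- The family `e` is a `Q`-orthonormal basis of the subspace `p` of `𝔭`. -/
def IsOrthonormalBasisOf (M : FlagManifold L) {ι : Type*} [DecidableEq ι]
    (e : ι → M.tangent) (p : Submodule ℝ M.tangent) : Prop :=
  (∀ i j, M.Q (e i) (e j) = if i = j then 1 else 0) ∧ Submodule.span ℝ (Set.range e) = p

/-! ### Invariant metrics and tensors

A `G`-invariant symmetric `2`-tensor on `G/K` is the same as an `Ad(K)`-invariant symmetric bilinear
form on `𝔭`, its value at the origin. -/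

/-- `h` is (the value at the origin of) a `G`-invariant symmetric `2`-tensor on `G/K`. -/
def IsInvariantTensor (M : FlagManifold L) (h : LinearMap.BilinForm ℝ M.tangent) : Prop :=
  (∀ X Y, h X Y = h Y X) ∧ ∀ k X Y, h (M.Ad k X) (M.Ad k Y) = h X Y

/-- `g` is (the value at the origin of) a `G`-invariant Riemannian metric on `G/K`. -/
def IsInvariantMetric (M : FlagManifold L) (g : LinearMap.BilinForm ℝ M.tangent) : Prop :=
  M.IsInvariantTensor g ∧ ∀ X, X ≠ 0 → 0 < g X X

/-- The metric `(x₁, x₂) = x₁ Q|_{p₁} + x₂ Q|_{p₂}` for a decomposition `𝔭 = p₁ ⊕ p₂`. -/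
def diagMetric (M : FlagManifold L) {p₁ p₂ : Submodule ℝ M.tangent} (h : IsCompl p₁ p₂)
    (x₁ x₂ : ℝ) : LinearMap.BilinForm ℝ M.tangent :=
  x₁ • M.Q.compl₁₂ (p₁.subtype ∘ₗ Submodule.projectionOnto p₁ p₂ h)
      (p₁.subtype ∘ₗ Submodule.projectionOnto p₁ p₂ h) +
    x₂ • M.Q.compl₁₂ (p₂.subtype ∘ₗ Submodule.projectionOnto p₂ p₁ h.symm)
      (p₂.subtype ∘ₗ Submodule.projectionOnto p₂ p₁ h.symm)

open Classical in
/-- For nondegenerate `g`, the endomorphism `A` of `𝔭` with `h = g(A·, ·)`. -/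
def toEnd (M : FlagManifold L) (g : LinearMap.BilinForm ℝ M.tangent) :
    LinearMap.BilinForm ℝ M.tangent →ₗ[ℝ] Module.End ℝ M.tangent :=
  if hg : g.Nondegenerate then (LinearEquiv.congrRight (g.toDual hg).symm).toLinearMap else 0

/-- The trace `tr_g h = ∑ h(X_i, X_i)` (`X_i` a `g`-orthonormal basis) of a bilinear form. -/
def metricTrace (M : FlagManifold L) (g : LinearMap.BilinForm ℝ M.tangent) :
    LinearMap.BilinForm ℝ M.tangent →ₗ[ℝ] ℝ :=
  LinearMap.trace ℝ M.tangent ∘ₗ M.toEnd g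

/-- The ratio `dvol_{g'}² / dvol_g²` of the squares of the volume densities of two metrics. -/
def volumeRatioSq (M : FlagManifold L) (g g' : LinearMap.BilinForm ℝ M.tangent) : ℝ :=
  LinearMap.det (M.toEnd g g')

/-! ### Levi-Civita connection and curvature -/

/-- `(X, Y, Z) ↦ ½ (g([X,Y]_𝔭, Z) - g([Y,Z]_𝔭, X) - g([X,Z]_𝔭, Y))` -/
def koszul (M : FlagManifold L) (g : LinearMap.BilinForm ℝ M.tangent) :
    M.tangent →ₗ[ℝ] LinearMap.BilinForm ℝ M.tangent :=
  LinearMap.mk₂ ℝ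
    (fun X Y => (1 / 2 : ℝ) •
      (g (M.bracket X Y) - g.flip X ∘ₗ M.bracket Y - g.flip Y ∘ₗ M.bracket X))
    (by intros; ext; simp; ring) (by intros; ext; simp; ring)
    (by intros; ext; simp; ring) (by intros; ext; simp; ring)

/-- The Levi-Civita connection of the invariant metric `g`, as the linear map
`Λ : 𝔭 → End(𝔭)`, `Λ(X)Y = ½ [X,Y]_𝔭 + U(X,Y)`, which is determined by being `g`-skew and
torsion-free, `Λ(X)Y - Λ(Y)X = [X,Y]_𝔭` (see `leviCivita_spec`). The covariant derivative at the
origin of the invariant tensor field with value `T` is `∇_X T = Λ(X) · T`. -/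
def leviCivita (M : FlagManifold L) (g : LinearMap.BilinForm ℝ M.tangent) :
    M.tangent →ₗ[ℝ] Module.End ℝ M.tangent :=
  M.toEnd g ∘ₗ M.koszul g

theorem toEnd_spec (M : FlagManifold L) {g : LinearMap.BilinForm ℝ M.tangent}
    (hg : g.Nondegenerate) (h : LinearMap.BilinForm ℝ M.tangent) (X Y : M.tangent) :
    g (M.toEnd g h X) Y = h X Y := by
  rw [toEnd, dif_pos hg]
  exact LinearMap.BilinForm.apply_toDual_symm_apply (hB := hg) (h X) Y

theorem bracket_swap (M : FlagManifold L) (X Y : M.tangent) :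
    M.bracket X Y = -M.bracket Y X := by
  simp only [bracket, LinearMap.mk₂_apply]
  rw [← lie_skew, map_neg]

theorem IsInvariantMetric.nondegenerate {M : FlagManifold L}
    {g : LinearMap.BilinForm ℝ M.tangent} (hg : M.IsInvariantMetric g) : g.Nondegenerate := by
  constructor
  · intro X hX
    by_contra hne
    exact (hg.2 X hne).ne' (hX X)
  · intro X hX
    by_contra hne
    exact (hg.2 X hne).ne' (hX X)

theorem leviCivita_spec (M : FlagManifold L) {g : LinearMap.BilinForm ℝ M.tangent}
    (hg : M.IsInvariantMetric g) (X Y Z : M.tangent) :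
    g (M.leviCivita g X Y) Z + g Y (M.leviCivita g X Z) = 0 ∧
      M.leviCivita g X Y - M.leviCivita g Y X = M.bracket X Y := by
  have hs := hg.1.1
  have hk : ∀ X Y Z, g (M.leviCivita g X Y) Z = 1 / 2 * (g (M.bracket X Y) Z -
      g (M.bracket Y Z) X - g (M.bracket X Z) Y) := fun X Y Z => by
    rw [leviCivita, LinearMap.comp_apply, M.toEnd_spec hg.nondegenerate]
    simp [koszul]
  refine ⟨?_, ?_⟩
  · rw [hs Y, hk, hk, M.bracket_swap Z Y]
    simp only [map_neg, LinearMap.neg_apply]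
    ring
  · rw [← sub_eq_zero]
    refine hg.nondegenerate.1 _ fun W => ?_
    simp only [map_sub, LinearMap.sub_apply, hk]
    rw [M.bracket_swap Y X]
    simp only [map_neg, LinearMap.neg_apply]
    ring

/-- The curvature tensor `R(X,Y) = [Λ(X), Λ(Y)] - Λ([X,Y]_𝔭) - ad([X,Y]_𝔨)|_𝔭` at the origin. -/
def curvature (M : FlagManifold L) (g : LinearMap.BilinForm ℝ M.tangent) :
    M.tangent →ₗ[ℝ] M.tangent →ₗ[ℝ] Module.End ℝ M.tangent :=
  LinearMap.mk₂ ℝ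
    (fun X Y => M.leviCivita g X * M.leviCivita g Y - M.leviCivita g Y * M.leviCivita g X -
      M.leviCivita g (M.bracket X Y) -
      M.proj ∘ₗ (LieAlgebra.ad ℝ L (⁅(X : L), (Y : L)⁆ - (M.bracket X Y : L)) : L →ₗ[ℝ] L) ∘ₗ
        M.tangent.subtype)
    (by intros; ext; simp; abel)
    (by intros; ext; simp [smul_sub])
    (by intros; ext; simp; abel)
    (by intros; ext; simp [smul_sub])

/-- The Ricci tensor `ric(Y, Z) = tr (X ↦ R(X,Y)Z)`. -/
def ricci (M : FlagManifold L) (g : LinearMap.BilinForm ℝ M.tangent) :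
    LinearMap.BilinForm ℝ M.tangent :=
  LinearMap.mk₂ ℝ (fun Y Z => LinearMap.trace ℝ M.tangent (((M.curvature g).flip Y).flip Z))
    (by intros; rw [← map_add]; congr 1; ext; simp)
    (by intros; rw [← map_smul]; congr 1; ext; simp)
    (by intros; simp only [map_add])
    (by intros; simp only [map_smul])

/-- The scalar curvature. -/
def scal (M : FlagManifold L) (g : LinearMap.BilinForm ℝ M.tangent) : ℝ :=
  M.metricTrace g (M.ricci g)

/-- `g` satisfies the Einstein equation `ric(g) = ρ g`. -/
def IsEinsteinWith (M : FlagManifold L) (g : LinearMap.BilinForm ℝ M.tangent) (ρ : ℝ) : Prop :=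
  M.ricci g = ρ • g

/-- `g` is an Einstein metric. -/
def IsEinstein (M : FlagManifold L) (g : LinearMap.BilinForm ℝ M.tangent) : Prop :=
  ∃ ρ : ℝ, M.IsEinsteinWith g ρ

/-! ### Kähler metrics -/

/-- `g` is Kähler with respect to a `G`-invariant complex structure: there is an `Ad(K)`-invariant
`g`-orthogonal almost complex structure `J` on `𝔭` which is parallel, `∇_X J = [Λ(X), J] = 0`. -/
def IsInvariantKahler (M : FlagManifold L) (g : LinearMap.BilinForm ℝ M.tangent) : Prop :=
  ∃ J : Module.End ℝ M.tangent, (∀ X, J (J X) = -X) ∧ (∀ X Y, g (J X) (J Y) = g X Y) ∧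
    (∀ k X, J (M.Ad k X) = M.Ad k (J X)) ∧
    ∀ X Y, M.leviCivita g X (J Y) = J (M.leviCivita g X Y)

/-- The holonomy algebra of `g` at the origin: the smallest space of endomorphisms of `𝔭` that
contains all curvature operators `R(X,Y)` and is stable under `[Λ(X), ·]`, `X ∈ 𝔭`. -/
def holonomyAlgebra (M : FlagManifold L) (g : LinearMap.BilinForm ℝ M.tangent) :
    Submodule ℝ (Module.End ℝ M.tangent) :=
  sInf {S | (∀ X Y, M.curvature g X Y ∈ S) ∧ ∀ X, ∀ T ∈ S, M.leviCivita g X * T - T * M.leviCivita g X ∈ S}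

/-- `g` is a Kähler metric with respect to some complex structure on `G/K`, not necessarily
`G`-invariant: as `G/K` is simply connected, parallel orthogonal almost complex structures on it
correspond to orthogonal complex structures on `𝔭` commuting with the holonomy algebra. -/
def IsKahler (M : FlagManifold L) (g : LinearMap.BilinForm ℝ M.tangent) : Prop :=
  ∃ J : Module.End ℝ M.tangent, (∀ X, J (J X) = -X) ∧ (∀ X Y, g (J X) (J Y) = g X Y) ∧
    ∀ T ∈ M.holonomyAlgebra g, ∀ X, J (T X) = T (J X)

/-! ### `G`-stability -/

/-- The divergence `(δ_g h)(X) = -∑ (∇_{X_i} h)(X_i, X)` of the invariant symmetric tensor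
`h = g(A·, ·)`, that is `-tr (Y ↦ (∇_Y A) X)` with `∇_Y A = [Λ(Y), A]`. -/
def divergence (M : FlagManifold L) (g h : LinearMap.BilinForm ℝ M.tangent) (X : M.tangent) : ℝ :=
  -LinearMap.trace ℝ M.tangent
    ((M.leviCivita g).flip (M.toEnd g h X) - M.toEnd g h ∘ₗ (M.leviCivita g).flip X)

/-- `T` is a `G`-invariant TT-tensor for `g`: trace-free and divergence-free. -/
def IsTT (M : FlagManifold L) (g T : LinearMap.BilinForm ℝ M.tangent) : Prop :=
  M.IsInvariantTensor T ∧ M.metricTrace g T = 0 ∧ ∀ X, M.divergence g T X = 0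

/-- The scalar curvature of the rescaling of `g'` to the volume of `g`. -/
def scalNormalized (M : FlagManifold L) (g g' : LinearMap.BilinForm ℝ M.tangent) : ℝ :=
  (M.volumeRatioSq g g') ^ (1 / (Module.finrank ℝ M.tangent : ℝ)) * M.scal g'

/-- The second variation `scal''_g(T,T)` at a critical point `g` of `scal` on the space of invariant
metrics of the same volume, computed along the curve `g + sT` rescaled to the volume of `g`
(which has velocity `T` when `T` is trace-free). -/
def secondVariation (M : FlagManifold L) (g T : LinearMap.BilinForm ℝ M.tangent) : ℝ :=
  iteratedDeriv 2 (fun s : ℝ => M.scalNormalized g (g + s • T)) 0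

/-- `g` is an Einstein metric with `scal''_g` negative definite on invariant TT-tensors. -/
def IsGStable (M : FlagManifold L) (g : LinearMap.BilinForm ℝ M.tangent) : Prop :=
  M.IsEinstein g ∧ ∀ T, M.IsTT g T → T ≠ 0 → M.secondVariation g T < 0

/-- `g` is an Einstein metric with `scal''_g(T,T) > 0` for some invariant TT-tensor `T`. -/
def IsGUnstable (M : FlagManifold L) (g : LinearMap.BilinForm ℝ M.tangent) : Prop :=
  M.IsEinstein g ∧ ∃ T, M.IsTT g T ∧ 0 < M.secondVariation g T

/-- `g'` is an invariant metric with the volume of `g` in the `ε`-neighbourhood of `g`. -/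
def IsNearby (M : FlagManifold L) (g : LinearMap.BilinForm ℝ M.tangent) (ε : ℝ)
    (g' : LinearMap.BilinForm ℝ M.tangent) : Prop :=
  M.IsInvariantMetric g' ∧ M.volumeRatioSq g g' = 1 ∧ ∀ X, |g' X X - g X X| ≤ ε * g X X

/-- `g` is a local maximum of `scal` among invariant metrics of the same volume. -/
def IsLocalMaxScal (M : FlagManifold L) (g : LinearMap.BilinForm ℝ M.tangent) : Prop :=
  ∃ ε > 0, ∀ g', M.IsNearby g ε g' → M.scal g' ≤ M.scal g

/-- `g` is a local minimum of `scal` among invariant metrics of the same volume. -/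
def IsLocalMinScal (M : FlagManifold L) (g : LinearMap.BilinForm ℝ M.tangent) : Prop :=
  ∃ ε > 0, ∀ g', M.IsNearby g ε g' → M.scal g ≤ M.scal g'

/-! ### The Lichnerowicz Laplacian on invariant tensors -/

/-- The representation `θ(A)β = Aβ(·,·) - β(A·,·) - β(·,A·)` of `𝔤𝔩(𝔭)`. -/
def theta (M : FlagManifold L) (A : Module.End ℝ M.tangent)
    (β : M.tangent →ₗ[ℝ] M.tangent →ₗ[ℝ] M.tangent) :
    M.tangent →ₗ[ℝ] M.tangent →ₗ[ℝ] M.tangent :=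
  β.compr₂ A - β ∘ₗ A - β.compl₂ A

/-- `⟨β, γ⟩ = ∑ g(β(X_i, X_j), γ(X_i, X_j))` over a `g`-orthonormal basis `X_i` of `𝔭`. -/
def innerBracket (M : FlagManifold L) (g : LinearMap.BilinForm ℝ M.tangent)
    (β γ : M.tangent →ₗ[ℝ] M.tangent →ₗ[ℝ] M.tangent) : ℝ :=
  M.metricTrace g (LinearMap.mk₂ ℝ (fun X Y => M.metricTrace g (g.compl₁₂ (β X) (γ Y)))
    (by intros; rw [← map_add]; congr 1; ext; simp)
    (by intros; rw [← map_smul]; congr 1; ext; simp)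
    (by intros; rw [← map_add]; congr 1; ext; simp)
    (by intros; rw [← map_smul]; congr 1; ext; simp))

theorem innerBracket_add_left (M : FlagManifold L) (g : LinearMap.BilinForm ℝ M.tangent)
    (β β' γ : M.tangent →ₗ[ℝ] M.tangent →ₗ[ℝ] M.tangent) :
    M.innerBracket g (β + β') γ = M.innerBracket g β γ + M.innerBracket g β' γ := by
  simp only [innerBracket]
  rw [← map_add]
  congr 1
  ext X Y
  simp only [LinearMap.mk₂_apply, LinearMap.add_apply]
  rw [← map_add]
  congr 1
  ext
  simp

theorem innerBracket_smul_left (M : FlagManifold L) (g : LinearMap.BilinForm ℝ M.tangent) (c : ℝ)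
    (β γ : M.tangent →ₗ[ℝ] M.tangent →ₗ[ℝ] M.tangent) :
    M.innerBracket g (c • β) γ = c * M.innerBracket g β γ := by
  simp only [innerBracket]
  rw [← smul_eq_mul, ← map_smul]
  congr 1
  ext X Y
  simp only [LinearMap.mk₂_apply, LinearMap.smul_apply]
  rw [← map_smul (M.metricTrace g)]
  congr 1
  ext
  simp

theorem theta_add (M : FlagManifold L) (A A' : Module.End ℝ M.tangent)
    (β : M.tangent →ₗ[ℝ] M.tangent →ₗ[ℝ] M.tangent) :
    M.theta (A + A') β = M.theta A β + M.theta A' β := by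
  ext; simp [theta]; abel

theorem theta_smul (M : FlagManifold L) (c : ℝ) (A : Module.End ℝ M.tangent)
    (β : M.tangent →ₗ[ℝ] M.tangent →ₗ[ℝ] M.tangent) :
    M.theta (c • A) β = c • M.theta A β := by
  ext; simp [theta, smul_sub]

/-- The moment map `M_{μ_𝔭}`, determined by `tr (M_{μ_𝔭} Aᵗ) = ¼ ⟨θ(A)μ_𝔭, μ_𝔭⟩` for all
`A ∈ 𝔤𝔩(𝔭)`. For `A = g(X, ·)Y` the left-hand side is `g(M_{μ_𝔭} X, Y)`. -/
def momentMap (M : FlagManifold L) (g : LinearMap.BilinForm ℝ M.tangent) :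
    Module.End ℝ M.tangent :=
  M.toEnd g (LinearMap.mk₂ ℝ
    (fun X Y => 1 / 4 * M.innerBracket g (M.theta ((g X).smulRight Y) M.bracket) M.bracket)
    (by
      intro X X' Y
      rw [← mul_add, ← innerBracket_add_left, ← theta_add]
      congr 3; ext; simp [add_smul])
    (by
      intro c X Y
      have : (g (c • X)).smulRight Y = c • (g X).smulRight Y := by ext; simp [mul_smul]
      rw [this, theta_smul, innerBracket_smul_left, smul_eq_mul]; ring)
    (by
      intro X Y Y'
      rw [← mul_add, ← innerBracket_add_left, ← theta_add]
      congr 3; ext; simp)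
    (by
      intro c X Y
      have : (g X).smulRight (c • Y) = c • (g X).smulRight Y := by
        ext; simp [smul_comm c]
      rw [this, theta_smul, innerBracket_smul_left, smul_eq_mul]; ring))

/-- The bilinear form `⟨L_𝔭 A, C⟩ = ½ ⟨θ(A)μ_𝔭, θ(C)μ_𝔭⟩ + 2 tr (M_{μ_𝔭} A C)` on `sym(𝔭)`; the
self-adjoint operator `L_𝔭` is the Lichnerowicz Laplacian on invariant TT-tensors. -/
def lichnerowiczForm (M : FlagManifold L) (g : LinearMap.BilinForm ℝ M.tangent)
    (A C : Module.End ℝ M.tangent) : ℝ :=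
  1 / 2 * M.innerBracket g (M.theta A M.bracket) (M.theta C M.bracket) +
    2 * LinearMap.trace ℝ M.tangent (M.momentMap g * A * C)

/-- The eigenvalues of `L_𝔭` on the space of invariant TT-tensors: those `l` with `L_𝔭 A = l A`
for some nonzero `A ∈ sym(𝔭)` such that `T = g(A·, ·)` is an invariant TT-tensor, where
`L_𝔭 A = l A` means `⟨L_𝔭 A, C⟩ = l tr (A C)` for all `C ∈ sym(𝔭)`. -/
def lichnerowiczSpectrum (M : FlagManifold L) (g : LinearMap.BilinForm ℝ M.tangent) : Set ℝ :=
  {l | ∃ T, M.IsTT g T ∧ T ≠ 0 ∧ ∀ C : Module.End ℝ M.tangent, (∀ X Y, g (C X) Y = g X (C Y)) →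
    M.lichnerowiczForm g (M.toEnd g T) C =
      l * LinearMap.trace ℝ M.tangent (M.toEnd g T * C)}

/-- `λ_𝔭(g)`, the smallest eigenvalue of `L_𝔭` on the space of invariant TT-tensors. -/
def lambdaMin (M : FlagManifold L) (g : LinearMap.BilinForm ℝ M.tangent) : ℝ :=
  sInf (M.lichnerowiczSpectrum g)

end FlagManifold

end

/-! The whole geometry is recovered from one torus element. By Schur's lemma the square of `ad t`,
for `t` in the torus, is a nonpositive scalar on each irreducible summand, and some `s` in the torus
acts nontrivially on both summands, with weights `a, b > 0`. Brackets of vectors of weights `a` and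
`c` have weights `|a ± c|`. Unless `b = 2a` or `a = 2b`, no such weight occurs in `𝔭` for brackets
with `q₁`, so `[q₁, 𝔭] ⊆ 𝔨`, and then `q₁ + [q₁, q₁]` is a proper nonzero ideal (`weight_ratio`,
`false_of_bracket_eq_zero`). After rescaling the weights are 1 and 2, which gives `[p₁, p₁] ⊆ 𝔨 +
p₂`, `[p₁, p₂] ⊆ p₁`, `[p₂, p₂] ⊆ 𝔨`, and makes `p₁`, `p₂` orthogonal for every invariant form.

By Schur again, the sums `∑ |[f, ·]_𝔭|²` on `p₁` and `∑ |[e, ·]_𝔭|²` on `p₂` are scalars `α` and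
`β`. Double counting gives `d₁ α = d₂ β`. A second relation `1 - 4α = β` comes from writing `s = ∑
[e, [s, e]]` over a basis of `𝔭`, splitting the sum along `p₁` and `p₂`, and using that the first
part is a derivation of the bracket `p₁ × p₁ → p₂` (`constants_eq`). This fixes `[112] = d₁ α`.

Everything else is explicit. The Levi-Civita map is a multiple of the bracket on each pair of
summands, Ricci is diagonal (`ricci_isDiag`), and the Einstein equation is a quadratic with two
roots. Invariant TT-tensors form a line, on which the Lichnerowicz form is scalar. Scalar curvature
on metrics of fixed volume is a combination of three exponentials in one variable, whose second
derivative at the two Einstein metrics has opposite signs.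

For the Kähler claims, `ad s` on `p₁` and `½ ad s` on `p₂` define an invariant complex structure,
parallel when `x₂ = 2 x₁`. If `x₂ ≠ 2 x₁`, an orthogonal complex structure commuting with the
connection map would force `[p₁, p₁]_𝔭 = 0`. A parallel structure that is not assumed invariant is
reduced to this case by the Einstein condition with `ρ ≠ 0` (`leviCivita_comm_of_holonomy`). -/

noncomputable section

namespace FlagManifold

section

/-! ### Symmetric operators and Schur's lemma over the reals. -/

section LinearAlgebra

variable {V : Type*} [AddCommGroup V] [Module ℝ V] [FiniteDimensional ℝ V]

/-- A symmetric operator for a positive definite form has an eigenvector. -/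
theorem exists_eigenvector_of_symmetric [Nontrivial V] (Q : LinearMap.BilinForm ℝ V)
    (hs : ∀ X Y, Q X Y = Q Y X) (hp : ∀ X, X ≠ 0 → 0 < Q X X) (T : Module.End ℝ V)
    (hT : ∀ X Y, Q (T X) Y = Q X (T Y)) : ∃ (l : ℝ) (v : V), v ≠ 0 ∧ T v = l • v := by
  let c : InnerProductSpace.Core ℝ V :=
    { inner := fun X Y => Q X Y
      conj_inner_symm := fun X Y => by simpa using hs Y X
      re_inner_nonneg := fun X => by
        rcases eq_or_ne X 0 with rfl | h
        · simp
        · simpa using (hp X h).le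
      add_left := fun X Y Z => by simp
      smul_left := fun X Y r => by simp
      definite := fun X h => by
        by_contra hne
        exact (hp X hne).ne' h }
  let _ : NormedAddCommGroup V := c.toNormedAddCommGroup
  let _ : InnerProductSpace ℝ V := InnerProductSpace.ofCore c.toCore
  have hsym : T.IsSymmetric := fun X Y => hT X Y
  obtain ⟨v, hv⟩ := (hsym.hasEigenvalue_iSup_of_finiteDimensional).exists_hasEigenvector
  exact ⟨_, v, hv.2, hv.apply_eq_smul⟩

/-- Schur's lemma for invariant symmetric forms on a real irreducible orthogonal representation. -/
theorem exists_eq_smul_of_irreducible (Q b : LinearMap.BilinForm ℝ V)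
    (hQs : ∀ X Y, Q X Y = Q Y X) (hQp : ∀ X, X ≠ 0 → 0 < Q X X)
    (p : Submodule ℝ V) (hp : p ≠ ⊥) (hbs : ∀ X ∈ p, ∀ Y ∈ p, b X Y = b Y X)
    (hirr : ∀ q : Submodule ℝ V, q ≤ p →
      (∀ l : ℝ, (∀ X, X ∈ q ↔ X ∈ p ∧ ∀ Y ∈ p, b X Y = l * Q X Y) → q = ⊥ ∨ q = p)) :
    ∃ l : ℝ, ∀ X ∈ p, ∀ Y ∈ p, b X Y = l * Q X Y := by
  have : Nontrivial p := Submodule.nontrivial_iff_ne_bot.2 hp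
  let Qp := Q.restrict p
  let bp := b.restrict p
  have hQp' : ∀ X, X ≠ 0 → 0 < Qp X X := fun X hX => hQp X (by simpa using hX)
  have hnd : Qp.Nondegenerate := by
    constructor
    · intro X hX
      by_contra hne
      exact (hQp' X hne).ne' (hX X)
    · intro X hX
      by_contra hne
      exact (hQp' X hne).ne' (hX X)
  let T : Module.End ℝ p := (Qp.toDual hnd).symm.toLinearMap ∘ₗ bp
  have hT : ∀ X Y, Qp (T X) Y = bp X Y := fun X Y =>
    LinearMap.BilinForm.apply_toDual_symm_apply (hB := hnd) (bp X) Y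
  obtain ⟨l, v, hv, hl⟩ := exists_eigenvector_of_symmetric Qp (fun X Y => hQs X Y) hQp' T
    (fun X Y => by
      rw [hT, show Qp X (T Y) = Qp (T Y) X from hQs _ _, hT]
      exact hbs X X.2 Y Y.2)
  -- This is an eigenspace of `T`, described by the forms alone, so that a caller can check its
  -- invariance under a group without mentioning `T`.
  let q : Submodule ℝ V :=
    { carrier := {X | X ∈ p ∧ ∀ Y ∈ p, b X Y = l * Q X Y}
      zero_mem' := ⟨p.zero_mem, by simp⟩
      add_mem' := by
        rintro X Y ⟨h1, h2⟩ ⟨h3, h4⟩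
        refine ⟨p.add_mem h1 h3, fun Z hZ => ?_⟩
        simp [h2 Z hZ, h4 Z hZ, mul_add]
      smul_mem' := by
        rintro c X ⟨h1, h2⟩
        refine ⟨p.smul_mem c h1, fun Z hZ => ?_⟩
        simp [h2 Z hZ]; ring }
  have hvq : (v : V) ∈ q := ⟨v.2, fun Y hY => by
    have := hT v ⟨Y, hY⟩
    rw [hl] at this
    simpa [Qp, bp] using this.symm⟩
  rcases hirr q (fun X hX => hX.1) l (fun X => Iff.rfl) with h | h
  · rw [h] at hvq
    exact absurd (by simpa using hvq) hv
  · exact ⟨l, fun X hX => (h ▸ hX : X ∈ q).2⟩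

end LinearAlgebra

/-! ### One-parameter groups `exp (s ad Z)`. -/

section AdjointGroup

variable {L : Type*} [LieRing L] [LieAlgebra ℝ L] [FiniteDimensional ℝ L]

-- Testing against a functional avoids fixing a norm on `L`. At `s = 0` this turns invariance under
-- `K` into invariance under `𝔨`.
open scoped Matrix.Norms.Operator in
theorem hasDerivAt_expAd (Z v : L) (f : L →ₗ[ℝ] ℝ) (s : ℝ) :
    HasDerivAt (fun s : ℝ => f (expAd (s • Z) v)) (f (expAd (s • Z) ⁅Z, v⁆)) s := by
  let n := Module.finrank ℝ L
  let b := Module.finBasis ℝ L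
  let A := LinearMap.toMatrix b b (LieAlgebra.ad ℝ L Z)
  let _ : NormedAlgebra ℚ (Matrix (Fin n) (Fin n) ℝ) :=
    NormedAlgebra.restrictScalars ℚ ℝ _
  have hE : HasDerivAt (fun s : ℝ => NormedSpace.exp (s • A)) (NormedSpace.exp (s • A) * A) s :=
    hasDerivAt_exp_smul_const A s
  let ev : Matrix (Fin n) (Fin n) ℝ →ₗ[ℝ] ℝ :=
    f ∘ₗ (LinearMap.applyₗ v) ∘ₗ (Matrix.toLin b b).toLinearMap
  have hev : HasDerivAt (fun s : ℝ => ev (NormedSpace.exp (s • A)))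
      (ev (NormedSpace.exp (s • A) * A)) s :=
    (LinearMap.toContinuousLinearMap ev).hasFDerivAt.comp_hasDerivAt s hE
  have h1 : ∀ s : ℝ, expAd (s • Z) = Matrix.toLin b b (NormedSpace.exp (s • A)) := fun s => by
    simp only [expAd, map_smul, A, b]
  have h2 : ev (NormedSpace.exp (s • A) * A) = f (expAd (s • Z) ⁅Z, v⁆) := by
    rw [h1]
    simp only [ev, LinearMap.comp_apply, LinearEquiv.coe_coe, LinearMap.applyₗ_apply_apply]
    rw [Matrix.toLin_mul b b b, LinearMap.comp_apply]
    simp [A, Matrix.toLin_toMatrix]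
  rw [h2] at hev
  simp only [h1]
  rw [h1] at hev
  exact hev

theorem expAd_zero (v : L) : expAd (0 : L) v = v := by
  simp [expAd]

open scoped Matrix.Norms.Operator in
theorem expAd_neg_apply (Z v : L) : expAd (-Z) (expAd Z v) = v := by
  let n := Module.finrank ℝ L
  let _ : NormedAlgebra ℚ (Matrix (Fin n) (Fin n) ℝ) :=
    NormedAlgebra.restrictScalars ℚ ℝ _
  let A := LinearMap.toMatrix (Module.finBasis ℝ L) (Module.finBasis ℝ L) (LieAlgebra.ad ℝ L Z)
  have h : NormedSpace.exp (-A) * NormedSpace.exp A = 1 := by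
    have := NormedSpace.exp_add_of_commute (Commute.refl A).neg_left
    exact this.symm.trans (by rw [neg_add_cancel, NormedSpace.exp_zero])
  simp only [expAd, map_neg]
  rw [← LinearMap.comp_apply, ← Matrix.toLin_mul]
  change Matrix.toLin _ _ (NormedSpace.exp (-A) * NormedSpace.exp A) v = v
  rw [h, Matrix.toLin_one, LinearMap.id_apply]

/-- `exp (ad Z)` as a linear equivalence. -/
def expAdEquiv (Z : L) : L ≃ₗ[ℝ] L :=
  LinearEquiv.ofLinearMap (expAd Z) (expAd (-Z))
    (by ext v; simpa using expAd_neg_apply (-Z) v) (by ext v; simpa using expAd_neg_apply Z v)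

theorem expAdEquiv_apply (Z v : L) : expAdEquiv Z v = expAd Z v := rfl

/-- Along `s ↦ exp (s ad Z) v` every functional has derivative zero. This puts the exponentials of
`𝔨` into `K`. -/
theorem expAd_eq_self {Z v : L} (h : ⁅Z, v⁆ = 0) : expAd Z v = v := by
  by_contra hne
  obtain ⟨f, hf⟩ : ∃ f : L →ₗ[ℝ] ℝ, f (expAd Z v - v) ≠ 0 := by
    by_contra! hcon
    exact hne (sub_eq_zero.1 ((Module.forall_dual_apply_eq_zero_iff ℝ _).1 hcon))
  have hd : ∀ s : ℝ, HasDerivAt (fun s : ℝ => f (expAd (s • Z) v)) 0 s := fun s => by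
    simpa [h] using hasDerivAt_expAd Z v f s
  have := is_const_of_deriv_eq_zero (fun s => (hd s).differentiableAt) (fun s => (hd s).deriv) 1 0
  simp only [one_smul, zero_smul, expAd_zero] at this
  exact hf (by rw [map_sub, this, sub_self])

end AdjointGroup

/-! ### The reductive decomposition, the form `Q`, and passage from `K` to `𝔨`. -/

variable {L : Type*} [LieRing L] [LieAlgebra ℝ L] [FiniteDimensional ℝ L] (M : FlagManifold L)

theorem expAdEquiv_mem {Z : L} (hZ : Z ∈ M.isotropyAlgebra) :
    expAdEquiv Z ∈ M.isotropyGroup :=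
  ⟨Subgroup.subset_closure ⟨Z, rfl⟩, fun t ht => expAd_eq_self (by
    rw [← lie_skew, hZ t ht, neg_zero])⟩

/-- `X ↦ [Z, X]_𝔭` on `𝔭`. -/
def adProj (Z : L) : Module.End ℝ M.tangent :=
  M.proj ∘ₗ (LieAlgebra.ad ℝ L Z : L →ₗ[ℝ] L) ∘ₗ M.tangent.subtype

theorem adProj_apply (Z : L) (X : M.tangent) : M.adProj Z X = M.proj ⁅Z, (X : L)⁆ := rfl

theorem bracket_apply (X Y : M.tangent) : M.bracket X Y = M.proj ⁅(X : L), (Y : L)⁆ := rfl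

theorem proj_coe (X : M.tangent) : M.proj (X : L) = X :=
  Submodule.projectionOnto_apply_left M.isCompl X

theorem proj_of_mem {v : L} (hv : v ∈ M.tangent) : (M.proj v : L) = v :=
  congrArg Subtype.val (M.proj_coe ⟨v, hv⟩)

theorem proj_eq_zero_iff {v : L} : M.proj v = 0 ↔ v ∈ M.isotropyAlgebra :=
  Submodule.projectionOnto_apply_eq_zero_iff M.isCompl

theorem sub_proj_mem (v : L) : v - M.proj v ∈ M.isotropyAlgebra := by
  rw [← proj_eq_zero_iff, map_sub, proj_coe, sub_self]

theorem killing_comm {L : Type*} [LieRing L] [LieAlgebra ℝ L] (x y : L) :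
    killingForm ℝ L x y = killingForm ℝ L y x :=
  LieModule.traceForm_comm ℝ L L x y

theorem killing_lie {L : Type*} [LieRing L] [LieAlgebra ℝ L] (x y z : L) :
    killingForm ℝ L ⁅x, y⁆ z = killingForm ℝ L x ⁅y, z⁆ :=
  LieModule.traceForm_apply_lie_apply ℝ L L x y z

theorem killing_eq_zero {z x : L} (hz : z ∈ M.isotropyAlgebra) (hx : x ∈ M.tangent) :
    killingForm ℝ L z x = 0 := hx z hz

theorem Q_apply (X Y : M.tangent) : M.Q X Y = -killingForm ℝ L X Y := rfl

theorem Q_proj (v : L) (X : M.tangent) : M.Q (M.proj v) X = -killingForm ℝ L v X := by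
  have := M.killing_eq_zero (M.sub_proj_mem v) X.2
  rw [map_sub, LinearMap.sub_apply, sub_eq_zero] at this
  rw [Q_apply, this]

theorem Q_comm (X Y : M.tangent) : M.Q X Y = M.Q Y X := by
  rw [Q_apply, Q_apply, killing_comm]

theorem Q_pos {X : M.tangent} (hX : X ≠ 0) : 0 < M.Q X X := by
  rw [Q_apply]
  linarith [M.compact X (by simpa using hX)]

theorem Q_self_eq_zero {X : M.tangent} (h : M.Q X X = 0) : X = 0 := by
  by_contra hne
  exact (M.Q_pos hne).ne' h

theorem lie_mem_isotropyAlgebra {y z : L} (hy : y ∈ M.isotropyAlgebra)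
    (hz : z ∈ M.isotropyAlgebra) : ⁅y, z⁆ ∈ M.isotropyAlgebra := fun t ht => by
  rw [leibniz_lie, hy t ht, hz t ht, lie_zero, zero_lie, add_zero]

theorem lie_mem_tangent {z x : L} (hz : z ∈ M.isotropyAlgebra) (hx : x ∈ M.tangent) :
    ⁅z, x⁆ ∈ M.tangent := by
  intro y hy
  change killingForm ℝ L y ⁅z, x⁆ = 0
  rw [← killing_lie]
  exact hx _ (M.lie_mem_isotropyAlgebra hy hz)

theorem torus_le {t : L} (ht : t ∈ M.torus) : t ∈ M.isotropyAlgebra := fun s hs =>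
  M.abelian s hs t ht

theorem coe_adProj {Z : L} (hZ : Z ∈ M.isotropyAlgebra) (X : M.tangent) :
    (M.adProj Z X : L) = ⁅Z, (X : L)⁆ :=
  M.proj_of_mem (M.lie_mem_tangent hZ X.2)

theorem Q_adProj (Z : L) (X Y : M.tangent) : M.Q (M.adProj Z X) Y = -M.Q X (M.adProj Z Y) := by
  rw [adProj_apply, adProj_apply, M.Q_comm X, Q_proj, Q_proj, ← lie_skew, map_neg,
    LinearMap.neg_apply, killing_lie, killing_comm]

theorem adProj_coe (X Y : M.tangent) : M.adProj (X : L) Y = M.bracket X Y := rfl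

/-- `Q` is naturally reductive: the `𝔨`-part of a bracket is orthogonal to `𝔭`, so associativity of
the Killing form survives the projection. -/
theorem Q_bracket (X Y Z : M.tangent) : M.Q (M.bracket X Y) Z = M.Q X (M.bracket Y Z) := by
  rw [M.bracket_swap X Y, map_neg, LinearMap.neg_apply, ← adProj_coe, Q_adProj, neg_neg,
    adProj_coe]

theorem Ad_apply (k : M.isotropyGroup) (X : M.tangent) :
    (M.Ad k X : L) = (k : L ≃ₗ[ℝ] L) X := rfl

theorem Q_Ad (k : M.isotropyGroup) (X Y : M.tangent) : M.Q (M.Ad k X) (M.Ad k Y) = M.Q X Y := by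
  rw [Q_apply, Q_apply, Ad_apply, Ad_apply, killingForm_of_mem_adjointGroup k.2.1]

theorem Ad_mul_inv (k : M.isotropyGroup) (X : M.tangent) : M.Ad k (M.Ad k⁻¹ X) = X := by
  apply Subtype.ext
  rw [Ad_apply, Ad_apply]
  exact (k : L ≃ₗ[ℝ] L).apply_symm_apply X

/-- An `Ad(K)`-invariant subspace of `𝔭` is `ad(𝔨)`-invariant. -/
theorem adProj_mem {q : Submodule ℝ M.tangent} (hq : ∀ k, ∀ X ∈ q, M.Ad k X ∈ q) {Z : L}
    (hZ : Z ∈ M.isotropyAlgebra) {X : M.tangent} (hX : X ∈ q) : M.adProj Z X ∈ q := by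
  by_contra hne
  -- A functional that vanishes on `q` but not on `[Z, X]`: along the orbit of `X`, which stays in
  -- `q`, it is constantly zero, while its derivative at 0 is its value on `[Z, X]`.
  obtain ⟨f, hf, hfq⟩ := Submodule.exists_le_ker_of_notMem hne
  have hd := hasDerivAt_expAd Z X (f ∘ₗ M.proj) 0
  have h0 : (fun s : ℝ => (f ∘ₗ M.proj) (expAd (s • Z) X)) = fun _ => 0 := by
    funext s
    have h1 := hq ⟨_, M.expAdEquiv_mem (M.isotropyAlgebra.smul_mem s hZ)⟩ X hX
    have h2 := hfq h1
    rw [LinearMap.mem_ker] at h2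
    rw [LinearMap.comp_apply, ← h2]
    congr 1
    rw [← M.proj_coe (M.Ad _ X), Ad_apply, expAdEquiv_apply]
  rw [h0, zero_smul, expAd_zero] at hd
  exact hf (hd.unique (hasDerivAt_const 0 0))

/-- An `Ad(K)`-invariant form on `𝔭` is `ad(𝔨)`-invariant. -/
theorem invariant_adProj {b : LinearMap.BilinForm ℝ M.tangent}
    (hb : ∀ k X Y, b (M.Ad k X) (M.Ad k Y) = b X Y) {Z : L}
    (hZ : Z ∈ M.isotropyAlgebra) (X Y : M.tangent) :
    b (M.adProj Z X) Y = -b X (M.adProj Z Y) := by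
  have hd := hasDerivAt_expAd Z X (b.flip Y ∘ₗ M.proj) 0
  have hd' := hasDerivAt_expAd (-Z) Y (b X ∘ₗ M.proj) 0
  -- Invariance moves `exp (s ad Z)` to the second argument as its inverse; comparing derivatives at
  -- `s = 0` gives skewness.
  have h0 : (fun s : ℝ => (b.flip Y ∘ₗ M.proj) (expAd (s • Z) X)) =
      fun s : ℝ => (b X ∘ₗ M.proj) (expAd (s • -Z) Y) := by
    funext s
    let k : M.isotropyGroup := ⟨_, M.expAdEquiv_mem (M.isotropyAlgebra.smul_mem s hZ)⟩
    have hk : ∀ W : M.tangent, M.Ad k W = M.proj (expAd (s • Z) W) := fun W => by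
      rw [← M.proj_coe (M.Ad _ W), Ad_apply, expAdEquiv_apply]
    let k' : M.isotropyGroup := ⟨_, M.expAdEquiv_mem (M.isotropyAlgebra.smul_mem (-s) hZ)⟩
    have hk' : ∀ W : M.tangent, M.Ad k' W = M.proj (expAd (s • -Z) W) := fun W => by
      rw [← M.proj_coe (M.Ad _ W), Ad_apply, expAdEquiv_apply, smul_neg, neg_smul]
    simp only [LinearMap.comp_apply, LinearMap.BilinForm.flip_apply]
    rw [← hk, ← hk', ← hb k X]
    congr 1
    apply Subtype.ext
    have := expAd_neg_apply (-(s • Z)) (Y : L)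
    rw [neg_neg] at this
    rw [Ad_apply, Ad_apply, expAdEquiv_apply, expAdEquiv_apply, neg_smul, this]
  rw [h0] at hd
  have := hd.unique hd'
  simp only [zero_smul, expAd_zero, LinearMap.comp_apply, LinearMap.BilinForm.flip_apply, neg_lie,
    map_neg] at this
  exact this

variable {M} in
/-- Schur's lemma for invariant symmetric forms on an irreducible summand. -/
theorem IsIrreducibleSummand.exists_eq_smul_Q {p : Submodule ℝ M.tangent}
    (hp : M.IsIrreducibleSummand p) (b : LinearMap.BilinForm ℝ M.tangent)
    (hs : ∀ X ∈ p, ∀ Y ∈ p, b X Y = b Y X)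
    (hb : ∀ k, ∀ X ∈ p, ∀ Y ∈ p, b (M.Ad k X) (M.Ad k Y) = b X Y) :
    ∃ l : ℝ, ∀ X ∈ p, ∀ Y ∈ p, b X Y = l * M.Q X Y := by
  refine exists_eq_smul_of_irreducible M.Q b M.Q_comm (fun X => M.Q_pos) p hp.1 hs ?_
  intro q hq l hl
  refine hp.2.2 q hq fun k X hX => ?_
  obtain ⟨h1, h2⟩ := (hl X).1 hX
  refine (hl _).2 ⟨hp.2.1 k X h1, fun Y hY => ?_⟩
  have hY' := hp.2.1 k⁻¹ Y hY
  rw [← M.Ad_mul_inv k Y, hb k X h1 _ hY', Q_Ad, h2 _ hY']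

end

/-! ### Torus weights on the isotropy summands. -/

section

variable {L : Type*} [LieRing L] [LieAlgebra ℝ L] [FiniteDimensional ℝ L] (M : FlagManifold L)

theorem adProj_proj {Z : L} (hZ : Z ∈ M.isotropyAlgebra) (v : L) :
    M.adProj Z (M.proj v) = M.proj ⁅Z, v⁆ := by
  have h := M.proj_eq_zero_iff.2 (M.lie_mem_isotropyAlgebra hZ (M.sub_proj_mem v))
  rw [lie_sub, map_sub, sub_eq_zero] at h
  rw [adProj_apply, h]

theorem adProj_bracket {Z : L} (hZ : Z ∈ M.isotropyAlgebra) (X Y : M.tangent) :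
    M.adProj Z (M.bracket X Y) = M.bracket (M.adProj Z X) Y + M.bracket X (M.adProj Z Y) := by
  rw [bracket_apply, adProj_proj M hZ, bracket_apply, bracket_apply, coe_adProj M hZ,
    coe_adProj M hZ, ← map_add, leibniz_lie]

/-- Elements of `K` fix the torus pointwise. Hence the form `Q([t, ·], [t, ·])` is `Ad(K)`-invariant
and Schur's lemma applies to it. -/
theorem Ad_adProj {t : L} (ht : t ∈ M.torus) (k : M.isotropyGroup) (X : M.tangent) :
    M.Ad k (M.adProj t X) = M.adProj t (M.Ad k X) := by
  apply Subtype.ext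
  rw [Ad_apply, coe_adProj M (M.torus_le ht), coe_adProj M (M.torus_le ht), Ad_apply,
    lie_of_mem_adjointGroup k.2.1, k.2.2 t ht]

theorem adProj_torus_comm {t Z : L} (ht : t ∈ M.torus) (hZ : Z ∈ M.isotropyAlgebra)
    (X : M.tangent) : M.adProj t (M.adProj Z X) = M.adProj Z (M.adProj t X) := by
  apply Subtype.ext
  rw [coe_adProj M (M.torus_le ht), coe_adProj M hZ, coe_adProj M hZ,
    coe_adProj M (M.torus_le ht), leibniz_lie, hZ t ht, zero_lie, zero_add]

variable {M} in
/-- An element of the torus acts on an irreducible summand with a single squared weight. -/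
theorem IsIrreducibleSummand.exists_weight_sq {q : Submodule ℝ M.tangent}
    (hq : M.IsIrreducibleSummand q) {t : L} (ht : t ∈ M.torus) :
    ∃ a : ℝ, 0 ≤ a ∧ (∀ X ∈ q, M.adProj t (M.adProj t X) = -(a ^ 2) • X) ∧
      (a = 0 → ∀ X ∈ q, M.adProj t X = 0) := by
  -- Since `ad t` is `Q`-skew, this form is represented by `-(ad t)²`, so the Schur scalar `l` is
  -- nonnegative and the weight is `√l`.
  obtain ⟨l, hl⟩ := hq.exists_eq_smul_Q (M.Q.compl₁₂ (M.adProj t) (M.adProj t))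
    (fun X _ Y _ => M.Q_comm _ _) (fun k X _ Y _ => by
      simp only [LinearMap.compl₁₂_apply]
      rw [← M.Ad_adProj ht, ← M.Ad_adProj ht, Q_Ad])
  simp only [LinearMap.compl₁₂_apply] at hl
  have hl0 : 0 ≤ l := by
    obtain ⟨X, hX, hX0⟩ := Submodule.exists_mem_ne_zero_of_ne_bot hq.1
    have h1 := hl X hX X hX
    have h2 := M.Q_pos hX0
    have h3 : 0 ≤ M.Q (M.adProj t X) (M.adProj t X) := by
      rcases eq_or_ne (M.adProj t X) 0 with h | h
      · simp [h]
      · exact (M.Q_pos h).le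
    rw [h1] at h3
    exact nonneg_of_mul_nonneg_left h3 h2
  refine ⟨√l, Real.sqrt_nonneg l, fun X hX => ?_, fun h0 X hX => ?_⟩
  · rw [Real.sq_sqrt hl0]
    have hD : ∀ X ∈ q, M.adProj t X ∈ q := fun X hX =>
      M.adProj_mem hq.2.1 (M.torus_le ht) hX
    rw [neg_smul, ← sub_eq_zero, sub_neg_eq_add]
    refine M.Q_self_eq_zero ?_
    have hmem : M.adProj t (M.adProj t X) + l • X ∈ q :=
      q.add_mem (hD _ (hD _ hX)) (q.smul_mem l hX)
    have horth : ∀ W ∈ q, M.Q (M.adProj t (M.adProj t X) + l • X) W = 0 := fun W hW => by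
      rw [map_add, LinearMap.add_apply, Q_adProj, hl X hX W hW, map_smul, LinearMap.smul_apply,
        smul_eq_mul, neg_add_cancel]
    exact horth _ hmem
  · rw [Real.sqrt_eq_zero hl0] at h0
    refine M.Q_self_eq_zero ?_
    rw [hl X hX X hX, h0, zero_mul]

/-- A vector killed by the whole torus lies in `𝔨`, and `𝔨 ∩ 𝔭 = 0`. -/
theorem exists_torus_adProj_ne_zero {q : Submodule ℝ M.tangent}
    (hq : M.IsIrreducibleSummand q) : ∃ t ∈ M.torus, ∃ X ∈ q, M.adProj t X ≠ 0 := by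
  by_contra! h
  obtain ⟨X, hX, hX0⟩ := Submodule.exists_mem_ne_zero_of_ne_bot hq.1
  have hk : (X : L) ∈ M.isotropyAlgebra := fun t ht => by
    rw [← coe_adProj M (M.torus_le ht), h t ht X hX, ZeroMemClass.coe_zero]
  apply hX0
  rw [← M.proj_coe X, M.proj_eq_zero_iff.2 hk]

theorem adProj_add (s t : L) (X : M.tangent) :
    M.adProj (s + t) X = M.adProj s X + M.adProj t X := by
  simp [adProj_apply]

theorem adProj_smul (c : ℝ) (t : L) (X : M.tangent) :
    M.adProj (c • t) X = c • M.adProj t X := by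
  simp [adProj_apply]

/-- Choose `s` moving a vector of `q₁` and `t` moving a vector of `q₂`. If neither moves both chosen
vectors, then `s + t` does. -/
theorem exists_torus_weights {q₁ q₂ : Submodule ℝ M.tangent}
    (h₁ : M.IsIrreducibleSummand q₁) (h₂ : M.IsIrreducibleSummand q₂) :
    ∃ s ∈ M.torus, ∃ a b : ℝ, 0 < a ∧ 0 < b ∧
      (∀ X ∈ q₁, M.adProj s (M.adProj s X) = -(a ^ 2) • X) ∧
      (∀ X ∈ q₂, M.adProj s (M.adProj s X) = -(b ^ 2) • X) := by
  have key : ∃ s ∈ M.torus, (∃ X ∈ q₁, M.adProj s X ≠ 0) ∧ ∃ X ∈ q₂, M.adProj s X ≠ 0 := by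
    obtain ⟨s, hs, X, hX, hX0⟩ := M.exists_torus_adProj_ne_zero h₁
    obtain ⟨t, ht, Y, hY, hY0⟩ := M.exists_torus_adProj_ne_zero h₂
    by_cases hsY : M.adProj s Y = 0
    · by_cases htX : M.adProj t X = 0
      · refine ⟨s + t, M.torus.add_mem hs ht, ⟨X, hX, ?_⟩, Y, hY, ?_⟩
        · rwa [adProj_add, htX, add_zero]
        · rwa [adProj_add, hsY, zero_add]
      · exact ⟨t, ht, ⟨X, hX, htX⟩, Y, hY, hY0⟩
    · exact ⟨s, hs, ⟨X, hX, hX0⟩, Y, hY, hsY⟩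
  obtain ⟨s, hs, ⟨X, hX, hX0⟩, Y, hY, hY0⟩ := key
  obtain ⟨a, ha, h3, h4⟩ := h₁.exists_weight_sq hs
  obtain ⟨b, hb, h5, h6⟩ := h₂.exists_weight_sq hs
  exact ⟨s, hs, a, b, ha.lt_of_ne fun h => hX0 (h4 h.symm X hX),
    hb.lt_of_ne fun h => hY0 (h6 h.symm Y hY), h3, h5⟩

/-- The bracket of two weight vectors is a combination of vectors of weights `a ± b`. -/
theorem adProj_sq_bracket {s : L} (hs : s ∈ M.torus) {a b : ℝ} {X Y : M.tangent}
    (hX : M.adProj s (M.adProj s X) = -(a ^ 2) • X)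
    (hY : M.adProj s (M.adProj s Y) = -(b ^ 2) • Y) :
    M.adProj s (M.adProj s ((a * b) • M.bracket X Y + M.bracket (M.adProj s X) (M.adProj s Y))) =
      -((a - b) ^ 2) • ((a * b) • M.bracket X Y + M.bracket (M.adProj s X) (M.adProj s Y)) := by
  -- The derivation rule acts as the product-to-sum formula for cosines: this combination isolates
  -- weight `a - b`, and replacing `a` by `-a` isolates weight `a + b`.
  simp only [map_add, map_smul, M.adProj_bracket (M.torus_le hs), hX, hY, LinearMap.smul_apply]
  module

/-- A simple `L` admits no splitting `𝔭 = r₁ ⊕ r₂` with `[r₁, 𝔭] ⊆ 𝔨`. -/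
theorem false_of_bracket_eq_zero {q : Submodule ℝ M.tangent} (hq : q ≠ ⊥) (hq' : q ≠ ⊤)
    (hqk : ∀ Z ∈ M.isotropyAlgebra, ∀ X ∈ q, M.adProj Z X ∈ q)
    (hbr : ∀ X ∈ q, ∀ Y, M.bracket X Y = 0) : False := by
  have hk : ∀ X ∈ q, ∀ Y : M.tangent, ⁅(X : L), (Y : L)⁆ ∈ M.isotropyAlgebra := fun X hX Y =>
    M.proj_eq_zero_iff.1 (hbr X hX Y)
  let r : Submodule ℝ M.tangent := M.Q.orthogonal q
  have hcompl : IsCompl q r := by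
    rw [LinearMap.BilinForm.isCompl_orthogonal_iff_disjoint
      (fun X Y h => by rw [M.Q_comm, h]), Submodule.disjoint_def]
    exact fun X hX hX' => M.Q_self_eq_zero (hX' X hX)
  -- With `Z = [X, Y] ∈ 𝔨` one has `B(Z, Z) = B([Z, X], Y) = 0`, because `[Z, X]` stays in `q`,
  -- which is orthogonal to `r`.
  have hlie : ∀ X ∈ q, ∀ Y ∈ r, ⁅(X : L), (Y : L)⁆ = 0 := by
    intro X hX Y hY
    by_contra hne
    refine (M.compact _ hne).ne ?_
    have h1 := hqk _ (hk X hX Y) X hX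
    have h2 : M.Q (M.adProj ⁅(X : L), (Y : L)⁆ X) Y = 0 := hY _ h1
    rw [Q_apply, coe_adProj M (hk X hX Y), killing_lie] at h2
    linarith
  let G : Set L := {v | ∃ X ∈ q, ∃ X' ∈ q, v = ⁅(X : L), (X' : L)⁆}
  -- The candidate ideal is `q + [q, q]`. It is stable under `𝔨` and `q`, and `r` commutes with `q`.
  let S : Submodule ℝ L := q.map M.tangent.subtype ⊔ Submodule.span ℝ G
  have hqS : ∀ X ∈ q, (X : L) ∈ S := fun X hX =>
    Submodule.mem_sup_left (Submodule.mem_map_of_mem hX)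
  have hGS : ∀ X ∈ q, ∀ X' ∈ q, ⁅(X : L), (X' : L)⁆ ∈ S := fun X hX X' hX' =>
    Submodule.mem_sup_right (Submodule.subset_span ⟨X, hX, X', hX', rfl⟩)
  have hdec : ∀ y : L, ∃ z ∈ M.isotropyAlgebra, ∃ X ∈ q, ∃ Y ∈ r, y = z + X + Y := by
    intro y
    obtain ⟨X, hX, Y, hY, hXY⟩ := Submodule.mem_sup.1
      (hcompl.sup_eq_top ▸ Submodule.mem_top : M.proj y ∈ q ⊔ r)
    refine ⟨_, M.sub_proj_mem y, X, hX, Y, hY, ?_⟩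
    rw [← hXY]; push_cast; abel
  have hkq : ∀ z ∈ M.isotropyAlgebra, ∀ X ∈ q, ∃ X' ∈ q, (X' : L) = ⁅z, (X : L)⁆ :=
    fun z hz X hX => ⟨_, hqk z hz X hX, coe_adProj M hz X⟩
  have hlie' : ∀ X ∈ q, ∀ Y ∈ r, ⁅(Y : L), (X : L)⁆ = 0 := fun X hX Y hY => by
    rw [← lie_skew, hlie X hX Y hY, neg_zero]
  have hS1 : ∀ y : L, ∀ X ∈ q, ⁅y, (X : L)⁆ ∈ S := by
    intro y X hX
    obtain ⟨z, hz, X', hX', Y, hY, rfl⟩ := hdec y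
    obtain ⟨W, hW, hW'⟩ := hkq z hz X hX
    rw [add_lie, add_lie, ← hW', hlie' X hX Y hY, add_zero]
    exact S.add_mem (hqS W hW) (hGS X' hX' X hX)
  have hS2 : ∀ y : L, ∀ X ∈ q, ∀ X' ∈ q, ⁅⁅y, (X : L)⁆, (X' : L)⁆ ∈ S := by
    intro y X hX X' hX'
    obtain ⟨z, hz, X'', hX'', Y, hY, rfl⟩ := hdec y
    obtain ⟨W, hW, hW'⟩ := hkq z hz X hX
    obtain ⟨U, hU, hU'⟩ := hkq _ (hk X'' hX'' X) X' hX'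
    rw [add_lie, add_lie z, ← hW', hlie' X hX Y hY, add_lie, add_lie, zero_lie, add_zero, ← hU']
    exact S.add_mem (hGS W hW X' hX') (hqS U hU)
  let I : LieIdeal ℝ L :=
    { S with
      lie_mem := by
        intro y v hv
        change v ∈ S at hv
        change ⁅y, v⁆ ∈ S
        obtain ⟨u, hu, w, hw, rfl⟩ := Submodule.mem_sup.1 hv
        rw [lie_add]
        refine S.add_mem ?_ ?_
        · obtain ⟨X, hX, rfl⟩ := hu
          exact hS1 y X hX
        · induction hw using Submodule.span_induction with
          | mem w hw =>
            obtain ⟨X, hX, X', hX', rfl⟩ := hw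
            rw [leibniz_lie, ← lie_skew (X : L) ⁅y, (X' : L)⁆]
            exact S.add_mem (hS2 y X hX X' hX') (S.neg_mem (hS2 y X' hX' X hX))
          | zero => rw [lie_zero]; exact S.zero_mem
          | add w w' h1 h2 h3 h4 =>
            rw [lie_add]
            exact S.add_mem (h3 (Submodule.mem_sup.2 ⟨u, hu, w, h1, rfl⟩))
              (h4 (Submodule.mem_sup.2 ⟨u, hu, w', h2, rfl⟩))
          | smul c w h1 h2 =>
            rw [lie_smul]
            exact S.smul_mem c (h2 (Submodule.mem_sup.2 ⟨u, hu, w, h1, rfl⟩)) }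
  have hIS : ∀ v, v ∈ I ↔ v ∈ S := fun v => Iff.rfl
  rcases M.simple.eq_bot_or_eq_top I with h | h
  · obtain ⟨X, hX, hX0⟩ := Submodule.exists_mem_ne_zero_of_ne_bot hq
    have := (hIS X).2 (hqS X hX)
    rw [h, LieSubmodule.mem_bot] at this
    exact hX0 (by simpa using this)
  -- The ideal is Killing-orthogonal to `r`, since `[q, q] ⊆ 𝔨`; were it all of `L`, a nonzero `Y ∈
  -- r` would be orthogonal to itself.
  · have hr : r ≠ ⊥ := fun h0 => hq' (by simpa [h0] using hcompl.sup_eq_top)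
    obtain ⟨Y, hY, hY0⟩ := Submodule.exists_mem_ne_zero_of_ne_bot hr
    have hYS : (Y : L) ∈ S := (hIS Y).1 (h ▸ LieSubmodule.mem_top _)
    have hS : S ≤ LinearMap.ker ((killingForm ℝ L).flip Y) := by
      refine sup_le ?_ (Submodule.span_le.2 ?_)
      · rintro _ ⟨X, hX, rfl⟩
        have : M.Q X Y = 0 := hY X hX
        rw [Q_apply] at this
        simpa using this
      · rintro _ ⟨X, hX, X', hX', rfl⟩
        simpa using M.killing_eq_zero (hk X hX X') Y.2
    have := hS hYS
    rw [LinearMap.mem_ker] at this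
    exact (M.compact Y (by simpa using hY0)).ne (by simpa using this)

/-- A splitting of `𝔭` into two irreducible summands, on which `s` in the torus has the
weights `±1` and `±2`. -/
structure IsWeightSplitting (p₁ p₂ : Submodule ℝ M.tangent) (s : L) : Prop where
  irr₁ : M.IsIrreducibleSummand p₁
  irr₂ : M.IsIrreducibleSummand p₂
  compl : IsCompl p₁ p₂
  mem : s ∈ M.torus
  sq₁ : ∀ X ∈ p₁, M.adProj s (M.adProj s X) = -X
  sq₂ : ∀ Y ∈ p₂, M.adProj s (M.adProj s Y) = (-4 : ℝ) • Y

theorem eq_zero_of_adProj_sq {q₁ q₂ : Submodule ℝ M.tangent} (hq : IsCompl q₁ q₂) {s : L}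
    {m a b : ℝ} (ha : ∀ X ∈ q₁, M.adProj s (M.adProj s X) = -a • X)
    (hb : ∀ X ∈ q₂, M.adProj s (M.adProj s X) = -b • X) {W : M.tangent}
    (hW : M.adProj s (M.adProj s W) = -m • W) :
    (m ≠ a → W ∈ q₂) ∧ (m ≠ b → W ∈ q₁) := by
  obtain ⟨X, hX, Y, hY, rfl⟩ := Submodule.mem_sup.1
    (hq.sup_eq_top ▸ Submodule.mem_top : W ∈ q₁ ⊔ q₂)
  rw [map_add, map_add, ha X hX, hb Y hY] at hW
  have h0 : (m - a) • X + (m - b) • Y = 0 := by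
    rw [← sub_eq_zero] at hW
    rw [← hW]; module
  have hXY : (m - a) • X = 0 ∧ (m - b) • Y = 0 := by
    have hXq : (m - a) • X ∈ q₁ := q₁.smul_mem _ hX
    have hYq : (m - b) • Y ∈ q₂ := q₂.smul_mem _ hY
    have h1 : (m - a) • X ∈ q₂ := by
      rw [eq_neg_of_add_eq_zero_left h0]; exact q₂.neg_mem hYq
    have h2 := (Submodule.disjoint_def.1 hq.disjoint) _ hXq h1
    exact ⟨h2, by rwa [h2, zero_add] at h0⟩
  constructor
  · intro hm
    rw [(smul_eq_zero.1 hXY.1).resolve_left (sub_ne_zero.2 hm), zero_add]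
    exact hY
  · intro hm
    rw [(smul_eq_zero.1 hXY.2).resolve_left (sub_ne_zero.2 hm), add_zero]
    exact hX

/-- Brackets with `q₁` can only have weights `0`, `2a`, `|a - b|`, `a + b`. One of these equals `a`
or `b` only if `b = 2a` or `a = 2b`; otherwise `[q₁, 𝔭]_𝔭 = 0`, against simplicity. -/
theorem weight_ratio {q₁ q₂ : Submodule ℝ M.tangent}
    (h₁ : M.IsIrreducibleSummand q₁) (h₂ : M.IsIrreducibleSummand q₂) (hq : IsCompl q₁ q₂)
    {s : L} (hs : s ∈ M.torus) {a b : ℝ} (ha : 0 < a) (hb : 0 < b)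
    (hX : ∀ X ∈ q₁, M.adProj s (M.adProj s X) = -(a ^ 2) • X)
    (hY : ∀ X ∈ q₂, M.adProj s (M.adProj s X) = -(b ^ 2) • X) : b = 2 * a ∨ a = 2 * b := by
  by_contra! hne
  have hz : ∀ {m : ℝ} {W : M.tangent}, M.adProj s (M.adProj s W) = -m • W → m ≠ a ^ 2 →
      m ≠ b ^ 2 → W = 0 := fun hW h3 h4 =>
    (Submodule.disjoint_def.1 hq.disjoint) _ ((M.eq_zero_of_adProj_sq hq hX hY hW).2 h4)
      ((M.eq_zero_of_adProj_sq hq hX hY hW).1 h3)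
  have key : ∀ X ∈ q₁, ∀ (Y : M.tangent) (c : ℝ), 0 < c →
      M.adProj s (M.adProj s Y) = -(c ^ 2) • Y → (a - c) ^ 2 ≠ a ^ 2 → (a - c) ^ 2 ≠ b ^ 2 →
      (a + c) ^ 2 ≠ a ^ 2 → (a + c) ^ 2 ≠ b ^ 2 → M.bracket X Y = 0 := by
    intro X hX' Y c hc hYc h3 h4 h5 h6
    have e1 := hz (M.adProj_sq_bracket hs (hX X hX') hYc) h3 h4
    -- The sign change gives the component of weight `a + c`; the difference of the two vanishing
    -- combinations is `2ac [X, Y]_𝔭`.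
    have e2 := hz (M.adProj_sq_bracket hs (a := -a) (by rw [neg_sq]; exact hX X hX') hYc)
      (by convert h5 using 1; ring) (by convert h6 using 1; ring)
    have e3 : (2 * (a * c)) • M.bracket X Y = 0 := by
      rw [show (0 : M.tangent) = 0 - 0 by rw [sub_zero]]
      nth_rewrite 1 [← e1]
      rw [← e2]; module
    exact (smul_eq_zero.1 e3).resolve_left (by positivity)
  have sqne : ∀ x y : ℝ, x ≠ y → x ≠ -y → x ^ 2 ≠ y ^ 2 := fun x y h3 h4 h5 =>
    (sq_eq_sq_iff_eq_or_eq_neg.1 h5).elim h3 h4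
  refine M.false_of_bracket_eq_zero h₁.1 ?_ (fun Z hZ X hX => M.adProj_mem h₁.2.1 hZ hX) ?_
  · rintro rfl
    exact h₂.1 (by simpa using hq.inf_eq_bot)
  · intro X hX' Y
    obtain ⟨X', hX'', Y', hY', rfl⟩ := Submodule.mem_sup.1
      (hq.sup_eq_top ▸ Submodule.mem_top : Y ∈ q₁ ⊔ q₂)
    rw [map_add, key X hX' X' a ha (hX X' hX''), key X hX' Y' b hb (hY Y' hY'), add_zero]
    all_goals apply sqne
    all_goals first
      | (intro h; linarith)
      | (intro h; apply hne.1; linarith)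
      | (intro h; apply hne.2; linarith)

/-- The summand with the smaller weight becomes `p₁`, and `s` is divided by that weight. -/
theorem exists_isWeightSplitting {q₁ q₂ : Submodule ℝ M.tangent}
    (h₁ : M.IsIrreducibleSummand q₁) (h₂ : M.IsIrreducibleSummand q₂) (hq : IsCompl q₁ q₂) :
    (∃ s, M.IsWeightSplitting q₁ q₂ s) ∨ ∃ s, M.IsWeightSplitting q₂ q₁ s := by
  obtain ⟨s, hs, a, b, ha, hb, hX, hY⟩ := M.exists_torus_weights h₁ h₂
  rcases M.weight_ratio h₁ h₂ hq hs ha hb hX hY with rfl | rfl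
  · refine Or.inl ⟨a⁻¹ • s, h₁, h₂, hq, M.torus.smul_mem _ hs, fun X hX' => ?_, fun Y hY' => ?_⟩
    · rw [adProj_smul, adProj_smul, map_smul, hX X hX', smul_smul, smul_smul]
      rw [show a⁻¹ * a⁻¹ * -a ^ 2 = -1 by field_simp, neg_one_smul]
    · rw [adProj_smul, adProj_smul, map_smul, hY Y hY', smul_smul, smul_smul]
      congr 1; field_simp; norm_num
  · refine Or.inr ⟨b⁻¹ • s, h₂, h₁, hq.symm, M.torus.smul_mem _ hs, fun X hX' => ?_,
      fun Y hY' => ?_⟩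
    · rw [adProj_smul, adProj_smul, map_smul, hY X hX', smul_smul, smul_smul]
      rw [show b⁻¹ * b⁻¹ * -b ^ 2 = -1 by field_simp, neg_one_smul]
    · rw [adProj_smul, adProj_smul, map_smul, hX Y hY', smul_smul, smul_smul]
      congr 1; field_simp; norm_num

end

/-! ### Orthonormal bases, and the Killing form as a sum of squares of brackets. -/

section

section OrthonormalFamilies

variable {V : Type*} [AddCommGroup V] [Module ℝ V] {ι : Type*} [Fintype ι] [DecidableEq ι]

theorem parseval_of_mem_span (Q : LinearMap.BilinForm ℝ V) (hs : ∀ X Y, Q X Y = Q Y X) (v : ι → V)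
    (hv : ∀ i j, Q (v i) (v j) = if i = j then 1 else 0) {X : V}
    (hX : X ∈ Submodule.span ℝ (Set.range v)) (Y : V) :
    Q X Y = ∑ i, Q X (v i) * Q Y (v i) := by
  induction hX using Submodule.span_induction with
  | mem X h =>
    obtain ⟨j, rfl⟩ := h
    simp [hv, hs Y]
  | zero => simp
  | add X X' _ _ h h' => simp [h, h', add_mul, Finset.sum_add_distrib]
  | smul c X _ h => simp [h, Finset.mul_sum, mul_assoc]

theorem trace_eq_sum_of_orthonormal [FiniteDimensional ℝ V] (Q : LinearMap.BilinForm ℝ V)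
    (v : ι → V)
    (hv : ∀ i j, Q (v i) (v j) = if i = j then 1 else 0)
    (hsp : Submodule.span ℝ (Set.range v) = ⊤) (T : Module.End ℝ V) :
    LinearMap.trace ℝ V T = ∑ i, Q (T (v i)) (v i) := by
  have hli : LinearIndependent ℝ v := by
    rw [Fintype.linearIndependent_iff]
    intro g hg j
    have := congrArg (fun X => Q X (v j)) hg
    simpa [hv] using this
  let b := Module.Basis.mk hli hsp.ge
  rw [LinearMap.trace_eq_matrix_trace ℝ b, Matrix.trace]
  refine Finset.sum_congr rfl fun i _ => ?_
  rw [Matrix.diag_apply, LinearMap.toMatrix_apply]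
  have h1 : ∀ X, b.repr X i = Q X (v i) := fun X => by
    conv_rhs => rw [← b.sum_repr X]
    simp [b, hv]
  rw [h1]; simp [b]

theorem exists_orthonormal [FiniteDimensional ℝ V] (Q : LinearMap.BilinForm ℝ V)
    (hs : ∀ X Y, Q X Y = Q Y X) (hp : ∀ X, X ≠ 0 → 0 < Q X X) :
    ∃ v : Fin (Module.finrank ℝ V) → V, (∀ i j, Q (v i) (v j) = if i = j then 1 else 0) ∧
      Submodule.span ℝ (Set.range v) = ⊤ := by
  let c : InnerProductSpace.Core ℝ V :=
    { inner := fun X Y => Q X Y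
      conj_inner_symm := fun X Y => by simpa using hs Y X
      re_inner_nonneg := fun X => by
        rcases eq_or_ne X 0 with rfl | h
        · simp
        · simpa using (hp X h).le
      add_left := fun X Y Z => by simp
      smul_left := fun X Y r => by simp
      definite := fun X h => by
        by_contra hne
        exact (hp X hne).ne' h }
  let _ : NormedAddCommGroup V := c.toNormedAddCommGroup
  let _ : InnerProductSpace ℝ V := InnerProductSpace.ofCore c.toCore
  let b := stdOrthonormalBasis ℝ V
  refine ⟨b, fun i j => ?_, ?_⟩
  · exact (orthonormal_iff_ite.1 b.orthonormal) i j
  · have := b.toBasis.span_eq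
    rwa [b.coe_toBasis] at this

theorem exists_orthonormal_submodule [FiniteDimensional ℝ V] (Q : LinearMap.BilinForm ℝ V)
    (hs : ∀ X Y, Q X Y = Q Y X) (hp : ∀ X, X ≠ 0 → 0 < Q X X) (p : Submodule ℝ V) :
    ∃ v : Fin (Module.finrank ℝ p) → V, (∀ i j, Q (v i) (v j) = if i = j then 1 else 0) ∧
      Submodule.span ℝ (Set.range v) = p := by
  obtain ⟨v, hv, hsp⟩ := exists_orthonormal (Q.restrict p) (fun X Y => hs X Y)
    (fun X hX => hp X (by simpa using hX))
  refine ⟨fun i => v i, fun i j => hv i j, ?_⟩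
  have := congrArg (Submodule.map p.subtype) hsp
  rw [Submodule.map_span, Submodule.map_top, Submodule.range_subtype, ← Set.range_comp] at this
  exact this

end OrthonormalFamilies

variable {L : Type*} [LieRing L] [LieAlgebra ℝ L] [FiniteDimensional ℝ L] (M : FlagManifold L)

theorem exists_isOrthonormalBasisOf (p : Submodule ℝ M.tangent) :
    ∃ e : Fin (Module.finrank ℝ p) → M.tangent, M.IsOrthonormalBasisOf e p :=
  exists_orthonormal_submodule M.Q M.Q_comm (fun _ => M.Q_pos) p

variable {M} in
theorem IsOrthonormalBasisOf.mem {ι : Type*} [DecidableEq ι] {e : ι → M.tangent}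
    {p : Submodule ℝ M.tangent} (he : M.IsOrthonormalBasisOf e p) (i : ι) : e i ∈ p :=
  he.2 ▸ Submodule.subset_span ⟨i, rfl⟩

variable {M} in
theorem IsOrthonormalBasisOf.parseval {ι : Type*} [Fintype ι] [DecidableEq ι] {e : ι → M.tangent}
    {p : Submodule ℝ M.tangent} (he : M.IsOrthonormalBasisOf e p) {X : M.tangent} (hX : X ∈ p)
    (Y : M.tangent) : M.Q X Y = ∑ i, M.Q X (e i) * M.Q Y (e i) :=
  parseval_of_mem_span M.Q M.Q_comm e he.1 (he.2.symm ▸ hX) Y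

variable {M} in
theorem IsOrthonormalBasisOf.trace_eq {ι : Type*} [Fintype ι] [DecidableEq ι] {e : ι → M.tangent}
    (he : M.IsOrthonormalBasisOf e ⊤) (T : Module.End ℝ M.tangent) :
    LinearMap.trace ℝ M.tangent T = ∑ i, M.Q (T (e i)) (e i) :=
  trace_eq_sum_of_orthonormal M.Q e he.1 he.2 T

/-- The form `-B` on the whole Lie algebra. -/
def negKilling : LinearMap.BilinForm ℝ L := -killingForm ℝ L

theorem negKilling_apply {L : Type*} [LieRing L] [LieAlgebra ℝ L] (x y : L) :
    negKilling x y = -killingForm ℝ L x y := rfl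

theorem negKilling_comm {L : Type*} [LieRing L] [LieAlgebra ℝ L] (x y : L) :
    negKilling x y = negKilling y x := by
  rw [negKilling_apply, negKilling_apply, killing_comm]

theorem negKilling_lie {L : Type*} [LieRing L] [LieAlgebra ℝ L] (x y z : L) :
    negKilling ⁅x, y⁆ z = negKilling x ⁅y, z⁆ := by
  rw [negKilling_apply, negKilling_apply, killing_lie]

theorem negKilling_proj (v : L) (X : M.tangent) : negKilling v (X : L) = M.Q (M.proj v) X := by
  rw [Q_proj, negKilling_apply]

theorem negKilling_ext (M : FlagManifold L) (x y : L) (h : ∀ z, negKilling x z = negKilling y z) : x = y := by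
  by_contra hne
  have h1 := h (x - y)
  rw [← sub_eq_zero, ← LinearMap.sub_apply, ← map_sub, negKilling_apply, neg_eq_zero] at h1
  exact (M.compact _ (sub_ne_zero.2 hne)).ne h1

/-- The Killing form as a sum over an orthonormal basis adapted to `L = 𝔭 ⊕ 𝔨`. -/
theorem negKilling_eq_sum {ι κ : Type*} [Fintype ι] [DecidableEq ι] [Fintype κ] [DecidableEq κ]
    {e : ι → M.tangent} (he : M.IsOrthonormalBasisOf e ⊤) {z : κ → L}
    (hz : ∀ i j, negKilling (z i) (z j) = if i = j then 1 else 0)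
    (hz' : Submodule.span ℝ (Set.range z) = M.isotropyAlgebra) (x y : L) :
    negKilling x y = ∑ i, negKilling ⁅x, (e i : L)⁆ ⁅y, (e i : L)⁆ +
      ∑ j, negKilling ⁅x, z j⁆ ⁅y, z j⁆ := by
  have hzm : ∀ j, z j ∈ M.isotropyAlgebra := fun j => hz' ▸ Submodule.subset_span ⟨j, rfl⟩
  let v : ι ⊕ κ → L := Sum.elim (fun i => (e i : L)) z
  have horth : ∀ i j, negKilling (z j) (e i : L) = 0 := fun i j => by
    rw [negKilling_proj, M.proj_eq_zero_iff.2 (hzm j), map_zero, LinearMap.zero_apply]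
  have hv : ∀ i j, negKilling (v i) (v j) = if i = j then 1 else 0 := by
    rintro (i | i) (j | j)
    · simpa [v, negKilling_proj, proj_coe] using he.1 i j
    · simpa [v] using (negKilling_comm _ _).trans (horth i j)
    · simpa [v] using horth j i
    · simpa [v] using hz i j
  have hsp : Submodule.span ℝ (Set.range v) = ⊤ := by
    have h1 : Submodule.span ℝ (Set.range fun i => (e i : L)) = M.tangent := by
      have := congrArg (Submodule.map M.tangent.subtype) he.2
      rwa [Submodule.map_span, Submodule.map_top, Submodule.range_subtype, ← Set.range_comp] at this
    rw [Set.Sum.elim_range, Submodule.span_union, h1, hz', M.isCompl.sup_eq_top]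
  -- The Killing form is a trace form, so its expansion in an adapted basis, together with skewness
  -- of `ad`, expresses it through inner products of brackets.
  have hB : negKilling x y = -LinearMap.trace ℝ L (LieAlgebra.ad ℝ L y ∘ₗ LieAlgebra.ad ℝ L x) := by
    rw [negKilling_comm]; rfl
  rw [hB, trace_eq_sum_of_orthonormal negKilling v hv hsp, Fintype.sum_sum_type,
    neg_add, ← Finset.sum_neg_distrib, ← Finset.sum_neg_distrib]
  have h2 : ∀ w : L, -negKilling ((LieAlgebra.ad ℝ L y ∘ₗ LieAlgebra.ad ℝ L x) w) w =
      negKilling ⁅x, w⁆ ⁅y, w⁆ := fun w => by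
    rw [LinearMap.comp_apply, LieAlgebra.ad_apply, LieAlgebra.ad_apply, ← lie_skew, map_neg,
      LinearMap.neg_apply, neg_neg, negKilling_lie]
  simp only [h2]
  rfl

/-- The contribution of the isotropy algebra to the Ricci curvature, in terms of `[·,·]_𝔭`. -/
theorem sum_isotropy_curvature {ι : Type*} [Fintype ι] [DecidableEq ι]
    {e : ι → M.tangent} (he : M.IsOrthonormalBasisOf e ⊤) (Y Z : M.tangent) :
    ∑ i, M.Q (M.adProj (⁅(e i : L), (Y : L)⁆ - M.bracket (e i) Y) Z) (e i) =
      -(1 / 2) * (M.Q Y Z - ∑ i, M.Q (M.bracket (e i) Y) (M.bracket (e i) Z)) := by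
  obtain ⟨z, hz, hz'⟩ := exists_orthonormal_submodule (negKilling (L := L)) negKilling_comm
    (fun x hx => by rw [negKilling_apply]; linarith [M.compact x hx]) M.isotropyAlgebra
  have hzm : ∀ j, z j ∈ M.isotropyAlgebra := fun j => hz' ▸ Submodule.subset_span ⟨j, rfl⟩
  -- `c i Y` is the `𝔨`-part of `[Y, e_i]`.
  let c : ι → M.tangent → L := fun i Y => ⁅(Y : L), (e i : L)⁆ - M.bracket Y (e i)
  have hc : ∀ i Y, c i Y ∈ M.isotropyAlgebra := fun i Y => M.sub_proj_mem _
  have h0 : ∀ x ∈ M.isotropyAlgebra, ∀ X : M.tangent, negKilling x (X : L) = 0 := fun x hx X => by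
    rw [negKilling_proj, M.proj_eq_zero_iff.2 hx, map_zero, LinearMap.zero_apply]
  have h0' : ∀ x ∈ M.isotropyAlgebra, ∀ X : M.tangent, negKilling (X : L) x = 0 := fun x hx X => by
    rw [negKilling_comm, h0 x hx]
  have hlie : ∀ i (Y : M.tangent), ⁅(Y : L), (e i : L)⁆ = c i Y + M.bracket Y (e i) := fun i Y => by
    simp [c]
  have h1 : ∀ i, negKilling ⁅(Y : L), (e i : L)⁆ ⁅(Z : L), (e i : L)⁆ =
      negKilling (c i Y) (c i Z) + M.Q (M.bracket (e i) Y) (M.bracket (e i) Z) := fun i => by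
    rw [hlie, hlie, M.bracket_swap (e i) Y, M.bracket_swap (e i) Z]
    simp only [map_add, LinearMap.add_apply, h0 _ (hc i Y), h0' _ (hc i Z), negKilling_proj,
      proj_coe, map_neg, LinearMap.neg_apply, neg_neg, add_zero, zero_add]
  -- Expanding in both bases, the brackets with `𝔨` contribute the same sum of products of `𝔨`-parts
  -- as the brackets with `𝔭`. That sum thus occurs twice in `-B(Y, Z)`, whence the factor `1/2`.
  have h2 : ∑ j, negKilling ⁅(Y : L), z j⁆ ⁅(Z : L), z j⁆ = ∑ i, negKilling (c i Y) (c i Z) := by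
    have h3 : ∀ j, negKilling ⁅(Y : L), z j⁆ ⁅(Z : L), z j⁆ =
        ∑ i, negKilling (c i Y) (z j) * negKilling (c i Z) (z j) := fun j => by
      have hl : ∀ Y : M.tangent, ⁅(Y : L), z j⁆ = -(M.adProj (z j) Y : L) := fun Y => by
        rw [coe_adProj M (hzm j), lie_skew]
      rw [hl, hl]
      simp only [map_neg, LinearMap.neg_apply, neg_neg]
      rw [negKilling_proj, proj_coe, he.parseval Submodule.mem_top]
      refine Finset.sum_congr rfl fun i _ => ?_
      have hq : ∀ Y : M.tangent, M.Q (M.adProj (z j) Y) (e i) = negKilling (c i Y) (z j) :=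
          fun Y => by
        rw [← add_zero (negKilling (c i Y) (z j)), ← h0' _ (hzm j) (M.bracket Y (e i)),
          ← LinearMap.add_apply, ← map_add, ← hlie, adProj_apply, ← negKilling_proj,
          negKilling_lie, negKilling_comm]
      rw [hq, hq]
    simp only [h3]
    rw [Finset.sum_comm]
    refine Finset.sum_congr rfl fun i _ => ?_
    exact (parseval_of_mem_span negKilling negKilling_comm z hz (hz'.symm ▸ hc i Y) _).symm
  have h4 : ∀ i, M.Q (M.adProj (⁅(e i : L), (Y : L)⁆ - M.bracket (e i) Y) Z) (e i) =
      -negKilling (c i Y) (c i Z) := fun i => by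
    have h5 : ⁅(e i : L), (Y : L)⁆ - M.bracket (e i) Y = -c i Y := by
      rw [M.bracket_swap (e i) Y, ← lie_skew]; simp only [c]; push_cast; abel
    rw [h5, adProj_apply, ← negKilling_proj, negKilling_lie, hlie, map_add, map_neg,
      LinearMap.neg_apply, LinearMap.neg_apply, h0 _ (hc i Y), neg_zero, add_zero]
  have h6 := M.negKilling_eq_sum he hz hz' (Y : L) (Z : L)
  simp only [h1, h2, Finset.sum_add_distrib] at h6
  rw [negKilling_proj, proj_coe] at h6
  simp only [h4, Finset.sum_neg_distrib]
  linarith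

/-- An element of the torus is recovered from its action on `𝔭`. -/
theorem sum_lie_adProj {ι : Type*} [Fintype ι] [DecidableEq ι]
    {e : ι → M.tangent} (he : M.IsOrthonormalBasisOf e ⊤) {t : L} (ht : t ∈ M.torus) :
    ∑ i, ⁅(e i : L), (M.adProj t (e i) : L)⁆ = t := by
  obtain ⟨z, hz, hz'⟩ := exists_orthonormal_submodule (negKilling (L := L)) negKilling_comm
    (fun x hx => by rw [negKilling_apply]; linarith [M.compact x hx]) M.isotropyAlgebra
  have hzm : ∀ j, z j ∈ M.isotropyAlgebra := fun j => hz' ▸ Submodule.subset_span ⟨j, rfl⟩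
  -- Pairing with `x`, the claim is the expansion of `-B(t, x)` in an adapted basis, where the
  -- `𝔨`-terms vanish because `t` centralizes `𝔨`.
  refine M.negKilling_ext _ _ fun x => ?_
  rw [M.negKilling_eq_sum he hz hz' t x]
  simp only [hzm _ t ht, map_zero, LinearMap.zero_apply, Finset.sum_const_zero, add_zero, map_sum,
    LinearMap.sum_apply]
  refine Finset.sum_congr rfl fun i _ => ?_
  rw [coe_adProj M (M.torus_le ht), negKilling_lie]
  exact (negKilling_comm _ _).trans (negKilling_lie _ _ _)

/-- `K` preserves `𝔨` as well as `𝔭`, hence commutes with the projection. This makes `bracketForm`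
invariant. -/
theorem Ad_bracket (k : M.isotropyGroup) (X Y : M.tangent) :
    M.Ad k (M.bracket X Y) = M.bracket (M.Ad k X) (M.Ad k Y) := by
  have h : ∀ v : L, M.Ad k (M.proj v) = M.proj ((k : L ≃ₗ[ℝ] L) v) := fun v => by
    have h1 : (k : L ≃ₗ[ℝ] L) (v - M.proj v) ∈ M.isotropyAlgebra := fun t ht => by
      rw [← k.2.2 t ht, ← lie_of_mem_adjointGroup k.2.1, M.sub_proj_mem v t ht, map_zero]
    have h2 := M.proj_eq_zero_iff.2 h1
    rw [map_sub, map_sub, sub_eq_zero, ← Ad_apply, proj_coe] at h2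
    exact h2.symm
  rw [bracket_apply, h, lie_of_mem_adjointGroup k.2.1]
  rfl

/-- The form `(X, Y) ↦ -tr (ad_𝔭 X ad_𝔭 Y) = ∑ Q([v, X]_𝔭, [v, Y]_𝔭)` on `𝔭`. -/
def bracketForm : LinearMap.BilinForm ℝ M.tangent :=
  -(LinearMap.mul ℝ (Module.End ℝ M.tangent)).compr₂ (LinearMap.trace ℝ M.tangent) |>.compl₁₂
    M.bracket M.bracket

theorem bracketForm_apply (X Y : M.tangent) :
    M.bracketForm X Y = -LinearMap.trace ℝ M.tangent (M.bracket X * M.bracket Y) := rfl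

theorem bracketForm_comm (X Y : M.tangent) : M.bracketForm X Y = M.bracketForm Y X := by
  rw [bracketForm_apply, bracketForm_apply, LinearMap.trace_mul_comm]

theorem bracketForm_Ad (k : M.isotropyGroup) (X Y : M.tangent) :
    M.bracketForm (M.Ad k X) (M.Ad k Y) = M.bracketForm X Y := by
  have hk : M.Ad k * M.Ad k⁻¹ = 1 := by ext1 X; exact M.Ad_mul_inv k X
  have hk' : M.Ad k⁻¹ * M.Ad k = 1 := by
    ext1 X; simpa using M.Ad_mul_inv k⁻¹ X
  have h : ∀ X, M.bracket (M.Ad k X) = M.Ad k * M.bracket X * M.Ad k⁻¹ := fun X => by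
    ext1 Y
    rw [Module.End.mul_apply, Module.End.mul_apply, Ad_bracket, Ad_mul_inv]
  rw [bracketForm_apply, bracketForm_apply, h, h]
  congr 1
  rw [show M.Ad k * M.bracket X * M.Ad k⁻¹ * (M.Ad k * M.bracket Y * M.Ad k⁻¹) =
      M.Ad k * (M.bracket X * (M.Ad k⁻¹ * M.Ad k) * M.bracket Y * M.Ad k⁻¹) by noncomm_ring,
    LinearMap.trace_mul_comm, hk', mul_one, mul_assoc, hk', mul_one]

theorem bracketForm_eq_sum {ι : Type*} [Fintype ι] [DecidableEq ι]
    {e : ι → M.tangent} (he : M.IsOrthonormalBasisOf e ⊤) (X Y : M.tangent) :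
    M.bracketForm X Y = ∑ i, M.Q (M.bracket (e i) X) (M.bracket (e i) Y) := by
  rw [bracketForm_comm, bracketForm_apply, he.trace_eq, ← Finset.sum_neg_distrib]
  refine Finset.sum_congr rfl fun i _ => ?_
  rw [Module.End.mul_apply, M.bracket_swap (e i) X, M.bracket_swap (e i) Y, ← adProj_coe, Q_adProj,
    adProj_coe]
  simp

end

/-! ### Bracket relations for weights 1 and 2, and the structural constants. -/

section

variable {L : Type*} [LieRing L] [LieAlgebra ℝ L] [FiniteDimensional ℝ L] {M : FlagManifold L}
  {p₁ p₂ : Submodule ℝ M.tangent} {s : L}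

namespace IsWeightSplitting

theorem exists_add (h : M.IsWeightSplitting p₁ p₂ s) (V : M.tangent) :
    ∃ X ∈ p₁, ∃ Y ∈ p₂, V = X + Y := by
  obtain ⟨X, hX, Y, hY, hV⟩ := Submodule.mem_sup.1
    (h.compl.sup_eq_top ▸ Submodule.mem_top : V ∈ p₁ ⊔ p₂)
  exact ⟨X, hX, Y, hY, hV.symm⟩

theorem D_mem₁ (h : M.IsWeightSplitting p₁ p₂ s) {X : M.tangent} (hX : X ∈ p₁) :
    M.adProj s X ∈ p₁ := M.adProj_mem h.irr₁.2.1 (M.torus_le h.mem) hX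

theorem D_mem₂ (h : M.IsWeightSplitting p₁ p₂ s) {X : M.tangent} (hX : X ∈ p₂) :
    M.adProj s X ∈ p₂ := M.adProj_mem h.irr₂.2.1 (M.torus_le h.mem) hX

/-- Applying `ad s` twice on either side gives `-b(X, Y) = -4 b(X, Y)`. The different weights thus
play the role of inequivalence of the two summands. -/
theorem form_eq_zero (h : M.IsWeightSplitting p₁ p₂ s) {b : LinearMap.BilinForm ℝ M.tangent}
    (hb : ∀ k X Y, b (M.Ad k X) (M.Ad k Y) = b X Y) {X Y : M.tangent} (hX : X ∈ p₁)
    (hY : Y ∈ p₂) : b X Y = 0 := by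
  have hi := M.invariant_adProj hb (M.torus_le h.mem)
  have h1 := hi (M.adProj s X) Y
  rw [hi X, h.sq₁ X hX, h.sq₂ Y hY] at h1
  simp only [map_neg, LinearMap.neg_apply, map_smul, smul_eq_mul] at h1
  linarith

theorem Q_eq_zero (h : M.IsWeightSplitting p₁ p₂ s) {X Y : M.tangent} (hX : X ∈ p₁)
    (hY : Y ∈ p₂) : M.Q X Y = 0 := h.form_eq_zero M.Q_Ad hX hY

theorem Q_eq_zero' (h : M.IsWeightSplitting p₁ p₂ s) {X Y : M.tangent} (hX : X ∈ p₁)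
    (hY : Y ∈ p₂) : M.Q Y X = 0 := by rw [M.Q_comm, h.Q_eq_zero hX hY]

theorem eigen (h : M.IsWeightSplitting p₁ p₂ s) {m : ℝ} {W : M.tangent}
    (hW : M.adProj s (M.adProj s W) = -m • W) : (m ≠ 1 → W ∈ p₂) ∧ (m ≠ 4 → W ∈ p₁) :=
  M.eq_zero_of_adProj_sq h.compl (fun X hX => by rw [h.sq₁ X hX]; module)
    (fun X hX => h.sq₂ X hX) hW

theorem eigen_eq_zero (h : M.IsWeightSplitting p₁ p₂ s) {m : ℝ} {W : M.tangent}
    (hW : M.adProj s (M.adProj s W) = -m • W) (h1 : m ≠ 1) (h2 : m ≠ 4) : W = 0 :=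
  (Submodule.disjoint_def.1 h.compl.disjoint) _ ((h.eigen hW).2 h2) ((h.eigen hW).1 h1)

/-- Weights 1 and 1 combine to 0 and 2, and 0 does not occur in `𝔭`. The lemmas up to `bracket₂₂`
use the same principle: 1 and 2 combine to 1 and 3, of which only 1 survives; 2 and 2 combine to 0
and 4, of which none does. -/
theorem bracket_D_D₁₁ (h : M.IsWeightSplitting p₁ p₂ s) {X X' : M.tangent} (hX : X ∈ p₁)
    (hX' : X' ∈ p₁) :
    M.bracket (M.adProj s X) (M.adProj s X') = -M.bracket X X' := by
  have := h.eigen_eq_zero (M.adProj_sq_bracket h.mem (a := 1) (b := 1)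
    (by rw [h.sq₁ X hX]; module) (by rw [h.sq₁ X' hX']; module)) (by norm_num) (by norm_num)
  rw [mul_one, one_smul] at this
  exact eq_neg_of_add_eq_zero_right this

theorem bracket_mem₁₁ (h : M.IsWeightSplitting p₁ p₂ s) {X X' : M.tangent} (hX : X ∈ p₁)
    (hX' : X' ∈ p₁) : M.bracket X X' ∈ p₂ := by
  have := (h.eigen (M.adProj_sq_bracket h.mem (a := -1) (b := 1)
    (by rw [h.sq₁ X hX]; module) (by rw [h.sq₁ X' hX']; module))).1 (by norm_num)
  rw [h.bracket_D_D₁₁ hX hX'] at this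
  have h2 := p₂.smul_mem (-1 / 2) this
  convert h2 using 1
  module

theorem bracket_D₁₁ (h : M.IsWeightSplitting p₁ p₂ s) {X X' : M.tangent} (hX : X ∈ p₁)
    (hX' : X' ∈ p₁) : M.bracket (M.adProj s X) X' = M.bracket X (M.adProj s X') := by
  have := h.bracket_D_D₁₁ hX (h.D_mem₁ hX')
  rw [h.sq₁ X' hX', map_neg, neg_inj] at this
  exact this

theorem bracket_D_D₁₂ (h : M.IsWeightSplitting p₁ p₂ s) {X Y : M.tangent} (hX : X ∈ p₁)
    (hY : Y ∈ p₂) :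
    M.bracket (M.adProj s X) (M.adProj s Y) = (2 : ℝ) • M.bracket X Y := by
  have := h.eigen_eq_zero (M.adProj_sq_bracket h.mem (a := -1) (b := 2)
    (by rw [h.sq₁ X hX]; module) (by rw [h.sq₂ Y hY]; module)) (by norm_num) (by norm_num)
  rw [← sub_eq_zero, ← this]
  module

theorem bracket_mem₁₂ (h : M.IsWeightSplitting p₁ p₂ s) {X Y : M.tangent} (hX : X ∈ p₁)
    (hY : Y ∈ p₂) : M.bracket X Y ∈ p₁ := by
  have := (h.eigen (M.adProj_sq_bracket h.mem (a := 1) (b := 2)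
    (by rw [h.sq₁ X hX]; module) (by rw [h.sq₂ Y hY]; module))).2 (by norm_num)
  rw [h.bracket_D_D₁₂ hX hY] at this
  have h2 := p₁.smul_mem (1 / 4) this
  convert h2 using 1
  module

theorem bracket_mem₂₁ (h : M.IsWeightSplitting p₁ p₂ s) {X Y : M.tangent} (hX : X ∈ p₁)
    (hY : Y ∈ p₂) : M.bracket Y X ∈ p₁ := by
  rw [M.bracket_swap]
  exact p₁.neg_mem (h.bracket_mem₁₂ hX hY)

theorem bracket_D₁₂ (h : M.IsWeightSplitting p₁ p₂ s) {X Y : M.tangent} (hX : X ∈ p₁)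
    (hY : Y ∈ p₂) :
    M.bracket X (M.adProj s Y) = (-2 : ℝ) • M.bracket (M.adProj s X) Y := by
  have := h.bracket_D_D₁₂ (h.D_mem₁ hX) hY
  rw [h.sq₁ X hX, map_neg, LinearMap.neg_apply] at this
  rw [neg_smul, ← this, neg_neg]

theorem bracket₂₂ (h : M.IsWeightSplitting p₁ p₂ s) {Y Y' : M.tangent} (hY : Y ∈ p₂)
    (hY' : Y' ∈ p₂) : M.bracket Y Y' = 0 := by
  have e1 := h.eigen_eq_zero (M.adProj_sq_bracket h.mem (a := 2) (b := 2)
    (by rw [h.sq₂ Y hY]; module) (by rw [h.sq₂ Y' hY']; module)) (by norm_num) (by norm_num)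
  have e2 := h.eigen_eq_zero (M.adProj_sq_bracket h.mem (a := -2) (b := 2)
    (by rw [h.sq₂ Y hY]; module) (by rw [h.sq₂ Y' hY']; module)) (by norm_num) (by norm_num)
  have e3 := congrArg₂ (fun U V => (1 / 8 : ℝ) • (U - V)) e1 e2
  simp only [sub_zero, smul_zero] at e3
  rw [← e3]; module

/-- For the `𝔨`-part `Z` of `[X, Y]`, `B(Z, Z) = B([Z, X], Y) = 0`, since `[Z, X] ∈ p₁` is
orthogonal to `Y ∈ p₂`. -/
theorem lie₁₂ (h : M.IsWeightSplitting p₁ p₂ s) {X Y : M.tangent} (hX : X ∈ p₁)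
    (hY : Y ∈ p₂) : ⁅(X : L), (Y : L)⁆ = M.bracket X Y := by
  rw [← sub_eq_zero]
  by_contra hne
  have hk : ⁅(X : L), (Y : L)⁆ - M.bracket X Y ∈ M.isotropyAlgebra := M.sub_proj_mem _
  refine (M.compact _ hne).ne ?_
  have h1 := M.adProj_mem h.irr₁.2.1 hk hX
  have h2 := h.Q_eq_zero h1 hY
  rw [Q_apply, coe_adProj M hk, killing_lie, neg_eq_zero] at h2
  rw [map_sub, h2, M.killing_eq_zero hk (M.bracket X Y).2, sub_zero]

/-- If `[p₁, p₁]_𝔭 = 0`, then `[p₁, p₂]_𝔭 = 0` by the cyclic symmetry of `Q([·,·], ·)`, and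
simplicity is contradicted. -/
theorem exists_bracket_ne_zero (h : M.IsWeightSplitting p₁ p₂ s) :
    ∃ X ∈ p₁, ∃ X' ∈ p₁, M.bracket X X' ≠ 0 := by
  by_contra! hc
  refine M.false_of_bracket_eq_zero h.irr₁.1 ?_
    (fun Z hZ X hX => M.adProj_mem h.irr₁.2.1 hZ hX) fun X hX V => ?_
  · rintro rfl
    exact h.irr₂.1 (by simpa using h.compl.inf_eq_bot)
  · obtain ⟨X', hX', Y, hY, rfl⟩ := h.exists_add V
    rw [map_add, hc X hX X' hX', zero_add]
    refine M.Q_self_eq_zero ?_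
    rw [Q_bracket, M.Q_comm, Q_bracket, hc _ (h.bracket_mem₁₂ hX hY) X hX, map_zero]

theorem sumElim (h : M.IsWeightSplitting p₁ p₂ s) {ι κ : Type*} [DecidableEq ι] [DecidableEq κ]
    {e : ι → M.tangent} {f : κ → M.tangent} (he : M.IsOrthonormalBasisOf e p₁)
    (hf : M.IsOrthonormalBasisOf f p₂) : M.IsOrthonormalBasisOf (Sum.elim e f) ⊤ := by
  constructor
  · rintro (i | i) (j | j)
    · simpa using he.1 i j
    · simpa using h.Q_eq_zero (he.mem i) (hf.mem j)
    · simpa using h.Q_eq_zero' (he.mem j) (hf.mem i)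
    · simpa using hf.1 i j
  · rw [Set.Sum.elim_range, Submodule.span_union, he.2, hf.2, h.compl.sup_eq_top]

theorem trace_eq (h : M.IsWeightSplitting p₁ p₂ s) {ι κ : Type*} [Fintype ι] [Fintype κ]
    [DecidableEq ι] [DecidableEq κ]
    {e : ι → M.tangent} {f : κ → M.tangent} (he : M.IsOrthonormalBasisOf e p₁)
    (hf : M.IsOrthonormalBasisOf f p₂) (T : Module.End ℝ M.tangent) :
    LinearMap.trace ℝ M.tangent T = ∑ i, M.Q (T (e i)) (e i) + ∑ j, M.Q (T (f j)) (f j) := by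
  rw [(h.sumElim he hf).trace_eq, Fintype.sum_sum_type]
  rfl

theorem Q_D_D₁ (h : M.IsWeightSplitting p₁ p₂ s) {X : M.tangent} (hX : X ∈ p₁) (V : M.tangent) :
    M.Q (M.adProj s X) (M.adProj s V) = M.Q X V := by
  rw [M.Q_comm, Q_adProj, h.sq₁ X hX, map_neg, neg_neg, M.Q_comm]

theorem Q_D_D₂ (h : M.IsWeightSplitting p₁ p₂ s) {Y : M.tangent} (hY : Y ∈ p₂) (V : M.tangent) :
    M.Q (M.adProj s Y) (M.adProj s V) = 4 * M.Q Y V := by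
  rw [M.Q_comm, Q_adProj, h.sq₂ Y hY, map_smul, M.Q_comm, smul_eq_mul]
  ring

theorem D_isOrthonormalBasisOf (h : M.IsWeightSplitting p₁ p₂ s) {ι : Type*} [DecidableEq ι]
    {e : ι → M.tangent} (he : M.IsOrthonormalBasisOf e p₁) :
    M.IsOrthonormalBasisOf (fun i => M.adProj s (e i)) p₁ := by
  refine ⟨fun i j => by rw [h.Q_D_D₁ (he.mem i), he.1], ?_⟩
  have h1 : Set.range (fun i => M.adProj s (e i)) = M.adProj s '' Set.range e := by
    rw [← Set.range_comp]; rfl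
  rw [h1, Submodule.span_image, he.2]
  apply le_antisymm
  · rintro _ ⟨X, hX, rfl⟩
    exact h.D_mem₁ hX
  · intro X hX
    exact ⟨-M.adProj s X, p₁.neg_mem (h.D_mem₁ hX), by rw [map_neg, h.sq₁ X hX, neg_neg]⟩

/-- Both kinds of sums of brackets with `𝔭₁`-vectors agree on `𝔭₁`. -/
theorem sum_bracket_swap (h : M.IsWeightSplitting p₁ p₂ s) {ι κ : Type*} [Fintype ι] [Fintype κ]
    [DecidableEq ι] [DecidableEq κ]
    {e : ι → M.tangent} {f : κ → M.tangent} (he : M.IsOrthonormalBasisOf e p₁)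
    (hf : M.IsOrthonormalBasisOf f p₂) {X : M.tangent} (hX : X ∈ p₁) (X' : M.tangent) :
    ∑ i, M.Q (M.bracket (e i) X) (M.bracket (e i) X') =
      ∑ j, M.Q (M.bracket (f j) X) (M.bracket (f j) X') := by
  have h1 : ∀ i, M.Q (M.bracket (e i) X) (M.bracket (e i) X') =
      ∑ j, M.Q (e i) (M.bracket X (f j)) * M.Q (e i) (M.bracket X' (f j)) := fun i => by
    rw [hf.parseval (h.bracket_mem₁₁ (he.mem i) hX)]
    simp only [Q_bracket]
  have h2 : ∀ j, M.Q (M.bracket (f j) X) (M.bracket (f j) X') =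
      ∑ i, M.Q (e i) (M.bracket X (f j)) * M.Q (e i) (M.bracket X' (f j)) := fun j => by
    rw [he.parseval (h.bracket_mem₂₁ hX (hf.mem j))]
    refine Finset.sum_congr rfl fun i _ => ?_
    rw [M.bracket_swap (f j) X, M.bracket_swap (f j) X', M.Q_comm, M.Q_comm _ (e i)]
    simp
  simp only [h1, h2]
  exact Finset.sum_comm

theorem bracket_orth₁ (h : M.IsWeightSplitting p₁ p₂ s) {X Y Z : M.tangent} (hX : X ∈ p₁)
    (hY : Y ∈ p₂) (hZ : Z ∈ p₁) : M.Q (M.bracket Z X) (M.bracket Z Y) = 0 :=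
  h.Q_eq_zero' (h.bracket_mem₁₂ hZ hY) (h.bracket_mem₁₁ hZ hX)

/-- The sums of brackets are multiples of `Q`. -/
theorem exists_constants (h : M.IsWeightSplitting p₁ p₂ s) :
    ∃ α β : ℝ, ∀ (e : Fin (Module.finrank ℝ p₁) → M.tangent)
      (f : Fin (Module.finrank ℝ p₂) → M.tangent), M.IsOrthonormalBasisOf e p₁ →
      M.IsOrthonormalBasisOf f p₂ →
        (∀ X ∈ p₁, ∀ V, ∑ j, M.Q (M.bracket (f j) X) (M.bracket (f j) V) = α * M.Q X V) ∧
        (∀ X ∈ p₁, ∀ V, ∑ i, M.Q (M.bracket (e i) X) (M.bracket (e i) V) = α * M.Q X V) ∧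
        (∀ Y ∈ p₂, ∀ V, ∑ i, M.Q (M.bracket (e i) Y) (M.bracket (e i) V) = β * M.Q Y V) := by
  obtain ⟨a, ha⟩ := h.irr₁.exists_eq_smul_Q M.bracketForm (fun X _ Y _ => M.bracketForm_comm X Y)
    (fun k X _ Y _ => M.bracketForm_Ad k X Y)
  obtain ⟨b, hb⟩ := h.irr₂.exists_eq_smul_Q M.bracketForm (fun X _ Y _ => M.bracketForm_comm X Y)
    (fun k X _ Y _ => M.bracketForm_Ad k X Y)
  -- On `p₁` the invariant form is the sum over `e` plus the sum over `f`, which are equal; on `p₂`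
  -- the sum over `f` vanishes.
  refine ⟨a / 2, b, fun e f he hf => ?_⟩
  have hsum := fun X Y => M.bracketForm_eq_sum (h.sumElim he hf) X Y
  simp only [Fintype.sum_sum_type, Sum.elim_inl, Sum.elim_inr] at hsum
  refine ⟨fun X hX V => ?_, fun X hX V => ?_, fun Y hY V => ?_⟩
  · obtain ⟨X', hX', Y, hY, rfl⟩ := h.exists_add V
    have h1 := hsum X X'
    rw [ha X hX X' hX', h.sum_bracket_swap he hf hX X'] at h1
    simp only [map_add, h.bracket₂₂ (hf.mem _) hY, add_zero, h.Q_eq_zero hX hY]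
    linarith
  · obtain ⟨X', hX', Y, hY, rfl⟩ := h.exists_add V
    have h1 := hsum X X'
    rw [ha X hX X' hX', ← h.sum_bracket_swap he hf hX X'] at h1
    simp only [map_add, h.bracket_orth₁ hX hY (he.mem _), add_zero, h.Q_eq_zero hX hY]
    linarith
  · obtain ⟨X, hX, Y', hY', rfl⟩ := h.exists_add V
    have h1 := hsum Y Y'
    rw [hb Y hY Y' hY'] at h1
    simp only [h.bracket₂₂ (hf.mem _) hY', map_zero, Finset.sum_const_zero, add_zero] at h1
    have h2 : ∀ i, M.Q (M.bracket (e i) Y) (M.bracket (e i) X) = 0 := fun i => by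
      rw [M.Q_comm, h.bracket_orth₁ hX hY (he.mem i)]
    simp only [map_add, h2, zero_add, h.Q_eq_zero' hX hY]
    exact h1.symm

theorem finrank_pos₁ (h : M.IsWeightSplitting p₁ p₂ s) : (0 : ℝ) < Module.finrank ℝ p₁ := by
  have : Nontrivial p₁ := Submodule.nontrivial_iff_ne_bot.2 h.irr₁.1
  exact_mod_cast Module.finrank_pos

theorem finrank_pos₂ (h : M.IsWeightSplitting p₁ p₂ s) : (0 : ℝ) < Module.finrank ℝ p₂ := by
  have : Nontrivial p₂ := Submodule.nontrivial_iff_ne_bot.2 h.irr₂.1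
  exact_mod_cast Module.finrank_pos

theorem eq_smul_D₁ (h : M.IsWeightSplitting p₁ p₂ s) {W X : M.tangent} (hW : W ∈ p₁) {c : ℝ}
    (hX : X ∈ p₁) (hc : ∀ X' ∈ p₁, M.Q W (M.adProj s X') = c * M.Q X X') :
    W = c • M.adProj s X := by
  rw [← sub_eq_zero]
  have hmem : W - c • M.adProj s X ∈ p₁ := p₁.sub_mem hW (p₁.smul_mem c (h.D_mem₁ hX))
  refine M.Q_self_eq_zero ?_
  have h1 : ∀ X' ∈ p₁, M.Q (W - c • M.adProj s X) (M.adProj s X') = 0 := fun X' hX' => by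
    simp [hc X' hX', h.Q_D_D₁ hX]
  have h2 := h1 _ (h.D_mem₁ hmem)
  rwa [h.sq₁ _ hmem, map_neg, neg_eq_zero] at h2

theorem eq_smul_D₂ (h : M.IsWeightSplitting p₁ p₂ s) {W Y : M.tangent} (hW : W ∈ p₂) {c : ℝ}
    (hY : Y ∈ p₂) (hc : ∀ Y' ∈ p₂, M.Q W (M.adProj s Y') = 4 * c * M.Q Y Y') :
    W = c • M.adProj s Y := by
  rw [← sub_eq_zero]
  have hmem : W - c • M.adProj s Y ∈ p₂ := p₂.sub_mem hW (p₂.smul_mem c (h.D_mem₂ hY))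
  refine M.Q_self_eq_zero ?_
  have h1 : ∀ Y' ∈ p₂, M.Q (W - c • M.adProj s Y) (M.adProj s Y') = 0 := fun Y' hY' => by
    simp only [map_sub, map_smul, LinearMap.sub_apply, LinearMap.smul_apply, smul_eq_mul,
      hc Y' hY', h.Q_D_D₂ hY]
    ring
  have h2 := h1 _ (h.D_mem₂ hmem)
  rw [h.sq₂ _ hmem, map_smul, smul_eq_mul] at h2
  linarith

/-- The constants of `exists_constants` are determined by the dimensions. -/
theorem constants_eq (h : M.IsWeightSplitting p₁ p₂ s)
    {e : Fin (Module.finrank ℝ p₁) → M.tangent} {f : Fin (Module.finrank ℝ p₂) → M.tangent}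
    (he : M.IsOrthonormalBasisOf e p₁) (hf : M.IsOrthonormalBasisOf f p₂) {α β : ℝ}
    (hα : ∀ X ∈ p₁, ∀ V, ∑ j, M.Q (M.bracket (f j) X) (M.bracket (f j) V) = α * M.Q X V)
    (hβ : ∀ e : Fin (Module.finrank ℝ p₁) → M.tangent, M.IsOrthonormalBasisOf e p₁ →
      ∀ Y ∈ p₂, ∀ V, ∑ i, M.Q (M.bracket (e i) Y) (M.bracket (e i) V) = β * M.Q Y V) :
    (Module.finrank ℝ p₁ : ℝ) * α = Module.finrank ℝ p₂ * β ∧ 1 - 4 * α = β := by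
  constructor
  -- Both sides equal the sum of `|[e_i, f_j]_𝔭|²` over all pairs.
  · have h1 : ∑ i, ∑ j, M.Q (M.bracket (f j) (e i)) (M.bracket (f j) (e i)) =
        (Module.finrank ℝ p₁ : ℝ) * α := by
      simp [hα _ (he.mem _), he.1]
    have h2 : ∑ j, ∑ i, M.Q (M.bracket (e i) (f j)) (M.bracket (e i) (f j)) =
        (Module.finrank ℝ p₂ : ℝ) * β := by
      simp [hβ e he _ (hf.mem _), hf.1]
    rw [← h1, ← h2, Finset.sum_comm]
    refine Finset.sum_congr rfl fun j _ => Finset.sum_congr rfl fun i _ => ?_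
    rw [M.bracket_swap]; simp
  · have hs := M.torus_le h.mem
    -- `s = H₁ + H₂` splits the reconstruction of `s` along `p₁` and `p₂`. Both parts lie in `𝔨`, so
    -- they act on `𝔭` as derivations of the bracket.
    let H₁ : L := ∑ i, ⁅(e i : L), (M.adProj s (e i) : L)⁆
    let H₂ : L := ∑ j, ⁅(f j : L), (M.adProj s (f j) : L)⁆
    have hH : H₁ + H₂ = s := by
      have := M.sum_lie_adProj (h.sumElim he hf) h.mem
      rwa [Fintype.sum_sum_type] at this
    have hH₁ : H₁ ∈ M.isotropyAlgebra := by
      refine Submodule.sum_mem _ fun i _ => M.proj_eq_zero_iff.1 ?_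
      have h1 := h.bracket_D₁₁ (he.mem i) (he.mem i)
      rw [M.bracket_swap] at h1
      change M.bracket (e i) (M.adProj s (e i)) = 0
      have h2 := congrArg (fun W => (1 / 2 : ℝ) • (M.bracket (e i) (M.adProj s (e i)) - W)) h1
      simp only [sub_self, smul_zero] at h2
      rw [← h2]; module
    have hH₂ : H₂ ∈ M.isotropyAlgebra := by
      rw [← hH] at hs
      simpa using M.isotropyAlgebra.sub_mem hs hH₁
    -- Expanding the double bracket by Jacobi turns this pairing into sums of squares over `f`;
    -- there is no `𝔨`-contribution by `lie₁₂`. Hence `H₂` acts on `p₁` as `4α ad s`.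
    have act₂ : ∀ X ∈ p₁, ∀ X' ∈ p₁,
        M.Q (M.adProj H₂ X) (M.adProj s X') = 4 * α * M.Q X X' := by
      intro X hX X' hX'
      have h1 : ∀ j, negKilling ⁅⁅(f j : L), (M.adProj s (f j) : L)⁆, (X : L)⁆
          (M.adProj s X' : L) =
          2 * M.Q (M.bracket (f j) (M.adProj s X)) (M.bracket (f j) (M.adProj s X')) +
          2 * M.Q (M.bracket (f j) X) (M.bracket (f j) X') := fun j => by
        have hf' := hf.mem j
        have hDf := h.D_mem₂ hf'
        have hDX := h.D_mem₁ hX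
        have hDX' := h.D_mem₁ hX'
        have a1 : ∀ {A B : M.tangent}, A ∈ p₁ → B ∈ p₂ → ⁅(B : L), (A : L)⁆ = M.bracket B A :=
          fun hA hB => by
            rw [← lie_skew, h.lie₁₂ hA hB, M.bracket_swap, Submodule.coe_neg, neg_neg]
        have a2 : M.bracket (M.adProj s (f j)) X = (-2 : ℝ) • M.bracket (f j) (M.adProj s X) := by
          rw [M.bracket_swap, h.bracket_D₁₂ hX hf', M.bracket_swap (f j)]; module
        have a3 : M.bracket (M.adProj s (f j)) (M.adProj s X') = (2 : ℝ) • M.bracket (f j) X' := by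
          rw [M.bracket_swap, h.bracket_D_D₁₂ hX' hf', M.bracket_swap (f j)]; module
        rw [lie_lie, a1 hX hDf, a1 hX hf', map_sub, LinearMap.sub_apply, ← lie_skew,
          ← lie_skew (M.adProj s (f j) : L), map_neg, map_neg, LinearMap.neg_apply,
          LinearMap.neg_apply, negKilling_lie, negKilling_lie, a1 hDX' hf', a1 hDX' hDf,
          negKilling_proj, negKilling_proj, proj_coe, proj_coe, a2, a3]
        simp only [map_smul, LinearMap.smul_apply, smul_eq_mul]
        ring
      rw [adProj_apply, ← negKilling_proj]
      simp only [H₂, sum_lie, map_sum, LinearMap.sum_apply, h1, Finset.sum_add_distrib,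
        ← Finset.mul_sum]
      rw [hα _ (h.D_mem₁ hX), hα _ hX, h.Q_D_D₁ hX]
      ring
    -- The same computation over `p₁`; `ad s` maps the basis `e` to another orthonormal basis, so
    -- both sums have the same constant `β`.
    have act₁ : ∀ X ∈ p₂, ∀ X' ∈ p₂,
        M.Q (M.adProj H₁ X) (M.adProj s X') = 4 * β * M.Q X X' := by
      intro X hX X' hX'
      have h1 : ∀ j, negKilling ⁅⁅(e j : L), (M.adProj s (e j) : L)⁆, (X : L)⁆
          (M.adProj s X' : L) =
          2 * M.Q (M.bracket (M.adProj s (e j)) X) (M.bracket (M.adProj s (e j)) X') +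
          2 * M.Q (M.bracket (e j) X) (M.bracket (e j) X') := fun j => by
        have he' := he.mem j
        have hDe := h.D_mem₁ he'
        have hDX' := h.D_mem₂ hX'
        rw [lie_lie, h.lie₁₂ hDe hX, h.lie₁₂ he' hX, map_sub, LinearMap.sub_apply, ← lie_skew,
          ← lie_skew (M.adProj s (e j) : L), map_neg, map_neg, LinearMap.neg_apply,
          LinearMap.neg_apply, negKilling_lie, negKilling_lie, h.lie₁₂ he' hDX', h.lie₁₂ hDe hDX',
          negKilling_proj, negKilling_proj, proj_coe, proj_coe, h.bracket_D₁₂ he' hX',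
          h.bracket_D_D₁₂ he' hX']
        simp only [map_smul, smul_eq_mul]
        ring
      rw [adProj_apply, ← negKilling_proj]
      simp only [H₁, sum_lie, map_sum, LinearMap.sum_apply, h1, Finset.sum_add_distrib,
        ← Finset.mul_sum]
      rw [hβ _ (h.D_isOrthonormalBasisOf he) _ hX, hβ e he _ hX]
      ring
    have e₁ : ∀ X ∈ p₁, M.adProj H₁ X = (1 - 4 * α) • M.adProj s X := fun X hX => by
      have h1 := h.eq_smul_D₁ (M.adProj_mem h.irr₁.2.1 hH₂ hX) hX (act₂ X hX)
      have h2 := M.adProj_add H₁ H₂ X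
      rw [hH, h1] at h2
      rw [sub_smul, one_smul]
      exact eq_sub_of_add_eq h2.symm
    have e₂ : ∀ Y ∈ p₂, M.adProj H₁ Y = β • M.adProj s Y := fun Y hY =>
      h.eq_smul_D₂ (M.adProj_mem h.irr₂.2.1 hH₁ hY) hY (act₁ Y hY)
    -- On `p₁` the derivation `H₁` acts as `(1 - 4α) ad s`, on `p₂` as `β ad s`. A nonzero bracket
    -- `p₁ × p₁ → p₂` forces the factors to agree.
    obtain ⟨X, hX, X', hX', hne⟩ := h.exists_bracket_ne_zero
    have hb := h.bracket_mem₁₁ hX hX'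
    have h3 := M.adProj_bracket hH₁ X X'
    rw [e₂ _ hb, e₁ X hX, e₁ X' hX', map_smul, map_smul, LinearMap.smul_apply, ← smul_add,
      ← M.adProj_bracket hs] at h3
    have h4 : M.adProj s (M.bracket X X') ≠ 0 := fun h0 => by
      have := h.sq₂ _ hb
      rw [h0, map_zero] at this
      exact hne ((smul_eq_zero.1 this.symm).resolve_left (by norm_num))
    exact (smul_left_injective ℝ h4 h3).symm

end IsWeightSplitting

/-- The eigenvalue of `∑ |[f, ·]|²` on `𝔭₁`, where `f` runs over an orthonormal basis of `𝔭₂`. -/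
def coeff₁ (p₁ p₂ : Submodule ℝ M.tangent) : ℝ :=
  (Module.finrank ℝ p₂ : ℝ) / (Module.finrank ℝ p₁ + 4 * Module.finrank ℝ p₂)

/-- The eigenvalue of `∑ |[e, ·]|²` on `𝔭₂`, where `e` runs over an orthonormal basis of `𝔭₁`. -/
def coeff₂ (p₁ p₂ : Submodule ℝ M.tangent) : ℝ :=
  (Module.finrank ℝ p₁ : ℝ) / (Module.finrank ℝ p₁ + 4 * Module.finrank ℝ p₂)

namespace IsWeightSplitting

theorem sums (h : M.IsWeightSplitting p₁ p₂ s)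
    {e : Fin (Module.finrank ℝ p₁) → M.tangent} {f : Fin (Module.finrank ℝ p₂) → M.tangent}
    (he : M.IsOrthonormalBasisOf e p₁) (hf : M.IsOrthonormalBasisOf f p₂) :
    (∀ X ∈ p₁, ∀ V, ∑ j, M.Q (M.bracket (f j) X) (M.bracket (f j) V) =
      coeff₁ p₁ p₂ * M.Q X V) ∧
    (∀ X ∈ p₁, ∀ V, ∑ i, M.Q (M.bracket (e i) X) (M.bracket (e i) V) =
      coeff₁ p₁ p₂ * M.Q X V) ∧
    (∀ Y ∈ p₂, ∀ V, ∑ i, M.Q (M.bracket (e i) Y) (M.bracket (e i) V) =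
      coeff₂ p₁ p₂ * M.Q Y V) := by
  obtain ⟨α, β, hc⟩ := h.exists_constants
  obtain ⟨h1, h2⟩ := h.constants_eq he hf (hc e f he hf).1 fun e' he' => (hc e' f he' hf).2.2
  have hd₁ := h.finrank_pos₁
  have hd₂ := h.finrank_pos₂
  have hα : α = coeff₁ p₁ p₂ := by
    rw [coeff₁, eq_div_iff (by positivity)]
    rw [← h2] at h1; linarith
  have hβ : β = coeff₂ p₁ p₂ := by
    rw [coeff₂, eq_div_iff (by positivity)]
    have : α = (1 - β) / 4 := by linarith
    rw [this] at h1; linarith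
  rw [← hα, ← hβ]
  exact hc e f he hf

theorem structConst_eq (h : M.IsWeightSplitting p₁ p₂ s)
    {e : Fin (Module.finrank ℝ p₁) → M.tangent} {f : Fin (Module.finrank ℝ p₂) → M.tangent}
    (he : M.IsOrthonormalBasisOf e p₁) (hf : M.IsOrthonormalBasisOf f p₂) :
    M.structConst e e e = 0 ∧ M.structConst e e f = Module.finrank ℝ p₁ * coeff₁ p₁ p₂ ∧
      M.structConst e f f = 0 ∧ M.structConst f f f = 0 := by
  refine ⟨?_, ?_, ?_, ?_⟩
  · refine Finset.sum_eq_zero fun i _ => Finset.sum_eq_zero fun j _ =>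
      Finset.sum_eq_zero fun k _ => ?_
    rw [h.Q_eq_zero' (he.mem k) (h.bracket_mem₁₁ (he.mem i) (he.mem j)), zero_pow two_ne_zero]
  · rw [structConst, Finset.sum_comm]
    have h1 : ∀ i j, ∑ k, M.Q (M.bracket (e j) (e i)) (f k) ^ 2 =
        M.Q (M.bracket (e j) (e i)) (M.bracket (e j) (e i)) := fun i j => by
      rw [hf.parseval (h.bracket_mem₁₁ (he.mem j) (he.mem i))]
      simp only [sq]
    simp only [h1, (h.sums he hf).2.1 _ (he.mem _), he.1]
    simp
  · refine Finset.sum_eq_zero fun i _ => Finset.sum_eq_zero fun j _ =>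
      Finset.sum_eq_zero fun k _ => ?_
    rw [h.Q_eq_zero (h.bracket_mem₁₂ (he.mem i) (hf.mem j)) (hf.mem k), zero_pow two_ne_zero]
  · refine Finset.sum_eq_zero fun i _ => Finset.sum_eq_zero fun j _ =>
      Finset.sum_eq_zero fun k _ => ?_
    rw [h.bracket₂₂ (hf.mem i) (hf.mem j), map_zero, LinearMap.zero_apply, zero_pow two_ne_zero]

end IsWeightSplitting

end

/-! ### Diagonal metrics, their connection and Ricci tensor, and the Einstein equation. -/

section

variable {L : Type*} [LieRing L] [LieAlgebra ℝ L] [FiniteDimensional ℝ L] {M : FlagManifold L}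
  {p₁ p₂ : Submodule ℝ M.tangent} {s : L}

/-- The form `b` is `x₁ Q` on `p₁` and `x₂ Q` on `p₂`, and `p₁`, `p₂` are `b`-orthogonal. -/
def IsDiag (M : FlagManifold L) (p₁ p₂ : Submodule ℝ M.tangent)
    (b : LinearMap.BilinForm ℝ M.tangent) (x₁ x₂ : ℝ) : Prop :=
  (∀ X ∈ p₁, ∀ V, b X V = x₁ * M.Q X V) ∧ ∀ Y ∈ p₂, ∀ V, b Y V = x₂ * M.Q Y V

theorem IsDiag.add {b b' : LinearMap.BilinForm ℝ M.tangent} {x₁ x₂ y₁ y₂ : ℝ}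
    (hb : M.IsDiag p₁ p₂ b x₁ x₂) (hb' : M.IsDiag p₁ p₂ b' y₁ y₂) :
    M.IsDiag p₁ p₂ (b + b') (x₁ + y₁) (x₂ + y₂) :=
  ⟨fun X hX V => by simp [hb.1 X hX, hb'.1 X hX, add_mul],
    fun X hX V => by simp [hb.2 X hX, hb'.2 X hX, add_mul]⟩

theorem IsDiag.smul {b : LinearMap.BilinForm ℝ M.tangent} {x₁ x₂ : ℝ}
    (hb : M.IsDiag p₁ p₂ b x₁ x₂) (c : ℝ) : M.IsDiag p₁ p₂ (c • b) (c * x₁) (c * x₂) :=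
  ⟨fun X hX V => by simp [hb.1 X hX, mul_assoc], fun X hX V => by simp [hb.2 X hX, mul_assoc]⟩

theorem Q_cyc (X Y Z : M.tangent) : M.Q (M.bracket Y Z) X = M.Q (M.bracket X Y) Z := by
  rw [Q_bracket M X, M.Q_comm]

namespace IsWeightSplitting

theorem diagMetric_isDiag (h : M.IsWeightSplitting p₁ p₂ s) (hc : IsCompl p₁ p₂) (x₁ x₂ : ℝ) :
    M.IsDiag p₁ p₂ (M.diagMetric hc x₁ x₂) x₁ x₂ := by
  constructor
  · intro X hX V
    obtain ⟨X', hX', Y, hY, rfl⟩ := h.exists_add V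
    have a1 := Submodule.projectionOnto_apply_left hc ⟨X, hX⟩
    have a2 := Submodule.projectionOnto_apply_left hc ⟨X', hX'⟩
    have a3 : Submodule.projectionOnto p₁ p₂ hc Y = 0 :=
      (Submodule.projectionOnto_apply_eq_zero_iff hc).2 hY
    have a4 : Submodule.projectionOnto p₂ p₁ hc.symm X = 0 :=
      (Submodule.projectionOnto_apply_eq_zero_iff hc.symm).2 hX
    simp only at a1 a2
    simp [diagMetric, a1, a2, a3, a4, h.Q_eq_zero hX hY]
  · intro X hX V
    obtain ⟨Y, hY, X', hX', rfl⟩ := h.exists_add V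
    have a1 := Submodule.projectionOnto_apply_left hc.symm ⟨X, hX⟩
    have a2 := Submodule.projectionOnto_apply_left hc.symm ⟨X', hX'⟩
    have a3 : Submodule.projectionOnto p₂ p₁ hc.symm Y = 0 :=
      (Submodule.projectionOnto_apply_eq_zero_iff hc.symm).2 hY
    have a4 : Submodule.projectionOnto p₁ p₂ hc X = 0 :=
      (Submodule.projectionOnto_apply_eq_zero_iff hc).2 hX
    simp only at a1 a2
    simp [diagMetric, a1, a2, a3, a4, h.Q_eq_zero' hY hX]

theorem isDiag_ext (h : M.IsWeightSplitting p₁ p₂ s) {b b' : LinearMap.BilinForm ℝ M.tangent}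
    {x₁ x₂ : ℝ} (hb : M.IsDiag p₁ p₂ b x₁ x₂) (hb' : M.IsDiag p₁ p₂ b' x₁ x₂) : b = b' := by
  ext U V
  obtain ⟨X, hX, Y, hY, rfl⟩ := h.exists_add U
  simp only [map_add, LinearMap.add_apply, hb.1 X hX, hb'.1 X hX, hb.2 Y hY, hb'.2 Y hY]

theorem isDiag_inj (h : M.IsWeightSplitting p₁ p₂ s) {b : LinearMap.BilinForm ℝ M.tangent}
    {x₁ x₂ y₁ y₂ : ℝ} (hb : M.IsDiag p₁ p₂ b x₁ x₂) (hb' : M.IsDiag p₁ p₂ b y₁ y₂) :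
    x₁ = y₁ ∧ x₂ = y₂ := by
  obtain ⟨X, hX, hX0⟩ := Submodule.exists_mem_ne_zero_of_ne_bot h.irr₁.1
  obtain ⟨Y, hY, hY0⟩ := Submodule.exists_mem_ne_zero_of_ne_bot h.irr₂.1
  exact ⟨mul_right_cancel₀ (M.Q_pos hX0).ne' ((hb.1 X hX X).symm.trans (hb'.1 X hX X)),
    mul_right_cancel₀ (M.Q_pos hY0).ne' ((hb.2 Y hY Y).symm.trans (hb'.2 Y hY Y))⟩

theorem isDiag_comm (h : M.IsWeightSplitting p₁ p₂ s) {b : LinearMap.BilinForm ℝ M.tangent}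
    {x₁ x₂ : ℝ} (hb : M.IsDiag p₁ p₂ b x₁ x₂) (U V : M.tangent) : b U V = b V U := by
  obtain ⟨X, hX, Y, hY, rfl⟩ := h.exists_add U
  obtain ⟨X', hX', Y', hY', rfl⟩ := h.exists_add V
  simp only [map_add, LinearMap.add_apply, hb.1 X hX, hb.1 X' hX', hb.2 Y hY, hb.2 Y' hY',
    h.Q_eq_zero hX hY', h.Q_eq_zero' hX' hY, h.Q_eq_zero' hX hY', h.Q_eq_zero hX' hY,
    M.Q_comm X X', M.Q_comm Y Y']

theorem isDiag_right₁ (h : M.IsWeightSplitting p₁ p₂ s) {b : LinearMap.BilinForm ℝ M.tangent}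
    {x₁ x₂ : ℝ} (hb : M.IsDiag p₁ p₂ b x₁ x₂) {X : M.tangent} (hX : X ∈ p₁) (V : M.tangent) :
    b V X = x₁ * M.Q V X := by rw [h.isDiag_comm hb, hb.1 X hX, M.Q_comm]

theorem isDiag_right₂ (h : M.IsWeightSplitting p₁ p₂ s) {b : LinearMap.BilinForm ℝ M.tangent}
    {x₁ x₂ : ℝ} (hb : M.IsDiag p₁ p₂ b x₁ x₂) {X : M.tangent} (hX : X ∈ p₂) (V : M.tangent) :
    b V X = x₂ * M.Q V X := by rw [h.isDiag_comm hb, hb.2 X hX, M.Q_comm]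

theorem isDiag_pos (h : M.IsWeightSplitting p₁ p₂ s) {b : LinearMap.BilinForm ℝ M.tangent}
    {x₁ x₂ : ℝ} (hb : M.IsDiag p₁ p₂ b x₁ x₂) (h₁ : 0 < x₁) (h₂ : 0 < x₂) {V : M.tangent}
    (hV : V ≠ 0) : 0 < b V V := by
  obtain ⟨X, hX, Y, hY, rfl⟩ := h.exists_add V
  have e1 : b (X + Y) (X + Y) = x₁ * M.Q X X + x₂ * M.Q Y Y := by
    simp only [map_add, LinearMap.add_apply, hb.1 X hX, hb.2 Y hY, h.Q_eq_zero hX hY,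
      h.Q_eq_zero' hX hY]
    ring
  rw [e1]
  rcases eq_or_ne X 0 with rfl | hX0
  · have : 0 < M.Q Y Y := M.Q_pos (by simpa using hV)
    simp only [map_zero, mul_zero, zero_add]
    positivity
  · have h3 := M.Q_pos hX0
    rcases eq_or_ne Y 0 with rfl | hY0
    · simp only [map_zero, mul_zero, add_zero]
      positivity
    · have h4 := M.Q_pos hY0
      positivity

theorem isDiag_invariant (h : M.IsWeightSplitting p₁ p₂ s) {b : LinearMap.BilinForm ℝ M.tangent}
    {x₁ x₂ : ℝ} (hb : M.IsDiag p₁ p₂ b x₁ x₂) : M.IsInvariantTensor b := by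
  refine ⟨h.isDiag_comm hb, fun k U V => ?_⟩
  obtain ⟨X, hX, Y, hY, rfl⟩ := h.exists_add U
  simp only [map_add, LinearMap.add_apply, hb.1 X hX, hb.2 Y hY, hb.1 _ (h.irr₁.2.1 k X hX),
    hb.2 _ (h.irr₂.2.1 k Y hY), Q_Ad]

theorem isDiag_metric (h : M.IsWeightSplitting p₁ p₂ s) {b : LinearMap.BilinForm ℝ M.tangent}
    {x₁ x₂ : ℝ} (hb : M.IsDiag p₁ p₂ b x₁ x₂) (h₁ : 0 < x₁) (h₂ : 0 < x₂) :
    M.IsInvariantMetric b :=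
  ⟨h.isDiag_invariant hb, fun _ => h.isDiag_pos hb h₁ h₂⟩

/-- Schur's lemma gives a scalar on each summand, and distinct weights kill the mixed part. -/
theorem exists_isDiag (h : M.IsWeightSplitting p₁ p₂ s) {b : LinearMap.BilinForm ℝ M.tangent}
    (hb : M.IsInvariantTensor b) : ∃ x₁ x₂, M.IsDiag p₁ p₂ b x₁ x₂ := by
  obtain ⟨x₁, h₁⟩ := h.irr₁.exists_eq_smul_Q b (fun X _ Y _ => hb.1 X Y)
    (fun k X _ Y _ => hb.2 k X Y)
  obtain ⟨x₂, h₂⟩ := h.irr₂.exists_eq_smul_Q b (fun X _ Y _ => hb.1 X Y)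
    (fun k X _ Y _ => hb.2 k X Y)
  refine ⟨x₁, x₂, fun X hX V => ?_, fun Y hY V => ?_⟩
  · obtain ⟨X', hX', Y, hY, rfl⟩ := h.exists_add V
    rw [map_add, map_add, h₁ X hX X' hX', h.form_eq_zero hb.2 hX hY, h.Q_eq_zero hX hY, add_zero,
      add_zero]
  · obtain ⟨X, hX, Y', hY', rfl⟩ := h.exists_add V
    rw [map_add, map_add, h₂ Y hY Y' hY', hb.1 Y X, h.form_eq_zero hb.2 hX hY,
      h.Q_eq_zero' hX hY, zero_add, zero_add]

theorem exists_isDiag_metric (h : M.IsWeightSplitting p₁ p₂ s)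
    {b : LinearMap.BilinForm ℝ M.tangent} (hb : M.IsInvariantMetric b) :
    ∃ x₁ x₂, 0 < x₁ ∧ 0 < x₂ ∧ M.IsDiag p₁ p₂ b x₁ x₂ := by
  obtain ⟨x₁, x₂, hd⟩ := h.exists_isDiag hb.1
  obtain ⟨X, hX, hX0⟩ := Submodule.exists_mem_ne_zero_of_ne_bot h.irr₁.1
  obtain ⟨Y, hY, hY0⟩ := Submodule.exists_mem_ne_zero_of_ne_bot h.irr₂.1
  have h1 := hb.2 X hX0
  have h2 := hb.2 Y hY0
  rw [hd.1 X hX] at h1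
  rw [hd.2 Y hY] at h2
  exact ⟨x₁, x₂, (pos_iff_pos_of_mul_pos h1).2 (M.Q_pos hX0),
    (pos_iff_pos_of_mul_pos h2).2 (M.Q_pos hY0), hd⟩

theorem isDiag_nondegenerate (h : M.IsWeightSplitting p₁ p₂ s)
    {g : LinearMap.BilinForm ℝ M.tangent} {x₁ x₂ : ℝ} (hg : M.IsDiag p₁ p₂ g x₁ x₂) (h₁ : 0 < x₁)
    (h₂ : 0 < x₂) : g.Nondegenerate := (h.isDiag_metric hg h₁ h₂).nondegenerate

section Metric

variable {g : LinearMap.BilinForm ℝ M.tangent} {x₁ x₂ : ℝ}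

theorem toEnd_eq (h : M.IsWeightSplitting p₁ p₂ s) (hg : M.IsDiag p₁ p₂ g x₁ x₂) (h₁ : 0 < x₁)
    (h₂ : 0 < x₂) {b : LinearMap.BilinForm ℝ M.tangent} {X W : M.tangent}
    (hW : ∀ Z, g W Z = b X Z) : M.toEnd g b X = W := by
  have hnd := h.isDiag_nondegenerate hg h₁ h₂
  rw [← sub_eq_zero]
  refine hnd.1 _ fun Z => ?_
  rw [map_sub, LinearMap.sub_apply, M.toEnd_spec hnd, hW, sub_self]

theorem toEnd_diag₁ (h : M.IsWeightSplitting p₁ p₂ s) (hg : M.IsDiag p₁ p₂ g x₁ x₂) (h₁ : 0 < x₁)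
    (h₂ : 0 < x₂) {b : LinearMap.BilinForm ℝ M.tangent} {y₁ y₂ : ℝ}
    (hb : M.IsDiag p₁ p₂ b y₁ y₂) {X : M.tangent} (hX : X ∈ p₁) :
    M.toEnd g b X = (y₁ / x₁) • X :=
  h.toEnd_eq hg h₁ h₂ fun Z => by
    rw [map_smul, LinearMap.smul_apply, hg.1 X hX, hb.1 X hX, smul_eq_mul]; field_simp

theorem toEnd_diag₂ (h : M.IsWeightSplitting p₁ p₂ s) (hg : M.IsDiag p₁ p₂ g x₁ x₂) (h₁ : 0 < x₁)
    (h₂ : 0 < x₂) {b : LinearMap.BilinForm ℝ M.tangent} {y₁ y₂ : ℝ}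
    (hb : M.IsDiag p₁ p₂ b y₁ y₂) {X : M.tangent} (hX : X ∈ p₂) :
    M.toEnd g b X = (y₂ / x₂) • X :=
  h.toEnd_eq hg h₁ h₂ fun Z => by
    rw [map_smul, LinearMap.smul_apply, hg.2 X hX, hb.2 X hX, smul_eq_mul]; field_simp

theorem metricTrace_eq (h : M.IsWeightSplitting p₁ p₂ s) (hg : M.IsDiag p₁ p₂ g x₁ x₂)
    (h₁ : 0 < x₁) (h₂ : 0 < x₂) {ι κ : Type*} [Fintype ι] [Fintype κ]
    [DecidableEq ι] [DecidableEq κ]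
    {e : ι → M.tangent} {f : κ → M.tangent} (he : M.IsOrthonormalBasisOf e p₁)
    (hf : M.IsOrthonormalBasisOf f p₂) (b : LinearMap.BilinForm ℝ M.tangent) :
    M.metricTrace g b = x₁⁻¹ * ∑ i, b (e i) (e i) + x₂⁻¹ * ∑ j, b (f j) (f j) := by
  have hnd := h.isDiag_nondegenerate hg h₁ h₂
  rw [metricTrace, LinearMap.comp_apply, h.trace_eq he hf, Finset.mul_sum, Finset.mul_sum]
  congr 1
  · refine Finset.sum_congr rfl fun i _ => ?_
    rw [← M.toEnd_spec hnd b, h.isDiag_right₁ hg (he.mem i)]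
    field_simp
  · refine Finset.sum_congr rfl fun i _ => ?_
    rw [← M.toEnd_spec hnd b, h.isDiag_right₂ hg (hf.mem i)]
    field_simp

theorem metricTrace_diag (h : M.IsWeightSplitting p₁ p₂ s) (hg : M.IsDiag p₁ p₂ g x₁ x₂)
    (h₁ : 0 < x₁) (h₂ : 0 < x₂) {b : LinearMap.BilinForm ℝ M.tangent} {y₁ y₂ : ℝ}
    (hb : M.IsDiag p₁ p₂ b y₁ y₂) :
    M.metricTrace g b = Module.finrank ℝ p₁ * (y₁ / x₁) + Module.finrank ℝ p₂ * (y₂ / x₂) := by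
  obtain ⟨e, he⟩ := M.exists_isOrthonormalBasisOf p₁
  obtain ⟨f, hf⟩ := M.exists_isOrthonormalBasisOf p₂
  rw [h.metricTrace_eq hg h₁ h₂ he hf]
  simp only [hb.1 _ (he.mem _), hb.2 _ (hf.mem _), he.1, hf.1]
  simp only [if_true, mul_one, Finset.sum_const, Finset.card_univ, Fintype.card_fin, nsmul_eq_mul]
  ring

theorem koszul_apply (X Y Z : M.tangent) : M.koszul g X Y Z =
    1 / 2 * (g (M.bracket X Y) Z - g (M.bracket Y Z) X - g (M.bracket X Z) Y) := by
  simp [koszul]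

/-- By cyclic symmetry of `Q([X, Y]_𝔭, Z)` the Koszul formula collapses to a multiple of the
bracket. If `X`, `Y` and `[X, Y]_𝔭` lie in summands with metric factors `x`, `y`, `z`, that multiple
is `(z + y - x) / (2z)`. The next three lemmas are the other cases. -/
theorem leviCivita₁₁ (h : M.IsWeightSplitting p₁ p₂ s) (hg : M.IsDiag p₁ p₂ g x₁ x₂)
    (h₁ : 0 < x₁) (h₂ : 0 < x₂) {X X' : M.tangent} (hX : X ∈ p₁) (hX' : X' ∈ p₁) :
    M.leviCivita g X X' = (1 / 2 : ℝ) • M.bracket X X' :=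
  h.toEnd_eq hg h₁ h₂ fun Z => by
    rw [koszul_apply, map_smul, LinearMap.smul_apply, h.isDiag_right₁ hg hX,
      h.isDiag_right₁ hg hX', Q_cyc X X', Q_cyc X' X, M.bracket_swap X' X]
    simp

theorem leviCivita₁₂ (h : M.IsWeightSplitting p₁ p₂ s) (hg : M.IsDiag p₁ p₂ g x₁ x₂)
    (h₁ : 0 < x₁) (h₂ : 0 < x₂) {X Y : M.tangent} (hX : X ∈ p₁) (hY : Y ∈ p₂) :
    M.leviCivita g X Y = (x₂ / x₁ / 2) • M.bracket X Y :=
  h.toEnd_eq hg h₁ h₂ fun Z => by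
    rw [koszul_apply, map_smul, LinearMap.smul_apply, h.isDiag_right₁ hg hX,
      h.isDiag_right₂ hg hY, Q_cyc X Y, Q_cyc Y X, M.bracket_swap Y X,
      hg.1 _ (h.bracket_mem₁₂ hX hY), smul_eq_mul, map_neg, LinearMap.neg_apply]
    field_simp
    ring

theorem leviCivita₂₁ (h : M.IsWeightSplitting p₁ p₂ s) (hg : M.IsDiag p₁ p₂ g x₁ x₂)
    (h₁ : 0 < x₁) (h₂ : 0 < x₂) {X Y : M.tangent} (hX : X ∈ p₁) (hY : Y ∈ p₂) :
    M.leviCivita g Y X = (1 - x₂ / x₁ / 2) • M.bracket Y X :=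
  h.toEnd_eq hg h₁ h₂ fun Z => by
    rw [koszul_apply, map_smul, LinearMap.smul_apply, h.isDiag_right₁ hg hX,
      h.isDiag_right₂ hg hY, Q_cyc Y X, Q_cyc X Y, M.bracket_swap X Y,
      hg.1 _ (h.bracket_mem₂₁ hX hY), smul_eq_mul, map_neg, LinearMap.neg_apply]
    field_simp
    ring

theorem leviCivita₂₂ (h : M.IsWeightSplitting p₁ p₂ s) (hg : M.IsDiag p₁ p₂ g x₁ x₂)
    (h₁ : 0 < x₁) (h₂ : 0 < x₂) {Y Y' : M.tangent} (hY : Y ∈ p₂) (hY' : Y' ∈ p₂) :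
    M.leviCivita g Y Y' = 0 :=
  h.toEnd_eq hg h₁ h₂ fun Z => by
    rw [koszul_apply, h.isDiag_right₂ hg hY, h.isDiag_right₂ hg hY', Q_cyc Y Y', Q_cyc Y' Y,
      h.bracket₂₂ hY hY', h.bracket₂₂ hY' hY]
    simp

theorem curvature_apply (X Y Z : M.tangent) : M.curvature g X Y Z =
    M.leviCivita g X (M.leviCivita g Y Z) - M.leviCivita g Y (M.leviCivita g X Z) -
      M.leviCivita g (M.bracket X Y) Z -
        M.adProj (⁅(X : L), (Y : L)⁆ - M.bracket X Y) Z := rfl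

theorem ricci_apply (Y Z : M.tangent) : M.ricci g Y Z =
    LinearMap.trace ℝ M.tangent (((M.curvature g).flip Y).flip Z) := rfl

/-- The part of the sectional curvature sum that involves the connection only. -/
def connectionTerm (M : FlagManifold L) (g : LinearMap.BilinForm ℝ M.tangent)
    (Y Z v : M.tangent) : ℝ :=
  M.Q (M.leviCivita g v (M.leviCivita g Y Z)) v - M.Q (M.leviCivita g Y (M.leviCivita g v Z)) v -
    M.Q (M.leviCivita g (M.bracket v Y) Z) v

/-- The isotropy term of the curvature is replaced through `sum_isotropy_curvature`, after which
only the projected bracket is left. -/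
theorem ricci_eq_sum (h : M.IsWeightSplitting p₁ p₂ s) {ι κ : Type*} [Fintype ι] [Fintype κ]
    [DecidableEq ι] [DecidableEq κ]
    {e : ι → M.tangent} {f : κ → M.tangent} (he : M.IsOrthonormalBasisOf e p₁)
    (hf : M.IsOrthonormalBasisOf f p₂) (Y Z : M.tangent) :
    M.ricci g Y Z = ∑ i, connectionTerm M g Y Z (e i) + ∑ j, connectionTerm M g Y Z (f j) +
      1 / 2 * (M.Q Y Z - (∑ i, M.Q (M.bracket (e i) Y) (M.bracket (e i) Z) +
        ∑ j, M.Q (M.bracket (f j) Y) (M.bracket (f j) Z))) := by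
  have hs := M.sum_isotropy_curvature (h.sumElim he hf) Y Z
  simp only [Fintype.sum_sum_type, Sum.elim_inl, Sum.elim_inr] at hs
  rw [ricci_apply, h.trace_eq he hf]
  simp only [LinearMap.flip_apply, curvature_apply]
  have hd : ∀ v, M.Q (M.leviCivita g v (M.leviCivita g Y Z) -
      M.leviCivita g Y (M.leviCivita g v Z) - M.leviCivita g (M.bracket v Y) Z -
        M.adProj (⁅(v : L), (Y : L)⁆ - M.bracket v Y) Z) v = connectionTerm M g Y Z v -
      M.Q (M.adProj (⁅(v : L), (Y : L)⁆ - M.bracket v Y) Z) v := fun v => by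
    simp [connectionTerm]
  simp only [hd, Finset.sum_sub_distrib]
  linarith

theorem Q_bracket_self (v W : M.tangent) : M.Q (M.bracket v W) v = 0 := by
  have h1 := Q_bracket M v W v
  rw [M.bracket_swap W v, map_neg, M.Q_comm v] at h1
  linarith

theorem Q_bracket_bracket (v W Y : M.tangent) :
    M.Q (M.bracket Y W) v = M.Q (M.bracket v Y) W := Q_cyc v Y W

theorem Q_bracket_bracket' (v W Z : M.tangent) :
    M.Q (M.bracket W Z) v = -M.Q W (M.bracket v Z) := by
  rw [Q_bracket, M.bracket_swap Z v, map_neg]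

/-- Each connection term with `Y`, `Z` in the same summand is a multiple of `Q([v, Y], [v, Z])`,
summed by `sums`; terms with `Y`, `Z` in different summands vanish by the grading of the bracket. -/
theorem ricci_isDiag (h : M.IsWeightSplitting p₁ p₂ s) (hg : M.IsDiag p₁ p₂ g x₁ x₂)
    (h₁ : 0 < x₁) (h₂ : 0 < x₂) :
    M.IsDiag p₁ p₂ (M.ricci g) (1 / 2 - x₂ / x₁ / 2 * coeff₁ p₁ p₂)
      (1 / 2 + ((x₂ / x₁) ^ 2 / 4 - 1 / 2) * coeff₂ p₁ p₂) := by
  obtain ⟨e, he⟩ := M.exists_isOrthonormalBasisOf p₁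
  obtain ⟨f, hf⟩ := M.exists_isOrthonormalBasisOf p₂
  obtain ⟨hα, hα', hβ⟩ := h.sums he hf
  have Λ₁₁ := fun {X X'} => h.leviCivita₁₁ hg h₁ h₂ (X := X) (X' := X')
  have Λ₁₂ := fun {X Y} => h.leviCivita₁₂ hg h₁ h₂ (X := X) (Y := Y)
  have Λ₂₁ := fun {X Y} => h.leviCivita₂₁ hg h₁ h₂ (X := X) (Y := Y)
  have Λ₂₂ := fun {Y Y'} => h.leviCivita₂₂ hg h₁ h₂ (Y := Y) (Y' := Y')
  -- The connection, and so the Ricci tensor, depends on the metric only through this ratio.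
  generalize x₂ / x₁ = t at *
  constructor
  · intro Y hY V
    obtain ⟨Z, hZ, Z', hZ', rfl⟩ := h.exists_add V
    have k1 : ∀ i, connectionTerm M g Y Z (e i) =
        (1 - 3 * t / 4) * M.Q (M.bracket (e i) Y) (M.bracket (e i) Z) := fun i => by
      have hv := he.mem i
      have m1 := h.bracket_mem₁₁ hY hZ
      have m2 := h.bracket_mem₁₁ hv hZ
      have m3 := h.bracket_mem₁₁ hv hY
      simp only [connectionTerm, Λ₁₁ hY hZ, Λ₁₁ hv hZ, Λ₁₂ hv m1, Λ₁₂ hY m2, Λ₂₁ hZ m3,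
        map_smul, LinearMap.smul_apply, smul_eq_mul]
      rw [Q_bracket_self (e i), Q_bracket_bracket (e i) (M.bracket (e i) Z) Y,
        Q_bracket_bracket' (e i) (M.bracket (e i) Y) Z]
      ring
    have k2 : ∀ j, connectionTerm M g Y Z (f j) =
        (t / 4) * M.Q (M.bracket (f j) Y) (M.bracket (f j) Z) := fun j => by
      have hv := hf.mem j
      have m1 := h.bracket_mem₁₁ hY hZ
      have m2 := h.bracket_mem₂₁ hZ hv
      have m3 := h.bracket_mem₂₁ hY hv
      simp only [connectionTerm, Λ₁₁ hY hZ, Λ₂₁ hZ hv, Λ₂₂ hv m1, Λ₁₁ hY m2,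
        Λ₁₁ m3 hZ, map_smul, map_zero, LinearMap.smul_apply, LinearMap.zero_apply, smul_eq_mul, smul_zero]
      rw [Q_bracket_bracket (f j) (M.bracket (f j) Z) Y,
        Q_bracket_bracket' (f j) (M.bracket (f j) Y) Z]
      ring
    have k3 : ∀ i, connectionTerm M g Y Z' (e i) = 0 := fun i => by
      have hv := he.mem i
      have m1 := h.bracket_mem₁₂ hY hZ'
      have m2 := h.bracket_mem₁₂ hv hZ'
      have m3 := h.bracket_mem₁₁ hv hY
      simp only [connectionTerm, Λ₁₂ hY hZ', Λ₁₂ hv hZ', Λ₁₁ hv m1, Λ₁₁ hY m2, Λ₂₂ m3 hZ',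
        map_smul, map_zero, LinearMap.smul_apply, LinearMap.zero_apply, smul_eq_mul]
      simp only [h.Q_eq_zero' hv (h.bracket_mem₁₁ hv m1), h.Q_eq_zero' hv (h.bracket_mem₁₁ hY m2)]
      ring
    have k4 : ∀ j, connectionTerm M g Y Z' (f j) = 0 := fun j => by
      have hv := hf.mem j
      have m1 := h.bracket_mem₁₂ hY hZ'
      have m3 := h.bracket_mem₂₁ hY hv
      simp only [connectionTerm, Λ₁₂ hY hZ', Λ₂₂ hv hZ', Λ₂₁ m1 hv, Λ₁₂ m3 hZ',
        map_smul, map_zero, LinearMap.smul_apply, LinearMap.zero_apply, smul_eq_mul]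
      simp only [h.Q_eq_zero (h.bracket_mem₂₁ m1 hv) hv, h.Q_eq_zero (h.bracket_mem₁₂ m3 hZ') hv]
      ring
    rw [map_add, map_add, h.ricci_eq_sum he hf, h.ricci_eq_sum he hf]
    simp only [k1, k2, k3, k4, ← Finset.mul_sum, hα Y hY, hα' Y hY, h.Q_eq_zero hY hZ']
    simp only [Finset.sum_const_zero]
    ring
  · intro Y hY V
    obtain ⟨Z, hZ, Z', hZ', rfl⟩ := h.exists_add V
    have b0 : ∀ j, M.bracket (f j) Y = 0 := fun j => h.bracket₂₂ (hf.mem j) hY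
    have k1 : ∀ i, connectionTerm M g Y Z' (e i) =
        (t ^ 2 / 4) * M.Q (M.bracket (e i) Y) (M.bracket (e i) Z') := fun i => by
      have hv := he.mem i
      have m2 := h.bracket_mem₁₂ hv hZ'
      have m3 := h.bracket_mem₁₂ hv hY
      simp only [connectionTerm, Λ₂₂ hY hZ', Λ₁₂ hv hZ', Λ₂₁ m2 hY, Λ₁₂ m3 hZ',
        map_smul, map_zero, LinearMap.smul_apply, LinearMap.zero_apply, smul_eq_mul]
      rw [Q_bracket_bracket (e i) (M.bracket (e i) Z') Y,
        Q_bracket_bracket' (e i) (M.bracket (e i) Y) Z']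
      ring
    have k2 : ∀ j, connectionTerm M g Y Z' (f j) = 0 := fun j => by
      have hv := hf.mem j
      simp only [connectionTerm, Λ₂₂ hY hZ', Λ₂₂ hv hZ', b0]
      simp
    have k3 : ∀ i, connectionTerm M g Y Z (e i) = 0 := fun i => by
      have hv := he.mem i
      have m1 := h.bracket_mem₂₁ hZ hY
      have m2 := h.bracket_mem₁₁ hv hZ
      have m3 := h.bracket_mem₁₂ hv hY
      simp only [connectionTerm, Λ₂₁ hZ hY, Λ₁₁ hv hZ, Λ₁₁ hv m1, Λ₂₂ hY m2, Λ₁₁ m3 hZ,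
        map_smul, map_zero, LinearMap.smul_apply, LinearMap.zero_apply, smul_eq_mul, smul_zero]
      simp only [h.Q_eq_zero' hv (h.bracket_mem₁₁ hv m1), h.Q_eq_zero' hv (h.bracket_mem₁₁ m3 hZ)]
      ring
    have k4 : ∀ j, connectionTerm M g Y Z (f j) = 0 := fun j => by
      have hv := hf.mem j
      have m1 := h.bracket_mem₂₁ hZ hY
      have m2 := h.bracket_mem₂₁ hZ hv
      simp only [connectionTerm, Λ₂₁ hZ hY, Λ₂₁ hZ hv, Λ₂₁ m1 hv, Λ₂₁ m2 hY, b0,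
        map_smul, map_zero, LinearMap.smul_apply, LinearMap.zero_apply, smul_eq_mul]
      simp only [h.Q_eq_zero (h.bracket_mem₂₁ m1 hv) hv, h.Q_eq_zero (h.bracket_mem₂₁ m2 hY) hv]
      ring
    rw [map_add, map_add, h.ricci_eq_sum he hf, h.ricci_eq_sum he hf]
    simp only [k1, k2, k3, k4, ← Finset.mul_sum, hβ Y hY, b0, h.Q_eq_zero' hZ hY]
    simp only [Finset.sum_const_zero, map_zero, LinearMap.zero_apply]
    ring

theorem scal_eq (h : M.IsWeightSplitting p₁ p₂ s) (hg : M.IsDiag p₁ p₂ g x₁ x₂)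
    (h₁ : 0 < x₁) (h₂ : 0 < x₂) :
    M.scal g = Module.finrank ℝ p₁ * ((1 / 2 - x₂ / x₁ / 2 * coeff₁ p₁ p₂) / x₁) +
      Module.finrank ℝ p₂ * ((1 / 2 + ((x₂ / x₁) ^ 2 / 4 - 1 / 2) * coeff₂ p₁ p₂) / x₂) :=
  h.metricTrace_diag hg h₁ h₂ (h.ricci_isDiag hg h₁ h₂)

theorem isEinsteinWith_iff (h : M.IsWeightSplitting p₁ p₂ s) (hg : M.IsDiag p₁ p₂ g x₁ x₂)
    (h₁ : 0 < x₁) (h₂ : 0 < x₂) (ρ : ℝ) :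
    M.IsEinsteinWith g ρ ↔ 1 / 2 - x₂ / x₁ / 2 * coeff₁ p₁ p₂ = ρ * x₁ ∧
      1 / 2 + ((x₂ / x₁) ^ 2 / 4 - 1 / 2) * coeff₂ p₁ p₂ = ρ * x₂ := by
  have hr := h.ricci_isDiag hg h₁ h₂
  constructor
  · intro he
    exact h.isDiag_inj hr (he ▸ hg.smul ρ)
  · rintro ⟨e1, e2⟩
    rw [e1, e2] at hr
    exact h.isDiag_ext hr (hg.smul ρ)

/-- The Einstein equation for `(x₁, x₂)`. -/
theorem isEinstein_iff (h : M.IsWeightSplitting p₁ p₂ s) (hg : M.IsDiag p₁ p₂ g x₁ x₂)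
    (h₁ : 0 < x₁) (h₂ : 0 < x₂) :
    M.IsEinstein g ↔ x₂ = 2 * x₁ ∨
      x₂ = 4 * (Module.finrank ℝ p₂ : ℝ) / (Module.finrank ℝ p₁ + 2 * Module.finrank ℝ p₂) * x₁ := by
  have hd₁ := h.finrank_pos₁
  have hd₂ := h.finrank_pos₂
  have key : M.IsEinstein g ↔ (1 / 2 - x₂ / x₁ / 2 * coeff₁ p₁ p₂) * x₂ =
      (1 / 2 + ((x₂ / x₁) ^ 2 / 4 - 1 / 2) * coeff₂ p₁ p₂) * x₁ := by
    constructor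
    · rintro ⟨ρ, hρ⟩
      obtain ⟨e1, e2⟩ := (h.isEinsteinWith_iff hg h₁ h₂ ρ).1 hρ
      rw [e1, e2]; ring
    · intro he
      refine ⟨(1 / 2 - x₂ / x₁ / 2 * coeff₁ p₁ p₂) / x₁,
        (h.isEinsteinWith_iff hg h₁ h₂ _).2 ⟨by field_simp, ?_⟩⟩
      rw [div_mul_eq_mul_div, he]; field_simp
  rw [key, coeff₁, coeff₂]
  generalize (Module.finrank ℝ p₁ : ℝ) = d₁ at *
  generalize (Module.finrank ℝ p₂ : ℝ) = d₂ at *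
  -- The difference of the two sides factors into two linear forms in `(x₁, x₂)`, one for each
  -- Einstein metric.
  have h3 : (1 / 2 - x₂ / x₁ / 2 * (d₂ / (d₁ + 4 * d₂))) * x₂ -
      (1 / 2 + ((x₂ / x₁) ^ 2 / 4 - 1 / 2) * (d₁ / (d₁ + 4 * d₂))) * x₁ =
      -((x₂ - 2 * x₁) * ((d₁ + 2 * d₂) * x₂ - 4 * d₂ * x₁)) / (4 * x₁ * (d₁ + 4 * d₂)) := by
    field_simp
    ring
  rw [← sub_eq_zero, h3, neg_div, neg_eq_zero, div_eq_zero_iff,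
    or_iff_left (by positivity), mul_eq_zero, sub_eq_zero, sub_eq_zero, div_mul_eq_mul_div,
    eq_div_iff (by positivity), mul_comm x₂]

end Metric

end IsWeightSplitting

end

/-! ### The moment map, TT-tensors and the Lichnerowicz eigenvalue. -/

section

variable {L : Type*} [LieRing L] [LieAlgebra ℝ L] [FiniteDimensional ℝ L] {M : FlagManifold L}
  {p₁ p₂ : Submodule ℝ M.tangent} {s : L}

theorem IsOrthonormalBasisOf.eq_sum {ι : Type*} [Fintype ι] [DecidableEq ι] {e : ι → M.tangent}
    {p : Submodule ℝ M.tangent} (he : M.IsOrthonormalBasisOf e p) {X : M.tangent} (hX : X ∈ p) :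
    X = ∑ i, M.Q X (e i) • e i := by
  rw [← sub_eq_zero]
  refine M.Q_self_eq_zero ?_
  have h1 : ∀ V, M.Q (X - ∑ i, M.Q X (e i) • e i) V = 0 := fun V => by
    rw [map_sub, LinearMap.sub_apply, he.parseval hX V, map_sum, LinearMap.sum_apply, sub_eq_zero]
    refine Finset.sum_congr rfl fun i _ => ?_
    rw [map_smul, LinearMap.smul_apply, smul_eq_mul, M.Q_comm V]
  exact h1 _

theorem IsOrthonormalBasisOf.Q_map_eq_sum {ι : Type*} [Fintype ι] [DecidableEq ι]
    {e : ι → M.tangent} {p : Submodule ℝ M.tangent} (he : M.IsOrthonormalBasisOf e p)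
    {X : M.tangent} (hX : X ∈ p) (W : M.tangent) (C : Module.End ℝ M.tangent) :
    M.Q W (C X) = ∑ i, M.Q X (e i) * M.Q W (C (e i)) := by
  conv_lhs => rw [he.eq_sum hX]
  simp only [map_sum, map_smul, smul_eq_mul]

/-- The operator `A` is the multiplication by `v₁` on `p₁` and by `v₂` on `p₂`. -/
def IsDiagEnd (M : FlagManifold L) (p₁ p₂ : Submodule ℝ M.tangent)
    (A : Module.End ℝ M.tangent) (v₁ v₂ : ℝ) : Prop :=
  (∀ X ∈ p₁, A X = v₁ • X) ∧ ∀ Y ∈ p₂, A Y = v₂ • Y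

theorem theta_apply (A : Module.End ℝ M.tangent) (b : M.tangent →ₗ[ℝ] M.tangent →ₗ[ℝ] M.tangent)
    (X Y : M.tangent) : M.theta A b X Y = A (b X Y) - b (A X) Y - b X (A Y) := rfl

theorem theta_bracket_swap (A : Module.End ℝ M.tangent) (X Y : M.tangent) :
    M.theta A M.bracket X Y = -M.theta A M.bracket Y X := by
  rw [theta_apply, theta_apply, M.bracket_swap Y X, M.bracket_swap (A Y) X,
    M.bracket_swap Y (A X), map_neg]
  abel

namespace IsWeightSplitting

section Metric

variable {g : LinearMap.BilinForm ℝ M.tangent} {x₁ x₂ : ℝ}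

theorem Q_diagEnd₁ (h : M.IsWeightSplitting p₁ p₂ s) {A : Module.End ℝ M.tangent} {v₁ v₂ : ℝ}
    (hA : M.IsDiagEnd p₁ p₂ A v₁ v₂) {X : M.tangent} (hX : X ∈ p₁) (W : M.tangent) :
    M.Q (A W) X = v₁ * M.Q W X := by
  obtain ⟨X', hX', Y, hY, rfl⟩ := h.exists_add W
  simp [hA.1 X' hX', hA.2 Y hY, h.Q_eq_zero' hX hY]

theorem Q_diagEnd₂ (h : M.IsWeightSplitting p₁ p₂ s) {A : Module.End ℝ M.tangent} {v₁ v₂ : ℝ}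
    (hA : M.IsDiagEnd p₁ p₂ A v₁ v₂) {Y : M.tangent} (hY : Y ∈ p₂) (W : M.tangent) :
    M.Q (A W) Y = v₂ * M.Q W Y := by
  obtain ⟨X, hX, Y', hY', rfl⟩ := h.exists_add W
  simp [hA.1 X hX, hA.2 Y' hY', h.Q_eq_zero hX hY]

theorem toEnd_isDiagEnd (h : M.IsWeightSplitting p₁ p₂ s) (hg : M.IsDiag p₁ p₂ g x₁ x₂)
    (h₁ : 0 < x₁) (h₂ : 0 < x₂) {b : LinearMap.BilinForm ℝ M.tangent} {y₁ y₂ : ℝ}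
    (hb : M.IsDiag p₁ p₂ b y₁ y₂) : M.IsDiagEnd p₁ p₂ (M.toEnd g b) (y₁ / x₁) (y₂ / x₂) :=
  ⟨fun _ hX => h.toEnd_diag₁ hg h₁ h₂ hb hX, fun _ hX => h.toEnd_diag₂ hg h₁ h₂ hb hX⟩

theorem innerBracket_eq_sum (h : M.IsWeightSplitting p₁ p₂ s) (hg : M.IsDiag p₁ p₂ g x₁ x₂)
    (h₁ : 0 < x₁) (h₂ : 0 < x₂) {ι κ : Type*} [Fintype ι] [Fintype κ]
    [DecidableEq ι] [DecidableEq κ]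
    {e : ι → M.tangent} {f : κ → M.tangent} (he : M.IsOrthonormalBasisOf e p₁)
    (hf : M.IsOrthonormalBasisOf f p₂) (b c : M.tangent →ₗ[ℝ] M.tangent →ₗ[ℝ] M.tangent) :
    M.innerBracket g b c =
      x₁⁻¹ * ∑ i, (x₁⁻¹ * ∑ k, g (b (e i) (e k)) (c (e i) (e k)) +
        x₂⁻¹ * ∑ j, g (b (e i) (f j)) (c (e i) (f j))) +
      x₂⁻¹ * ∑ j, (x₁⁻¹ * ∑ i, g (b (f j) (e i)) (c (f j) (e i)) +
        x₂⁻¹ * ∑ k, g (b (f j) (f k)) (c (f j) (f k))) := by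
  rw [innerBracket, h.metricTrace_eq hg h₁ h₂ he hf]
  simp only [LinearMap.mk₂_apply, h.metricTrace_eq hg h₁ h₂ he hf, LinearMap.compl₁₂_apply]

theorem innerBracket_comm (h : M.IsWeightSplitting p₁ p₂ s) (hg : M.IsDiag p₁ p₂ g x₁ x₂)
    (h₁ : 0 < x₁) (h₂ : 0 < x₂) (b c : M.tangent →ₗ[ℝ] M.tangent →ₗ[ℝ] M.tangent) :
    M.innerBracket g b c = M.innerBracket g c b := by
  obtain ⟨e, he⟩ := M.exists_isOrthonormalBasisOf p₁
  obtain ⟨f, hf⟩ := M.exists_isOrthonormalBasisOf p₂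
  rw [h.innerBracket_eq_sum hg h₁ h₂ he hf, h.innerBracket_eq_sum hg h₁ h₂ he hf]
  simp only [fun U V => h.isDiag_comm hg (b U V) (c U V)]

section Sums

variable {e : Fin (Module.finrank ℝ p₁) → M.tangent} {f : Fin (Module.finrank ℝ p₂) → M.tangent}

/-- This and the next five sums reduce the inner product with `θ(C)μ`, for arbitrary `C`, to the
partial traces of `C` over `p₁` and `p₂`. Parseval and cyclic symmetry move `C` onto a basis vector,
after which the remaining sum is a Schur scalar. -/
theorem sum_map_bracket₁₁ (h : M.IsWeightSplitting p₁ p₂ s) (he : M.IsOrthonormalBasisOf e p₁)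
    (hf : M.IsOrthonormalBasisOf f p₂) (C : Module.End ℝ M.tangent) :
    ∑ i, ∑ k, M.Q (M.bracket (e i) (e k)) (C (M.bracket (e i) (e k))) =
      coeff₂ p₁ p₂ * ∑ j, M.Q (C (f j)) (f j) := by
  have h1 : ∀ i k, M.Q (M.bracket (e i) (e k)) (C (M.bracket (e i) (e k))) =
      ∑ j, M.Q (M.bracket (f j) (e i)) (e k) * M.Q (M.bracket (C (f j)) (e i)) (e k) :=
        fun i k => by
    rw [hf.Q_map_eq_sum (h.bracket_mem₁₁ (he.mem i) (he.mem k))]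
    refine Finset.sum_congr rfl fun j _ => ?_
    rw [← Q_cyc (f j), ← Q_cyc (C (f j))]
  have h2 : ∀ i j, ∑ k, M.Q (M.bracket (f j) (e i)) (e k) * M.Q (M.bracket (C (f j)) (e i)) (e k) =
      M.Q (M.bracket (e i) (f j)) (M.bracket (e i) (C (f j))) := fun i j => by
    rw [← he.parseval (h.bracket_mem₂₁ (he.mem i) (hf.mem j)), M.bracket_swap (f j),
      M.bracket_swap (C (f j))]
    simp
  simp only [h1]
  rw [Finset.sum_congr rfl fun i _ => Finset.sum_comm]
  simp only [h2]
  rw [Finset.sum_comm, Finset.mul_sum]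
  refine Finset.sum_congr rfl fun j _ => ?_
  rw [(h.sums he hf).2.2 _ (hf.mem j), M.Q_comm]

theorem sum_bracket_map₁₁ (h : M.IsWeightSplitting p₁ p₂ s) (he : M.IsOrthonormalBasisOf e p₁)
    (hf : M.IsOrthonormalBasisOf f p₂) (C : Module.End ℝ M.tangent) :
    ∑ i, ∑ k, M.Q (M.bracket (e i) (e k)) (M.bracket (e i) (C (e k))) =
      coeff₁ p₁ p₂ * ∑ i, M.Q (C (e i)) (e i) := by
  rw [Finset.sum_comm, Finset.mul_sum]
  refine Finset.sum_congr rfl fun k _ => ?_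
  rw [(h.sums he hf).2.1 _ (he.mem k), M.Q_comm]

theorem sum_bracket_map₁₁' (h : M.IsWeightSplitting p₁ p₂ s) (he : M.IsOrthonormalBasisOf e p₁)
    (hf : M.IsOrthonormalBasisOf f p₂) (C : Module.End ℝ M.tangent) :
    ∑ i, ∑ k, M.Q (M.bracket (e i) (e k)) (M.bracket (C (e i)) (e k)) =
      coeff₁ p₁ p₂ * ∑ i, M.Q (C (e i)) (e i) := by
  rw [← h.sum_bracket_map₁₁ he hf C, Finset.sum_comm]
  refine Finset.sum_congr rfl fun i _ => Finset.sum_congr rfl fun k _ => ?_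
  rw [M.bracket_swap (e k), M.bracket_swap (C (e k))]
  simp

theorem sum_map_bracket₁₂ (h : M.IsWeightSplitting p₁ p₂ s) (he : M.IsOrthonormalBasisOf e p₁)
    (hf : M.IsOrthonormalBasisOf f p₂) (C : Module.End ℝ M.tangent) :
    ∑ i, ∑ j, M.Q (M.bracket (e i) (f j)) (C (M.bracket (e i) (f j))) =
      coeff₁ p₁ p₂ * ∑ i, M.Q (C (e i)) (e i) := by
  have h1 : ∀ i j, M.Q (M.bracket (e i) (f j)) (C (M.bracket (e i) (f j))) =
      ∑ k, M.Q (M.bracket (f j) (e k)) (e i) * M.Q (M.bracket (f j) (C (e k))) (e i) :=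
        fun i j => by
    rw [he.Q_map_eq_sum (h.bracket_mem₁₂ (he.mem i) (hf.mem j))]
    refine Finset.sum_congr rfl fun k _ => ?_
    rw [Q_cyc (e i), Q_cyc (e i)]
  have h2 : ∀ j k, ∑ i, M.Q (M.bracket (f j) (e k)) (e i) * M.Q (M.bracket (f j) (C (e k))) (e i) =
      M.Q (M.bracket (f j) (e k)) (M.bracket (f j) (C (e k))) := fun j k =>
    (he.parseval (h.bracket_mem₂₁ (he.mem k) (hf.mem j)) _).symm
  simp only [h1]
  rw [Finset.sum_comm, Finset.sum_congr rfl fun i _ => Finset.sum_comm]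
  simp only [h2]
  rw [Finset.sum_comm, Finset.mul_sum]
  refine Finset.sum_congr rfl fun j _ => ?_
  rw [(h.sums he hf).1 _ (he.mem j), M.Q_comm]

theorem sum_bracket_map₁₂ (h : M.IsWeightSplitting p₁ p₂ s) (he : M.IsOrthonormalBasisOf e p₁)
    (hf : M.IsOrthonormalBasisOf f p₂) (C : Module.End ℝ M.tangent) :
    ∑ i, ∑ j, M.Q (M.bracket (e i) (f j)) (M.bracket (e i) (C (f j))) =
      coeff₂ p₁ p₂ * ∑ j, M.Q (C (f j)) (f j) := by
  rw [Finset.sum_comm, Finset.mul_sum]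
  refine Finset.sum_congr rfl fun k _ => ?_
  rw [(h.sums he hf).2.2 _ (hf.mem k), M.Q_comm]

theorem sum_bracket_map₁₂' (h : M.IsWeightSplitting p₁ p₂ s) (he : M.IsOrthonormalBasisOf e p₁)
    (hf : M.IsOrthonormalBasisOf f p₂) (C : Module.End ℝ M.tangent) :
    ∑ i, ∑ j, M.Q (M.bracket (e i) (f j)) (M.bracket (C (e i)) (f j)) =
      coeff₁ p₁ p₂ * ∑ i, M.Q (C (e i)) (e i) := by
  rw [Finset.mul_sum]
  refine Finset.sum_congr rfl fun i _ => ?_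
  rw [M.Q_comm (C (e i)), ← (h.sums he hf).1 _ (he.mem i)]
  refine Finset.sum_congr rfl fun j _ => ?_
  rw [M.bracket_swap (e i), M.bracket_swap (C (e i))]
  simp

/-- For diagonal `A`, `θ(A)` multiplies the block `p₁ × p₁ → p₂` of the bracket by `v₂ - 2v₁` and
the block `p₁ × p₂ → p₁` by `-v₂`; the latter counts twice by skew-symmetry. -/
theorem innerBracket_theta (h : M.IsWeightSplitting p₁ p₂ s) (hg : M.IsDiag p₁ p₂ g x₁ x₂)
    (h₁ : 0 < x₁) (h₂ : 0 < x₂) (he : M.IsOrthonormalBasisOf e p₁)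
    (hf : M.IsOrthonormalBasisOf f p₂) {A : Module.End ℝ M.tangent} {v₁ v₂ : ℝ}
    (hA : M.IsDiagEnd p₁ p₂ A v₁ v₂) (C : Module.End ℝ M.tangent) :
    M.innerBracket g (M.theta A M.bracket) (M.theta C M.bracket) =
      (v₂ - 2 * v₁) * (x₂ / x₁ ^ 2) * (coeff₂ p₁ p₂ * ∑ j, M.Q (C (f j)) (f j) -
        2 * (coeff₁ p₁ p₂ * ∑ i, M.Q (C (e i)) (e i))) +
      2 * v₂ / x₂ * (coeff₂ p₁ p₂ * ∑ j, M.Q (C (f j)) (f j)) := by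
  have t₁₁ : ∀ i k, g (M.theta A M.bracket (e i) (e k)) (M.theta C M.bracket (e i) (e k)) =
      (v₂ - 2 * v₁) * x₂ * (M.Q (M.bracket (e i) (e k)) (C (M.bracket (e i) (e k))) -
        M.Q (M.bracket (e i) (e k)) (M.bracket (C (e i)) (e k)) -
        M.Q (M.bracket (e i) (e k)) (M.bracket (e i) (C (e k)))) := fun i k => by
    have hb := h.bracket_mem₁₁ (he.mem i) (he.mem k)
    have : M.theta A M.bracket (e i) (e k) = (v₂ - 2 * v₁) • M.bracket (e i) (e k) := by
      rw [theta_apply, hA.1 _ (he.mem i), hA.1 _ (he.mem k), hA.2 _ hb]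
      simp only [map_smul, LinearMap.smul_apply]
      module
    rw [this, map_smul, LinearMap.smul_apply, hg.2 _ hb, theta_apply, map_sub, map_sub,
      smul_eq_mul]
    ring
  have t₁₂ : ∀ i j, g (M.theta A M.bracket (e i) (f j)) (M.theta C M.bracket (e i) (f j)) =
      -v₂ * x₁ * (M.Q (M.bracket (e i) (f j)) (C (M.bracket (e i) (f j))) -
        M.Q (M.bracket (e i) (f j)) (M.bracket (C (e i)) (f j)) -
        M.Q (M.bracket (e i) (f j)) (M.bracket (e i) (C (f j)))) := fun i j => by
    have hb := h.bracket_mem₁₂ (he.mem i) (hf.mem j)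
    have : M.theta A M.bracket (e i) (f j) = (-v₂) • M.bracket (e i) (f j) := by
      rw [theta_apply, hA.1 _ (he.mem i), hA.2 _ (hf.mem j), hA.1 _ hb]
      simp only [map_smul, LinearMap.smul_apply]
      module
    rw [this, map_smul, LinearMap.smul_apply, hg.1 _ hb, theta_apply, map_sub, map_sub,
      smul_eq_mul]
    ring
  have t₂₁ : ∀ j i, g (M.theta A M.bracket (f j) (e i)) (M.theta C M.bracket (f j) (e i)) =
      g (M.theta A M.bracket (e i) (f j)) (M.theta C M.bracket (e i) (f j)) := fun j i => by
    rw [theta_bracket_swap A (f j), theta_bracket_swap C (f j)]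
    simp
  have t₂₂ : ∀ j k, g (M.theta A M.bracket (f j) (f k)) (M.theta C M.bracket (f j) (f k)) = 0 :=
      fun j k => by
    have : M.theta A M.bracket (f j) (f k) = 0 := by
      rw [theta_apply, hA.2 _ (hf.mem j), hA.2 _ (hf.mem k)]
      simp [h.bracket₂₂ (hf.mem j) (hf.mem k)]
    rw [this, map_zero, LinearMap.zero_apply]
  have hc : ∑ j, ∑ i, g (M.theta A M.bracket (e i) (f j)) (M.theta C M.bracket (e i) (f j)) =
      ∑ i, ∑ j, g (M.theta A M.bracket (e i) (f j)) (M.theta C M.bracket (e i) (f j)) :=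
    Finset.sum_comm
  rw [h.innerBracket_eq_sum hg h₁ h₂ he hf]
  simp only [t₂₁, t₂₂, Finset.sum_const_zero, mul_zero, add_zero, Finset.sum_add_distrib,
    ← Finset.mul_sum]
  rw [hc]
  simp only [t₁₁, t₁₂, Finset.sum_sub_distrib, ← Finset.mul_sum, h.sum_map_bracket₁₁ he hf,
    h.sum_bracket_map₁₁ he hf, h.sum_bracket_map₁₁' he hf, h.sum_map_bracket₁₂ he hf,
    h.sum_bracket_map₁₂ he hf, h.sum_bracket_map₁₂' he hf]
  field_simp
  ring

theorem momentMap_isDiagEnd (h : M.IsWeightSplitting p₁ p₂ s) (hg : M.IsDiag p₁ p₂ g x₁ x₂)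
    (h₁ : 0 < x₁) (h₂ : 0 < x₂) :
    M.IsDiagEnd p₁ p₂ (M.momentMap g) (-(coeff₁ p₁ p₂ * x₂ / (2 * x₁ ^ 2)))
      (coeff₂ p₁ p₂ * (x₂ / (4 * x₁ ^ 2) - 1 / (2 * x₂))) := by
  obtain ⟨e, he⟩ := M.exists_isOrthonormalBasisOf p₁
  obtain ⟨f, hf⟩ := M.exists_isOrthonormalBasisOf p₂
  -- As `θ(-1)μ = -μ + μ + μ = μ`, pairing `θ(C)μ` with `μ` itself is the diagonal case `A = -1`.
  have hneg : M.IsDiagEnd p₁ p₂ (-1 : Module.End ℝ M.tangent) (-1) (-1) :=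
    ⟨fun X _ => by simp, fun X _ => by simp⟩
  have hth : M.theta (-1) M.bracket = M.bracket := by
    ext X Y
    rw [theta_apply]
    simp
  have key : ∀ C : Module.End ℝ M.tangent, M.innerBracket g (M.theta C M.bracket) M.bracket =
      (x₂ / x₁ ^ 2) * (coeff₂ p₁ p₂ * ∑ j, M.Q (C (f j)) (f j) -
        2 * (coeff₁ p₁ p₂ * ∑ i, M.Q (C (e i)) (e i))) -
      2 / x₂ * (coeff₂ p₁ p₂ * ∑ j, M.Q (C (f j)) (f j)) := fun C => by
    rw [h.innerBracket_comm hg h₁ h₂]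
    have := h.innerBracket_theta hg h₁ h₂ he hf hneg C
    rw [hth] at this
    rw [this]; ring
  constructor
  · intro X hX
    refine h.toEnd_eq hg h₁ h₂ fun Z => ?_
    have t₁ : ∑ i, M.Q ((g X).smulRight Z (e i)) (e i) = x₁ * M.Q X Z := by
      simp only [LinearMap.smulRight_apply, hg.1 X hX, map_smul, LinearMap.smul_apply, smul_eq_mul]
      rw [he.parseval hX Z, Finset.mul_sum]
      exact Finset.sum_congr rfl fun i _ => by ring
    have t₂ : ∑ j, M.Q ((g X).smulRight Z (f j)) (f j) = 0 := by
      simp [hg.1 X hX, h.Q_eq_zero hX (hf.mem _)]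
    rw [LinearMap.mk₂_apply, key, t₁, t₂, map_smul, LinearMap.smul_apply, hg.1 X hX, smul_eq_mul]
    field_simp
    ring
  · intro X hX
    refine h.toEnd_eq hg h₁ h₂ fun Z => ?_
    have t₁ : ∑ j, M.Q ((g X).smulRight Z (f j)) (f j) = x₂ * M.Q X Z := by
      simp only [LinearMap.smulRight_apply, hg.2 X hX, map_smul, LinearMap.smul_apply, smul_eq_mul]
      rw [hf.parseval hX Z, Finset.mul_sum]
      exact Finset.sum_congr rfl fun i _ => by ring
    have t₂ : ∑ i, M.Q ((g X).smulRight Z (e i)) (e i) = 0 := by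
      simp [hg.2 X hX, h.Q_eq_zero' (he.mem _) hX]
    rw [LinearMap.mk₂_apply, key, t₁, t₂, map_smul, LinearMap.smul_apply, hg.2 X hX, smul_eq_mul]
    field_simp
    ring

theorem trace_diagEnd_mul (h : M.IsWeightSplitting p₁ p₂ s) (he : M.IsOrthonormalBasisOf e p₁)
    (hf : M.IsOrthonormalBasisOf f p₂) {A : Module.End ℝ M.tangent} {v₁ v₂ : ℝ}
    (hA : M.IsDiagEnd p₁ p₂ A v₁ v₂) (C : Module.End ℝ M.tangent) :
    LinearMap.trace ℝ M.tangent (A * C) = v₁ * ∑ i, M.Q (C (e i)) (e i) +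
      v₂ * ∑ j, M.Q (C (f j)) (f j) := by
  rw [h.trace_eq he hf, Finset.mul_sum, Finset.mul_sum]
  simp only [Module.End.mul_apply, h.Q_diagEnd₁ hA (he.mem _), h.Q_diagEnd₂ hA (hf.mem _)]

/-- The terms in `1 / x₂` from the moment map and from `θ` cancel. Only `v₁ - v₂` survives, so
homotheties lie in the kernel. -/
theorem lichnerowiczForm_eq (h : M.IsWeightSplitting p₁ p₂ s) (hg : M.IsDiag p₁ p₂ g x₁ x₂)
    (h₁ : 0 < x₁) (h₂ : 0 < x₂) (he : M.IsOrthonormalBasisOf e p₁)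
    (hf : M.IsOrthonormalBasisOf f p₂) {A : Module.End ℝ M.tangent} {v₁ v₂ : ℝ}
    (hA : M.IsDiagEnd p₁ p₂ A v₁ v₂) (C : Module.End ℝ M.tangent) :
    M.lichnerowiczForm g A C = x₂ / x₁ ^ 2 * (v₁ - v₂) *
      (coeff₁ p₁ p₂ * ∑ i, M.Q (C (e i)) (e i) - coeff₂ p₁ p₂ * ∑ j, M.Q (C (f j)) (f j)) := by
  have hm := h.momentMap_isDiagEnd hg h₁ h₂
  have hmA : M.IsDiagEnd p₁ p₂ (M.momentMap g * A)
      (v₁ * -(coeff₁ p₁ p₂ * x₂ / (2 * x₁ ^ 2)))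
      (v₂ * (coeff₂ p₁ p₂ * (x₂ / (4 * x₁ ^ 2) - 1 / (2 * x₂)))) :=
    ⟨fun X hX => by rw [Module.End.mul_apply, hA.1 X hX, map_smul, hm.1 X hX, smul_smul],
      fun X hX => by rw [Module.End.mul_apply, hA.2 X hX, map_smul, hm.2 X hX, smul_smul]⟩
  rw [lichnerowiczForm, h.innerBracket_theta hg h₁ h₂ he hf hA, h.trace_diagEnd_mul he hf hmA]
  field_simp
  ring

end Sums

theorem Q_leviCivita_self₁ (h : M.IsWeightSplitting p₁ p₂ s) (hg : M.IsDiag p₁ p₂ g x₁ x₂)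
    (h₁ : 0 < x₁) (h₂ : 0 < x₂) {v : M.tangent} (hv : v ∈ p₁) (W : M.tangent) :
    M.Q (M.leviCivita g v W) v = 0 := by
  obtain ⟨X, hX, Y, hY, rfl⟩ := h.exists_add W
  rw [map_add, h.leviCivita₁₁ hg h₁ h₂ hv hX, h.leviCivita₁₂ hg h₁ h₂ hv hY]
  simp [Q_bracket_self]

theorem Q_leviCivita_self₂ (h : M.IsWeightSplitting p₁ p₂ s) (hg : M.IsDiag p₁ p₂ g x₁ x₂)
    (h₁ : 0 < x₁) (h₂ : 0 < x₂) {v : M.tangent} (hv : v ∈ p₂) (W : M.tangent) :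
    M.Q (M.leviCivita g v W) v = 0 := by
  obtain ⟨X, hX, Y, hY, rfl⟩ := h.exists_add W
  rw [map_add, h.leviCivita₂₁ hg h₁ h₂ hX hv, h.leviCivita₂₂ hg h₁ h₂ hv hY]
  simp [Q_bracket_self]

/-- In an adapted basis `Λ(v)W` has no component along `v`, and a diagonal endomorphism does not
change this. -/
theorem divergence_eq_zero (h : M.IsWeightSplitting p₁ p₂ s) (hg : M.IsDiag p₁ p₂ g x₁ x₂)
    (h₁ : 0 < x₁) (h₂ : 0 < x₂) {T : LinearMap.BilinForm ℝ M.tangent} {y₁ y₂ : ℝ}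
    (hT : M.IsDiag p₁ p₂ T y₁ y₂) (X : M.tangent) : M.divergence g T X = 0 := by
  obtain ⟨e, he⟩ := M.exists_isOrthonormalBasisOf p₁
  obtain ⟨f, hf⟩ := M.exists_isOrthonormalBasisOf p₂
  have hA := h.toEnd_isDiagEnd hg h₁ h₂ hT
  rw [divergence, h.trace_eq he hf]
  simp [h.Q_diagEnd₁ hA (he.mem _), h.Q_diagEnd₂ hA (hf.mem _),
    h.Q_leviCivita_self₁ hg h₁ h₂ (he.mem _), h.Q_leviCivita_self₂ hg h₁ h₂ (hf.mem _)]

theorem isTT_iff (h : M.IsWeightSplitting p₁ p₂ s) (hg : M.IsDiag p₁ p₂ g x₁ x₂)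
    (h₁ : 0 < x₁) (h₂ : 0 < x₂) {T : LinearMap.BilinForm ℝ M.tangent} :
    M.IsTT g T ↔ ∃ v₁ v₂, M.IsDiag p₁ p₂ T (v₁ * x₁) (v₂ * x₂) ∧
      Module.finrank ℝ p₁ * v₁ + Module.finrank ℝ p₂ * v₂ = 0 := by
  constructor
  · rintro ⟨hi, htr, -⟩
    obtain ⟨y₁, y₂, hT⟩ := h.exists_isDiag hi
    refine ⟨y₁ / x₁, y₂ / x₂, ?_, ?_⟩
    · rwa [div_mul_cancel₀ _ h₁.ne', div_mul_cancel₀ _ h₂.ne']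
    · rw [← htr, h.metricTrace_diag hg h₁ h₂ hT]
  · rintro ⟨v₁, v₂, hT, hv⟩
    refine ⟨h.isDiag_invariant hT, ?_, h.divergence_eq_zero hg h₁ h₂ hT⟩
    rw [h.metricTrace_diag hg h₁ h₂ hT, mul_div_cancel_right₀ _ h₁.ne',
      mul_div_cancel_right₀ _ h₂.ne', hv]

theorem exists_isTT (h : M.IsWeightSplitting p₁ p₂ s) (hg : M.IsDiag p₁ p₂ g x₁ x₂)
    (h₁ : 0 < x₁) (h₂ : 0 < x₂) : ∃ T, M.IsTT g T ∧ T ≠ 0 := by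
  have hT := h.diagMetric_isDiag h.compl (Module.finrank ℝ p₂ * x₁) (-Module.finrank ℝ p₁ * x₂)
  refine ⟨_, (h.isTT_iff hg h₁ h₂).2 ⟨_, _, hT, by ring⟩, fun h0 => ?_⟩
  rw [h0] at hT
  have h3 : M.IsDiag p₁ p₂ 0 0 0 := ⟨fun _ _ _ => by simp, fun _ _ _ => by simp⟩
  have := (h.isDiag_inj hT h3).1
  have hd₂ := h.finrank_pos₂
  exact (mul_pos hd₂ h₁).ne' this

theorem lichnerowiczSpectrum_eq (h : M.IsWeightSplitting p₁ p₂ s)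
    (hg : M.IsDiag p₁ p₂ g x₁ x₂) (h₁ : 0 < x₁) (h₂ : 0 < x₂) :
    M.lichnerowiczSpectrum g = {((Module.finrank ℝ p₁ : ℝ) + Module.finrank ℝ p₂) * x₂ /
      ((Module.finrank ℝ p₁ + 4 * Module.finrank ℝ p₂) * x₁ ^ 2)} := by
  obtain ⟨e, he⟩ := M.exists_isOrthonormalBasisOf p₁
  obtain ⟨f, hf⟩ := M.exists_isOrthonormalBasisOf p₂
  have hd₁ := h.finrank_pos₁
  have hd₂ := h.finrank_pos₂
  have key : ∀ T, M.IsTT g T → ∀ C, M.lichnerowiczForm g (M.toEnd g T) C =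
      ((Module.finrank ℝ p₁ : ℝ) + Module.finrank ℝ p₂) * x₂ /
      ((Module.finrank ℝ p₁ + 4 * Module.finrank ℝ p₂) * x₁ ^ 2) *
        LinearMap.trace ℝ M.tangent (M.toEnd g T * C) := by
    intro T hT C
    obtain ⟨v₁, v₂, hT, hv⟩ := (h.isTT_iff hg h₁ h₂).1 hT
    have hA := h.toEnd_isDiagEnd hg h₁ h₂ hT
    rw [mul_div_cancel_right₀ _ h₁.ne', mul_div_cancel_right₀ _ h₂.ne'] at hA
    rw [h.lichnerowiczForm_eq hg h₁ h₂ he hf hA, h.trace_diagEnd_mul he hf hA, coeff₁, coeff₂]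
    -- The trace condition leaves one free parameter, and on this line the form is a multiple of `tr
    -- (A C)`.
    have hv2 : v₂ = -(Module.finrank ℝ p₁ * v₁ / Module.finrank ℝ p₂) := by
      field_simp; linarith
    rw [hv2]
    field_simp
    ring
  ext l
  rw [Set.mem_singleton_iff]
  constructor
  · rintro ⟨T, hT, hT0, hl⟩
    obtain ⟨v₁, v₂, hTd, hv⟩ := (h.isTT_iff hg h₁ h₂).1 hT
    have hA := h.toEnd_isDiagEnd hg h₁ h₂ hTd
    rw [mul_div_cancel_right₀ _ h₁.ne', mul_div_cancel_right₀ _ h₂.ne'] at hA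
    have hnd := h.isDiag_nondegenerate hg h₁ h₂
    -- Testing with `C = A` determines the eigenvalue, because `tr (A²) > 0` for `A ≠ 0`.
    have h3 := hl (M.toEnd g T) fun X Y => by
      rw [M.toEnd_spec hnd, h.isDiag_comm hg, M.toEnd_spec hnd, hT.1.1]
    rw [key T hT] at h3
    refine mul_right_cancel₀ ?_ h3.symm
    rw [h.trace_diagEnd_mul he hf hA]
    simp only [h.Q_diagEnd₁ hA (he.mem _), h.Q_diagEnd₂ hA (hf.mem _), he.1, hf.1]
    simp only [if_true, mul_one, Finset.sum_const, Finset.card_univ, Fintype.card_fin,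
      nsmul_eq_mul]
    have hne : v₁ ≠ 0 ∨ v₂ ≠ 0 := by
      by_contra! hc
      apply hT0
      rw [hc.1, hc.2, zero_mul, zero_mul] at hTd
      exact h.isDiag_ext hTd ⟨fun _ _ _ => by simp, fun _ _ _ => by simp⟩
    have e1 : v₁ * (Module.finrank ℝ p₁ * v₁) + v₂ * (Module.finrank ℝ p₂ * v₂) =
      Module.finrank ℝ p₁ * v₁ ^ 2 + Module.finrank ℝ p₂ * v₂ ^ 2 := by ring
    rw [e1]
    rcases hne with hne | hne <;> positivity
  · rintro rfl
    obtain ⟨T, hT, hT0⟩ := h.exists_isTT hg h₁ h₂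
    exact ⟨T, hT, hT0, fun C _ => key T hT C⟩

theorem lambdaMin_eq (h : M.IsWeightSplitting p₁ p₂ s)
    (hg : M.IsDiag p₁ p₂ g x₁ x₂) (h₁ : 0 < x₁) (h₂ : 0 < x₂) :
    M.lambdaMin g = ((Module.finrank ℝ p₁ : ℝ) + Module.finrank ℝ p₂) * x₂ /
      ((Module.finrank ℝ p₁ + 4 * Module.finrank ℝ p₂) * x₁ ^ 2) := by
  rw [lambdaMin, h.lichnerowiczSpectrum_eq hg h₁ h₂, csInf_singleton]

end Metric

end IsWeightSplitting

end

/-! ### Scalar curvature at fixed volume and its second variation. -/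

section

variable {L : Type*} [LieRing L] [LieAlgebra ℝ L] [FiniteDimensional ℝ L] {M : FlagManifold L}
  {p₁ p₂ : Submodule ℝ M.tangent} {s : L}

/-- The scalar curvature along a curve `(x₁ e^{d₂ r}, x₂ e^{-d₁ r})` of metrics of equal volume. -/
def scalProfile (A B C d₁ d₂ r : ℝ) : ℝ :=
  A * Real.exp (-d₂ * r) + B * Real.exp (d₁ * r) - C * Real.exp (-(d₁ + 2 * d₂) * r)

theorem hasDerivAt_scalProfile (A B C d₁ d₂ r : ℝ) :
    HasDerivAt (scalProfile A B C d₁ d₂)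
      (scalProfile (-d₂ * A) (d₁ * B) (-(d₁ + 2 * d₂) * C) d₁ d₂ r) r := by
  have he : ∀ c : ℝ, HasDerivAt (fun r : ℝ => Real.exp (c * r)) (Real.exp (c * r) * c) r :=
    fun c => by simpa using ((hasDerivAt_id r).const_mul c).exp
  have := (((he (-d₂)).const_mul A).add ((he d₁).const_mul B)).sub
    ((he (-(d₁ + 2 * d₂))).const_mul C)
  refine HasDerivAt.congr_deriv this ?_
  simp only [scalProfile]
  ring

theorem deriv_scalProfile (A B C d₁ d₂ : ℝ) : deriv (scalProfile A B C d₁ d₂) =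
    scalProfile (-d₂ * A) (d₁ * B) (-(d₁ + 2 * d₂) * C) d₁ d₂ :=
  funext fun r => (hasDerivAt_scalProfile A B C d₁ d₂ r).deriv

theorem scalProfile_zero (A B C d₁ d₂ : ℝ) : scalProfile A B C d₁ d₂ 0 = A + B - C := by
  simp [scalProfile]

/-- The second derivative of `h ∘ r` at a critical point `r 0 = 0` of `h`. -/
theorem iteratedDeriv_scalProfile_log (A B C d₁ d₂ v₁ v₂ n : ℝ)
    (h0 : -d₂ * A + d₁ * B + (d₁ + 2 * d₂) * C = 0) :
    iteratedDeriv 2 (fun s : ℝ => scalProfile A B C d₁ d₂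
      ((Real.log (1 + s * v₁) - Real.log (1 + s * v₂)) / n)) 0 =
    (d₂ ^ 2 * A + d₁ ^ 2 * B - (d₁ + 2 * d₂) ^ 2 * C) * ((v₁ - v₂) / n) ^ 2 := by
  have hpos : ∀ v : ℝ, ∀ᶠ s : ℝ in nhds 0, 0 < 1 + s * v := fun v => by
    have hc : ContinuousAt (fun s : ℝ => 1 + s * v) 0 := by fun_prop
    exact hc.eventually (lt_mem_nhds (by simp))
  have hlog : ∀ v s : ℝ, 0 < 1 + s * v →
      HasDerivAt (fun s : ℝ => Real.log (1 + s * v)) (v / (1 + s * v)) s := fun v s h => by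
    have h1 : HasDerivAt (fun s : ℝ => 1 + s * v) v s := by
      simpa using ((hasDerivAt_id s).mul_const v).const_add 1
    exact h1.log h.ne'
  let r : ℝ → ℝ := fun s => (Real.log (1 + s * v₁) - Real.log (1 + s * v₂)) / n
  let r' : ℝ → ℝ := fun s => (v₁ / (1 + s * v₁) - v₂ / (1 + s * v₂)) / n
  have hr : ∀ᶠ s : ℝ in nhds 0, HasDerivAt r (r' s) s := by
    filter_upwards [hpos v₁, hpos v₂] with s h1 h2
    exact ((hlog v₁ s h1).sub (hlog v₂ s h2)).div_const n
  have hr0 : r 0 = 0 := by simp [r]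
  have hd : deriv (fun s : ℝ => scalProfile A B C d₁ d₂ (r s)) =ᶠ[nhds 0] fun s =>
      scalProfile (-d₂ * A) (d₁ * B) (-(d₁ + 2 * d₂) * C) d₁ d₂ (r s) * r' s := by
    filter_upwards [hr] with s hs
    exact ((hasDerivAt_scalProfile A B C d₁ d₂ (r s)).comp s hs).deriv
  have hr' : DifferentiableAt ℝ r' 0 := by
    have h1 : ∀ v : ℝ, DifferentiableAt ℝ (fun s : ℝ => v / (1 + s * v)) 0 := fun v =>
      (differentiableAt_const v).div (by fun_prop) (by simp)
    exact ((h1 v₁).sub (h1 v₂)).div_const n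
  rw [iteratedDeriv_succ, iteratedDeriv_one]
  change deriv (deriv fun s : ℝ => scalProfile A B C d₁ d₂ (r s)) 0 = _
  rw [hd.deriv_eq]
  have h1 := ((hasDerivAt_scalProfile (-d₂ * A) (d₁ * B) (-(d₁ + 2 * d₂) * C) d₁ d₂
    (r 0)).comp 0 hr.self_of_nhds).mul hr'.hasDerivAt
  have h2 := h1.deriv
  simp only [Function.comp_apply, hr0, scalProfile_zero] at h2
  -- At a critical point the term with the second derivative of the reparametrization drops out, so
  -- only the square of its velocity remains.
  have h3 : -d₂ * A + d₁ * B - -(d₁ + 2 * d₂) * C = 0 := by linarith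
  rw [h3, zero_mul, add_zero] at h2
  refine h2.trans ?_
  simp only [r', zero_mul, add_zero, div_one]
  ring

theorem isLocalMax_scalProfile {A B C d₁ d₂ : ℝ}
    (h0 : -d₂ * A + d₁ * B + (d₁ + 2 * d₂) * C = 0)
    (h1 : d₂ ^ 2 * A + d₁ ^ 2 * B - (d₁ + 2 * d₂) ^ 2 * C < 0) :
    IsLocalMax (scalProfile A B C d₁ d₂) 0 := by
  refine isLocalMax_of_deriv_deriv_neg ?_ ?_
    (hasDerivAt_scalProfile A B C d₁ d₂ 0).continuousAt
  · rw [deriv_scalProfile, deriv_scalProfile, scalProfile_zero]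
    linarith
  · rw [deriv_scalProfile, scalProfile_zero]
    linarith

theorem isLocalMin_scalProfile {A B C d₁ d₂ : ℝ}
    (h0 : -d₂ * A + d₁ * B + (d₁ + 2 * d₂) * C = 0)
    (h1 : 0 < d₂ ^ 2 * A + d₁ ^ 2 * B - (d₁ + 2 * d₂) ^ 2 * C) :
    IsLocalMin (scalProfile A B C d₁ d₂) 0 := by
  refine isLocalMin_of_deriv_deriv_pos ?_ ?_
    (hasDerivAt_scalProfile A B C d₁ d₂ 0).continuousAt
  · rw [deriv_scalProfile, deriv_scalProfile, scalProfile_zero]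
    linarith
  · rw [deriv_scalProfile, scalProfile_zero]
    linarith

namespace IsWeightSplitting

/-- The scalar curvature profile through the metric `(x₁, x₂)`. -/
def profile (p₁ p₂ : Submodule ℝ M.tangent) (x₁ x₂ : ℝ) : ℝ → ℝ :=
  scalProfile (Module.finrank ℝ p₁ / (2 * x₁))
    ((Module.finrank ℝ p₂ - Module.finrank ℝ p₁ * coeff₁ p₁ p₂) / (2 * x₂))
    (Module.finrank ℝ p₁ * coeff₁ p₁ p₂ * x₂ / (4 * x₁ ^ 2))
    (Module.finrank ℝ p₁) (Module.finrank ℝ p₂)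

/-- The first derivative of the profile at `0`. -/
def profileDeriv (p₁ p₂ : Submodule ℝ M.tangent) (x₁ x₂ : ℝ) : ℝ :=
  -(Module.finrank ℝ p₂ : ℝ) * (Module.finrank ℝ p₁ / (2 * x₁)) + Module.finrank ℝ p₁ *
    ((Module.finrank ℝ p₂ - Module.finrank ℝ p₁ * coeff₁ p₁ p₂) / (2 * x₂)) +
    (Module.finrank ℝ p₁ + 2 * Module.finrank ℝ p₂) *
    (Module.finrank ℝ p₁ * coeff₁ p₁ p₂ * x₂ / (4 * x₁ ^ 2))

/-- The second derivative of the profile at `0`. -/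
def profileDeriv₂ (p₁ p₂ : Submodule ℝ M.tangent) (x₁ x₂ : ℝ) : ℝ :=
  (Module.finrank ℝ p₂ : ℝ) ^ 2 * (Module.finrank ℝ p₁ / (2 * x₁)) +
    (Module.finrank ℝ p₁ : ℝ) ^ 2 *
    ((Module.finrank ℝ p₂ - Module.finrank ℝ p₁ * coeff₁ p₁ p₂) / (2 * x₂)) -
    (Module.finrank ℝ p₁ + 2 * Module.finrank ℝ p₂ : ℝ) ^ 2 *
    (Module.finrank ℝ p₁ * coeff₁ p₁ p₂ * x₂ / (4 * x₁ ^ 2))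

section Metric

variable {g : LinearMap.BilinForm ℝ M.tangent} {x₁ x₂ : ℝ}

/-- In logarithmic coordinates a diagonal metric is a homothety by `e^κ` of a metric on the
equal-volume curve through `(x₁, x₂)`, and `scal` scales by `e^(-κ)`. -/
theorem scal_exp (h : M.IsWeightSplitting p₁ p₂ s) (h₁ : 0 < x₁) (h₂ : 0 < x₂) (κ r : ℝ)
    (hg : M.IsDiag p₁ p₂ g (x₁ * Real.exp (κ + Module.finrank ℝ p₂ * r))
      (x₂ * Real.exp (κ - Module.finrank ℝ p₁ * r))) :
    M.scal g = Real.exp (-κ) * profile p₁ p₂ x₁ x₂ r := by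
  have hd₁ := h.finrank_pos₁
  have hd₂ := h.finrank_pos₂
  have hc : Module.finrank ℝ p₂ * coeff₂ p₁ p₂ = Module.finrank ℝ p₁ * coeff₁ p₁ p₂ := by
    rw [coeff₁, coeff₂]; ring
  rw [h.scal_eq hg (by positivity) (by positivity), profile, scalProfile]
  generalize coeff₁ p₁ p₂ = α at *
  generalize coeff₂ p₁ p₂ = β at *
  generalize (Module.finrank ℝ p₁ : ℝ) = d₁ at *
  generalize (Module.finrank ℝ p₂ : ℝ) = d₂ at *
  have e1 : Real.exp (κ + d₂ * r) = Real.exp κ * Real.exp (d₂ * r) := Real.exp_add _ _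
  have e2 : Real.exp (κ - d₁ * r) = Real.exp κ / Real.exp (d₁ * r) := Real.exp_sub _ _
  have e3 : Real.exp (-d₂ * r) = (Real.exp (d₂ * r))⁻¹ := by rw [← Real.exp_neg]; ring_nf
  have e4 : Real.exp (-(d₁ + 2 * d₂) * r) = (Real.exp (d₁ * r) * Real.exp (d₂ * r) ^ 2)⁻¹ := by
    rw [sq, ← Real.exp_add, ← Real.exp_add, ← Real.exp_neg]; ring_nf
  rw [e1, e2, e3, e4, Real.exp_neg, ← hc]
  have hβ : α = d₂ * β / d₁ := by rw [hc]; field_simp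
  rw [hβ]
  have := Real.exp_pos κ
  have := Real.exp_pos (d₁ * r)
  have := Real.exp_pos (d₂ * r)
  generalize Real.exp κ = K at *
  generalize Real.exp (d₁ * r) = E at *
  generalize Real.exp (d₂ * r) = F at *
  field_simp
  ring

theorem finrank_add (h : M.IsWeightSplitting p₁ p₂ s) :
    (Module.finrank ℝ M.tangent : ℝ) = Module.finrank ℝ p₁ + Module.finrank ℝ p₂ := by
  exact_mod_cast (Submodule.finrank_add_eq_of_isCompl h.compl).symm

theorem volumeRatioSq_eq (h : M.IsWeightSplitting p₁ p₂ s) (hg : M.IsDiag p₁ p₂ g x₁ x₂)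
    (h₁ : 0 < x₁) (h₂ : 0 < x₂) {g' : LinearMap.BilinForm ℝ M.tangent} {y₁ y₂ : ℝ}
    (hg' : M.IsDiag p₁ p₂ g' y₁ y₂) : M.volumeRatioSq g g' =
      (y₁ / x₁) ^ Module.finrank ℝ p₁ * (y₂ / x₂) ^ Module.finrank ℝ p₂ := by
  obtain ⟨e, he⟩ := M.exists_isOrthonormalBasisOf p₁
  obtain ⟨f, hf⟩ := M.exists_isOrthonormalBasisOf p₂
  have hb := h.sumElim he hf
  have hA := h.toEnd_isDiagEnd hg h₁ h₂ hg'
  have hli : LinearIndependent ℝ (Sum.elim e f) := by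
    rw [Fintype.linearIndependent_iff]
    intro c hc j
    have := congrArg (fun X => M.Q X (Sum.elim e f j)) hc
    simpa only [map_sum, map_smul, LinearMap.sum_apply, LinearMap.smul_apply, hb.1, smul_eq_mul,
      mul_ite, mul_one, mul_zero, Finset.sum_ite_eq', Finset.mem_univ, if_true, map_zero,
      LinearMap.zero_apply] using this
  let b := Module.Basis.mk hli hb.2.ge
  have hm : LinearMap.toMatrix b b (M.toEnd g g') =
      Matrix.diagonal (Sum.elim (fun _ => y₁ / x₁) (fun _ => y₂ / x₂)) := by
    have hbv : ∀ j, M.toEnd g g' (b j) =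
        (Sum.elim (fun _ => y₁ / x₁) (fun _ => y₂ / x₂) j : ℝ) • b j := by
      rintro (j | j)
      · simpa [b] using hA.1 _ (he.mem j)
      · simpa [b] using hA.2 _ (hf.mem j)
    ext i j
    rw [LinearMap.toMatrix_apply, hbv, map_smul, Finsupp.smul_apply, b.repr_self,
      Finsupp.single_apply, Matrix.diagonal_apply]
    by_cases hij : i = j
    · simp [hij]
    · simp [hij, Ne.symm hij]
  rw [volumeRatioSq, ← LinearMap.det_toMatrix b, hm, Matrix.det_diagonal, Fintype.prod_sum_type]
  simp [div_pow]

theorem secondVariation_eq (h : M.IsWeightSplitting p₁ p₂ s) (hg : M.IsDiag p₁ p₂ g x₁ x₂)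
    (h₁ : 0 < x₁) (h₂ : 0 < x₂) (h0 : profileDeriv p₁ p₂ x₁ x₂ = 0)
    {T : LinearMap.BilinForm ℝ M.tangent} {v₁ v₂ : ℝ}
    (hT : M.IsDiag p₁ p₂ T (v₁ * x₁) (v₂ * x₂)) :
    M.secondVariation g T = profileDeriv₂ p₁ p₂ x₁ x₂ *
      ((v₁ - v₂) / (Module.finrank ℝ p₁ + Module.finrank ℝ p₂)) ^ 2 := by
  have hd₁ := h.finrank_pos₁
  have hd₂ := h.finrank_pos₂
  rw [profileDeriv₂, ← iteratedDeriv_scalProfile_log _ _ _ _ _ v₁ v₂ _ h0, secondVariation]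
  refine Filter.EventuallyEq.iteratedDeriv_eq _ ?_
  have hpos : ∀ v : ℝ, ∀ᶠ s : ℝ in nhds 0, 0 < 1 + s * v := fun v => by
    have hc : ContinuousAt (fun s : ℝ => 1 + s * v) 0 := by fun_prop
    exact hc.eventually (lt_mem_nhds (by simp))
  filter_upwards [hpos v₁, hpos v₂] with u hu₁ hu₂
  have hgT : M.IsDiag p₁ p₂ (g + u • T) (x₁ * (1 + u * v₁)) (x₂ * (1 + u * v₂)) := by
    convert hg.add (hT.smul u) using 1 <;> ring
  let l₁ := Real.log (1 + u * v₁)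
  let l₂ := Real.log (1 + u * v₂)
  let n : ℝ := Module.finrank ℝ p₁ + Module.finrank ℝ p₂
  have hn : 0 < n := by positivity
  -- `κ` and `r` solve `l₁ = κ + d₂ r`, `l₂ = κ - d₁ r`. Volume normalization removes `κ`.
  let κ := (Module.finrank ℝ p₁ * l₁ + Module.finrank ℝ p₂ * l₂) / n
  let r := (l₁ - l₂) / n
  have e₁ : 1 + u * v₁ = Real.exp (κ + Module.finrank ℝ p₂ * r) := by
    rw [← Real.exp_log hu₁]
    congr 1
    simp only [κ, r, n, l₁]
    field_simp
    ring
  have e₂ : 1 + u * v₂ = Real.exp (κ - Module.finrank ℝ p₁ * r) := by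
    rw [← Real.exp_log hu₂]
    congr 1
    simp only [κ, r, n, l₂]
    field_simp
    ring
  have hvol : M.volumeRatioSq g (g + u • T) = Real.exp (n * κ) := by
    rw [h.volumeRatioSq_eq hg h₁ h₂ hgT, mul_div_cancel_left₀ _ h₁.ne',
      mul_div_cancel_left₀ _ h₂.ne', e₁, e₂, ← Real.exp_nat_mul, ← Real.exp_nat_mul,
      ← Real.exp_add]
    congr 1
    simp only [n]
    ring
  rw [e₁, e₂] at hgT
  rw [scalNormalized, h.scal_exp h₁ h₂ κ r hgT, hvol, h.finrank_add, ← Real.exp_mul,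
    ← mul_assoc, ← Real.exp_add]
  have e₃ : n * κ * (1 / n) + -κ = 0 := by field_simp; ring
  change Real.exp (n * κ * (1 / n) + -κ) * _ = _
  rw [e₃, Real.exp_zero, one_mul]
  rfl

/-- Invariant metrics of equal volume form a single curve: `y₁` determines `y₂`, and the parameter
is `r = log (y₁ / x₁) / d₂`. A local statement about the profile thus becomes one about all nearby
metrics. -/
theorem exists_scal_nearby (h : M.IsWeightSplitting p₁ p₂ s) (hg : M.IsDiag p₁ p₂ g x₁ x₂)
    (h₁ : 0 < x₁) (h₂ : 0 < x₂) {P : ℝ → Prop}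
    (hP : ∀ᶠ r in nhds 0, P (profile p₁ p₂ x₁ x₂ r)) :
    ∃ ε > 0, ∀ g', M.IsNearby g ε g' → P (M.scal g') := by
  have hd₁ := h.finrank_pos₁
  have hd₂ := h.finrank_pos₂
  have hc : Filter.Tendsto (fun a : ℝ => Real.log a / Module.finrank ℝ p₂) (nhds 1) (nhds 0) := by
    have : ContinuousAt (fun a : ℝ => Real.log a / Module.finrank ℝ p₂) 1 :=
      (Real.continuousAt_log one_ne_zero).div_const _
    simpa [ContinuousAt] using this
  obtain ⟨ε, hε, hball⟩ := Metric.eventually_nhds_iff.1 (hc.eventually hP)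
  -- Halving passes from the non-strict bound in `IsNearby` to an open ball.
  refine ⟨ε / 2, by positivity, fun g' hg' => ?_⟩
  obtain ⟨hm, hvol, hnear⟩ := hg'
  obtain ⟨y₁, y₂, hy₁, hy₂, hd⟩ := h.exists_isDiag_metric hm
  obtain ⟨X, hX, hX0⟩ := Submodule.exists_mem_ne_zero_of_ne_bot h.irr₁.1
  have hQ := M.Q_pos hX0
  have ha : |y₁ / x₁ - 1| ≤ ε / 2 := by
    have h3 := hnear X
    rw [hd.1 X hX, hg.1 X hX, ← sub_mul, abs_mul, abs_of_pos hQ, ← mul_assoc] at h3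
    have h4 := le_of_mul_le_mul_right h3 hQ
    rw [div_sub_one h₁.ne', abs_div, abs_of_pos h₁, div_le_iff₀ h₁]
    exact h4
  have hPr := hball (show dist (y₁ / x₁) 1 < ε by rw [Real.dist_eq]; linarith)
  rw [h.volumeRatioSq_eq hg h₁ h₂ hd] at hvol
  have hlog := congrArg Real.log hvol
  have ha0 : 0 < y₁ / x₁ := by positivity
  have hb0 : 0 < y₂ / x₂ := by positivity
  rw [Real.log_mul (by positivity) (by positivity), Real.log_pow, Real.log_pow, Real.log_one]
    at hlog
  have hscal := h.scal_exp (g := g') h₁ h₂ 0 (Real.log (y₁ / x₁) / Module.finrank ℝ p₂) (by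
    convert hd using 1
    · rw [zero_add, mul_div_cancel₀ _ hd₂.ne', Real.exp_log ha0]
      field_simp
    · have e1 : 0 - Module.finrank ℝ p₁ * (Real.log (y₁ / x₁) / Module.finrank ℝ p₂) =
          Real.log (y₂ / x₂) := by
        field_simp
        linarith
      rw [e1, Real.exp_log hb0]
      field_simp)
  rw [neg_zero, Real.exp_zero, one_mul] at hscal
  rw [hscal]
  exact hPr

theorem scal_self (h : M.IsWeightSplitting p₁ p₂ s) (hg : M.IsDiag p₁ p₂ g x₁ x₂)
    (h₁ : 0 < x₁) (h₂ : 0 < x₂) : M.scal g = profile p₁ p₂ x₁ x₂ 0 := by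
  have := h.scal_exp (g := g) h₁ h₂ 0 0 (by simpa using hg)
  simpa using this

theorem isLocalMaxScal (h : M.IsWeightSplitting p₁ p₂ s) (hg : M.IsDiag p₁ p₂ g x₁ x₂)
    (h₁ : 0 < x₁) (h₂ : 0 < x₂) (h0 : profileDeriv p₁ p₂ x₁ x₂ = 0)
    (h3 : profileDeriv₂ p₁ p₂ x₁ x₂ < 0) : M.IsLocalMaxScal g := by
  rw [IsLocalMaxScal, h.scal_self hg h₁ h₂]
  exact h.exists_scal_nearby hg h₁ h₂ (P := fun c => c ≤ profile p₁ p₂ x₁ x₂ 0)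
    (isLocalMax_scalProfile h0 h3)

theorem isLocalMinScal (h : M.IsWeightSplitting p₁ p₂ s) (hg : M.IsDiag p₁ p₂ g x₁ x₂)
    (h₁ : 0 < x₁) (h₂ : 0 < x₂) (h0 : profileDeriv p₁ p₂ x₁ x₂ = 0)
    (h3 : 0 < profileDeriv₂ p₁ p₂ x₁ x₂) : M.IsLocalMinScal g := by
  rw [IsLocalMinScal, h.scal_self hg h₁ h₂]
  exact h.exists_scal_nearby hg h₁ h₂ (P := fun c => profile p₁ p₂ x₁ x₂ 0 ≤ c)
    (isLocalMin_scalProfile h0 h3)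

theorem sub_ne_zero_of_isTT (h : M.IsWeightSplitting p₁ p₂ s)
    {T : LinearMap.BilinForm ℝ M.tangent} (hT0 : T ≠ 0) {v₁ v₂ : ℝ}
    (hT : M.IsDiag p₁ p₂ T (v₁ * x₁) (v₂ * x₂))
    (hv : Module.finrank ℝ p₁ * v₁ + Module.finrank ℝ p₂ * v₂ = 0) : v₁ - v₂ ≠ 0 := by
  intro he
  have hd₁ := h.finrank_pos₁
  have hd₂ := h.finrank_pos₂
  obtain rfl : v₁ = v₂ := sub_eq_zero.1 he
  have hv0 : v₁ = 0 := by
    rw [← add_mul] at hv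
    exact (mul_eq_zero.1 hv).resolve_left (by positivity)
  rw [hv0, zero_mul, zero_mul] at hT
  exact hT0 (h.isDiag_ext hT ⟨fun _ _ _ => by simp, fun _ _ _ => by simp⟩)

theorem isGStable (h : M.IsWeightSplitting p₁ p₂ s) (hg : M.IsDiag p₁ p₂ g x₁ x₂)
    (h₁ : 0 < x₁) (h₂ : 0 < x₂) (hE : M.IsEinstein g) (h0 : profileDeriv p₁ p₂ x₁ x₂ = 0)
    (h3 : profileDeriv₂ p₁ p₂ x₁ x₂ < 0) : M.IsGStable g := by
  refine ⟨hE, fun T hT hT0 => ?_⟩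
  have hd₁ := h.finrank_pos₁
  have hd₂ := h.finrank_pos₂
  obtain ⟨v₁, v₂, hTd, hv⟩ := (h.isTT_iff hg h₁ h₂).1 hT
  rw [h.secondVariation_eq hg h₁ h₂ h0 hTd]
  refine mul_neg_of_neg_of_pos h3 (sq_pos_of_ne_zero ?_)
  exact div_ne_zero (h.sub_ne_zero_of_isTT hT0 hTd hv) (by positivity)

theorem isGUnstable (h : M.IsWeightSplitting p₁ p₂ s) (hg : M.IsDiag p₁ p₂ g x₁ x₂)
    (h₁ : 0 < x₁) (h₂ : 0 < x₂) (hE : M.IsEinstein g) (h0 : profileDeriv p₁ p₂ x₁ x₂ = 0)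
    (h3 : 0 < profileDeriv₂ p₁ p₂ x₁ x₂) : M.IsGUnstable g := by
  obtain ⟨T, hT, hT0⟩ := h.exists_isTT hg h₁ h₂
  refine ⟨hE, T, hT, ?_⟩
  have hd₁ := h.finrank_pos₁
  have hd₂ := h.finrank_pos₂
  obtain ⟨v₁, v₂, hTd, hv⟩ := (h.isTT_iff hg h₁ h₂).1 hT
  rw [h.secondVariation_eq hg h₁ h₂ h0 hTd]
  refine mul_pos h3 (sq_pos_of_ne_zero ?_)
  exact div_ne_zero (h.sub_ne_zero_of_isTT hT0 hTd hv) (by positivity)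

/-- The second derivative is `-d₁² d₂ (d₁ + d₂) / (2 x₁ (d₁ + 4 d₂))`; at the other Einstein metric
it is exactly the opposite number. -/
theorem profileDeriv_kahler (h : M.IsWeightSplitting p₁ p₂ s) (h₁ : 0 < x₁) :
    profileDeriv p₁ p₂ x₁ (2 * x₁) = 0 ∧ profileDeriv₂ p₁ p₂ x₁ (2 * x₁) < 0 := by
  have hd₁ := h.finrank_pos₁
  have hd₂ := h.finrank_pos₂
  rw [profileDeriv, profileDeriv₂, coeff₁]
  generalize (Module.finrank ℝ p₁ : ℝ) = d₁ at *
  generalize (Module.finrank ℝ p₂ : ℝ) = d₂ at *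
  constructor
  · field_simp
    ring
  · have e : d₂ ^ 2 * (d₁ / (2 * x₁)) + d₁ ^ 2 *
        ((d₂ - d₁ * (d₂ / (d₁ + 4 * d₂))) / (2 * (2 * x₁))) -
        (d₁ + 2 * d₂) ^ 2 * (d₁ * (d₂ / (d₁ + 4 * d₂)) * (2 * x₁) / (4 * x₁ ^ 2)) =
        -(d₁ ^ 2 * d₂ * (d₁ + d₂) / (2 * x₁ * (d₁ + 4 * d₂))) := by
      field_simp
      ring
    rw [e, neg_lt_zero]
    positivity

theorem profileDeriv_nonKahler (h : M.IsWeightSplitting p₁ p₂ s) (h₁ : 0 < x₁) :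
    profileDeriv p₁ p₂ x₁
      (4 * (Module.finrank ℝ p₂ : ℝ) / (Module.finrank ℝ p₁ + 2 * Module.finrank ℝ p₂) * x₁) = 0 ∧
    0 < profileDeriv₂ p₁ p₂ x₁
      (4 * (Module.finrank ℝ p₂ : ℝ) / (Module.finrank ℝ p₁ + 2 * Module.finrank ℝ p₂) * x₁) := by
  have hd₁ := h.finrank_pos₁
  have hd₂ := h.finrank_pos₂
  rw [profileDeriv, profileDeriv₂, coeff₁]
  generalize (Module.finrank ℝ p₁ : ℝ) = d₁ at *
  generalize (Module.finrank ℝ p₂ : ℝ) = d₂ at *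
  constructor
  · field_simp
    ring
  · have e : d₂ ^ 2 * (d₁ / (2 * x₁)) + d₁ ^ 2 *
        ((d₂ - d₁ * (d₂ / (d₁ + 4 * d₂))) / (2 * (4 * d₂ / (d₁ + 2 * d₂) * x₁))) -
        (d₁ + 2 * d₂) ^ 2 * (d₁ * (d₂ / (d₁ + 4 * d₂)) * (4 * d₂ / (d₁ + 2 * d₂) * x₁) /
          (4 * x₁ ^ 2)) =
        d₁ ^ 2 * d₂ * (d₁ + d₂) / (2 * x₁ * (d₁ + 4 * d₂)) := by
      field_simp
      ring
    rw [e]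
    positivity

end Metric

end IsWeightSplitting

end

section

variable {L : Type*} [LieRing L] [LieAlgebra ℝ L] [FiniteDimensional ℝ L] {M : FlagManifold L}
  {p₁ p₂ : Submodule ℝ M.tangent} {s : L}

/-! ### Curvature identities and parallel complex structures -/

theorem curvature_mem_holonomyAlgebra (g : LinearMap.BilinForm ℝ M.tangent) (X Y : M.tangent) :
    M.curvature g X Y ∈ M.holonomyAlgebra g :=
  Submodule.mem_sInf.2 fun _ hS => hS.1 X Y

theorem commutator_mem_holonomyAlgebra (g : LinearMap.BilinForm ℝ M.tangent) (X : M.tangent)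
    {T : Module.End ℝ M.tangent} (hT : T ∈ M.holonomyAlgebra g) :
    M.leviCivita g X * T - T * M.leviCivita g X ∈ M.holonomyAlgebra g :=
  Submodule.mem_sInf.2 fun S hS => hS.2 X T (Submodule.mem_sInf.1 hT S hS)

/-- The first Bianchi identity. -/
theorem curvature_cyclic {g : LinearMap.BilinForm ℝ M.tangent} (hg : M.IsInvariantMetric g)
    (X Y Z : M.tangent) :
    M.curvature g X Y Z + M.curvature g Y Z X + M.curvature g Z X Y = 0 := by
  have ht : ∀ U V, M.leviCivita g U V = M.bracket U V + M.leviCivita g V U := fun U V =>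
    sub_eq_iff_eq_add.1 (M.leviCivita_spec hg U V 0).2
  have e1 : M.leviCivita g X (M.leviCivita g Y Z) =
      M.leviCivita g X (M.bracket Y Z) + M.leviCivita g X (M.leviCivita g Z Y) := by
    rw [ht Y Z, map_add]
  have e2 : M.leviCivita g Y (M.leviCivita g Z X) =
      M.leviCivita g Y (M.bracket Z X) + M.leviCivita g Y (M.leviCivita g X Z) := by
    rw [ht Z X, map_add]
  have e3 : M.leviCivita g Z (M.leviCivita g X Y) =
      M.leviCivita g Z (M.bracket X Y) + M.leviCivita g Z (M.leviCivita g Y X) := by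
    rw [ht X Y, map_add]
  have k : ∀ U V W : M.tangent, M.adProj (⁅(U : L), (V : L)⁆ - M.bracket U V) W =
      M.proj ⁅⁅(U : L), (V : L)⁆, (W : L)⁆ - M.bracket (M.bracket U V) W := fun U V W => by
    rw [adProj_apply, sub_lie, map_sub, M.bracket_apply (M.bracket U V)]
  -- Torsion-freeness cancels the connection terms, and what remains is the Jacobi identity
  -- projected to `𝔭`.
  have hj : M.proj ⁅⁅(X : L), (Y : L)⁆, (Z : L)⁆ + M.proj ⁅⁅(Y : L), (Z : L)⁆, (X : L)⁆ +
      M.proj ⁅⁅(Z : L), (X : L)⁆, (Y : L)⁆ = 0 := by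
    rw [← map_add, ← map_add, ← neg_eq_zero, ← map_neg, neg_add, neg_add, lie_skew, lie_skew,
      lie_skew, add_assoc, add_comm, lie_jacobi, map_zero]
  simp only [IsWeightSplitting.curvature_apply, k, e1, e2, e3]
  rw [ht X (M.bracket Y Z), ht Y (M.bracket Z X), ht Z (M.bracket X Y),
    M.bracket_swap X (M.bracket Y Z), M.bracket_swap Y (M.bracket Z X),
    M.bracket_swap Z (M.bracket X Y)]
  rw [← neg_eq_zero, ← hj]
  abel

/-- For an Einstein metric, `tr (A R(X,Y)) = 2 ρ g(AX, Y)` for skew `A` commuting with the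
curvature operators. -/
theorem trace_mul_curvature {g : LinearMap.BilinForm ℝ M.tangent} (hg : M.IsInvariantMetric g)
    {ρ : ℝ} (hρ : M.IsEinsteinWith g ρ) {A : Module.End ℝ M.tangent}
    (hA : ∀ X Y, g (A X) Y = -g X (A Y))
    (hc : ∀ X Y, A * M.curvature g X Y = M.curvature g X Y * A) (X Y : M.tangent) :
    LinearMap.trace ℝ M.tangent (A * M.curvature g X Y) = 2 * ρ * g (A X) Y := by
  have hsw : ∀ U V, M.curvature g U V = -M.curvature g V U := fun U V => by
    refine LinearMap.ext fun W => ?_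
    rw [LinearMap.neg_apply, IsWeightSplitting.curvature_apply, IsWeightSplitting.curvature_apply,
      M.bracket_swap U V, ← lie_skew (U : L) (V : L)]
    simp only [adProj_apply, map_neg, LinearMap.neg_apply, sub_lie, neg_lie, NegMemClass.coe_neg,
      map_sub]
    abel
  have hcv : ∀ U V W, A (M.curvature g U V W) = M.curvature g U V (A W) := fun U V W =>
    LinearMap.congr_fun (hc U V) W
  -- By Bianchi and commutation, `A R(X,Y)W = R(W,Y)AX - R(W,X)AY`; the traces over `W` of the
  -- right-hand terms are Ricci curvatures.
  have e : A * M.curvature g X Y = ((M.curvature g).flip Y).flip (A X) -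
      ((M.curvature g).flip X).flip (A Y) := by
    refine LinearMap.ext fun W => ?_
    have h1 := curvature_cyclic hg X Y W
    rw [hsw Y W, LinearMap.neg_apply] at h1
    have h2 : M.curvature g X Y W = M.curvature g W Y X - M.curvature g W X Y := by
      rw [← sub_eq_zero, ← h1]; abel
    rw [Module.End.mul_apply, h2, map_sub, hcv, hcv]
    rfl
  have hr : ∀ U V, LinearMap.trace ℝ M.tangent (((M.curvature g).flip U).flip V) = ρ * g U V :=
    fun U V => by rw [← IsWeightSplitting.ricci_apply, hρ]; rfl
  rw [e, map_sub, hr, hr, hg.1.1 Y, ← neg_eq_iff_eq_neg.2 (hA X Y)]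
  ring

theorem skew_of_orthogonal {g : LinearMap.BilinForm ℝ M.tangent} {J : Module.End ℝ M.tangent}
    (hJ : ∀ X, J (J X) = -X) (hJg : ∀ X Y, g (J X) (J Y) = g X Y) (X Y : M.tangent) :
    g (J X) Y = -g X (J Y) := by
  rw [← hJg X, hJ, map_neg, neg_neg]

namespace IsWeightSplitting

variable {g : LinearMap.BilinForm ℝ M.tangent} {x₁ x₂ : ℝ}

/-- For skew `B`, `-tr (B²)` is the squared `g`-norm of `B`. -/
theorem eq_zero_of_trace_sq (h : M.IsWeightSplitting p₁ p₂ s) (hg : M.IsDiag p₁ p₂ g x₁ x₂)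
    (h₁ : 0 < x₁) (h₂ : 0 < x₂) {B : Module.End ℝ M.tangent}
    (hB : ∀ X Y, g (B X) Y = -g X (B Y)) (ht : LinearMap.trace ℝ M.tangent (B * B) = 0) :
    B = 0 := by
  obtain ⟨e, he⟩ := M.exists_isOrthonormalBasisOf p₁
  obtain ⟨f, hf⟩ := M.exists_isOrthonormalBasisOf p₂
  have hm := h.isDiag_metric hg h₁ h₂
  have hp : ∀ V, 0 ≤ g V V := fun V => by
    rcases eq_or_ne V 0 with rfl | hV
    · simp
    · exact (hm.2 V hV).le
  have h0 : ∀ V, g (B V) (B V) = 0 → B V = 0 := fun V hV => by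
    by_contra hne
    exact (hm.2 _ hne).ne' hV
  have k₁ : ∀ i, M.Q ((B * B) (e i)) (e i) = -(x₁⁻¹ * g (B (e i)) (B (e i))) := fun i => by
    rw [← neg_eq_iff_eq_neg.2 (hB _ _), Module.End.mul_apply, h.isDiag_right₁ hg (he.mem i)]
    field_simp
  have k₂ : ∀ i, M.Q ((B * B) (f i)) (f i) = -(x₂⁻¹ * g (B (f i)) (B (f i))) := fun i => by
    rw [← neg_eq_iff_eq_neg.2 (hB _ _), Module.End.mul_apply, h.isDiag_right₂ hg (hf.mem i)]
    field_simp
  rw [h.trace_eq he hf] at ht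
  simp only [k₁, k₂, Finset.sum_neg_distrib] at ht
  have s₁ : 0 ≤ ∑ i, x₁⁻¹ * g (B (e i)) (B (e i)) :=
    Finset.sum_nonneg fun i _ => mul_nonneg (by positivity) (hp _)
  have s₂ : 0 ≤ ∑ i, x₂⁻¹ * g (B (f i)) (B (f i)) :=
    Finset.sum_nonneg fun i _ => mul_nonneg (by positivity) (hp _)
  have hs := (add_eq_zero_iff_of_nonneg s₁ s₂).1 (by linarith)
  have z₁ := (Finset.sum_eq_zero_iff_of_nonneg fun i _ =>
    mul_nonneg (inv_nonneg.2 h₁.le) (hp (B (e i)))).1 hs.1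
  have z₂ := (Finset.sum_eq_zero_iff_of_nonneg fun i _ =>
    mul_nonneg (inv_nonneg.2 h₂.le) (hp (B (f i)))).1 hs.2
  refine LinearMap.ext_on (h.sumElim he hf).2 ?_
  rintro _ ⟨i | j, rfl⟩
  · exact h0 _ ((mul_eq_zero.1 (z₁ i (Finset.mem_univ _))).resolve_left (by positivity))
  · exact h0 _ ((mul_eq_zero.1 (z₂ j (Finset.mem_univ _))).resolve_left (by positivity))

/-- On an Einstein manifold with `ρ ≠ 0`, a complex structure commuting with the holonomy algebra
is invariant. -/
theorem leviCivita_comm_of_holonomy (h : M.IsWeightSplitting p₁ p₂ s)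
    (hg : M.IsDiag p₁ p₂ g x₁ x₂) (h₁ : 0 < x₁) (h₂ : 0 < x₂) {ρ : ℝ} (hE : M.IsEinsteinWith g ρ)
    (hρ : ρ ≠ 0) {J : Module.End ℝ M.tangent} (hJ : ∀ X Y, g (J X) Y = -g X (J Y))
    (hH : ∀ T ∈ M.holonomyAlgebra g, ∀ X, J (T X) = T (J X)) (X Y : M.tangent) :
    M.leviCivita g X (J Y) = J (M.leviCivita g X Y) := by
  have hm := h.isDiag_metric hg h₁ h₂
  have hΛ : ∀ U V, g (M.leviCivita g X U) V = -g U (M.leviCivita g X V) := fun U V =>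
    eq_neg_of_add_eq_zero_left (M.leviCivita_spec hm X U V).1
  have hH' : ∀ T ∈ M.holonomyAlgebra g, J * T = T * J := fun T hT => LinearMap.ext (hH T hT)
  have hcomm : ∀ {A C : Module.End ℝ M.tangent}, (∀ U V, g (A U) V = -g U (A V)) →
      (∀ U V, g (C U) V = -g U (C V)) → ∀ U V, g ((A * C - C * A) U) V =
        -g U ((A * C - C * A) V) := fun {A C} hA hC U V => by
    simp only [LinearMap.sub_apply, Module.End.mul_apply, map_sub, hA, hC]
    ring
  generalize hΛX : M.leviCivita g X = Λ at *
  -- `B = [Λ(X), J]` measures the failure of `J` to be invariant. It commutes with the holonomy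
  -- algebra because `J` does and the algebra is stable under `[Λ(X), ·]`.
  obtain ⟨B, hBdef⟩ : ∃ B, B = Λ * J - J * Λ := ⟨_, rfl⟩
  have hBc : ∀ T ∈ M.holonomyAlgebra g, B * T = T * B := fun T hT => by
    have c1 := hH' T hT
    have c2 := hH' _ (hΛX ▸ commutator_mem_holonomyAlgebra g X hT)
    rw [hBdef]
    rw [mul_sub, sub_mul] at c2
    have c3 : J * Λ * T - T * (J * Λ) = Λ * T * J - T * Λ * J := by
      rw [mul_assoc, ← mul_assoc T, ← c1, mul_assoc J T, ← c2]
    rw [sub_mul, mul_sub, ← sub_eq_zero]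
    have c4 : Λ * J * T = Λ * T * J := by rw [mul_assoc, c1, mul_assoc]
    rw [c4, ← mul_assoc T Λ J]
    rw [← sub_eq_zero] at c3
    rw [← neg_eq_zero, ← c3]
    abel
  have hBs : ∀ U V, g (B U) V = -g U (B V) := hBdef ▸ hcomm hΛ hJ
  -- `A = [J, B]` is skew and commutes with curvature. As `J` commutes with `R`, `tr (A R) = 0` by
  -- cyclicity, while `trace_mul_curvature` gives `2ρ g(AX, Y)`; so `ρ ≠ 0` forces `A = 0`.
  have hA0 : J * B - B * J = 0 := by
    refine LinearMap.ext fun U => hm.nondegenerate.1 _ fun V => ?_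
    have := trace_mul_curvature hm hE (hcomm hJ hBs) (fun U V => by
      have c1 := hH' _ (curvature_mem_holonomyAlgebra g U V)
      have c2 := hBc _ (curvature_mem_holonomyAlgebra g U V)
      rw [sub_mul, mul_sub, mul_assoc, c2, ← mul_assoc, c1, mul_assoc B, c1, ← mul_assoc B, c2,
        mul_assoc, mul_assoc]) U V
    rw [sub_mul, map_sub, mul_assoc B, hH' _ (curvature_mem_holonomyAlgebra g U V), ← mul_assoc,
      LinearMap.trace_mul_comm ℝ (B * _) J, ← mul_assoc, sub_self] at this
    exact (mul_eq_zero.1 this.symm).resolve_left (mul_ne_zero two_ne_zero hρ)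
  have hB0 : B = 0 := by
    refine h.eq_zero_of_trace_sq hg h₁ h₂ hBs ?_
    -- Now `B` commutes with `J`, so `tr (B²) = tr (B [Λ, J])` vanishes by cyclicity.
    have e : B * B = B * Λ * J - J * B * Λ := by
      rw [sub_eq_zero.1 hA0]
      conv_lhs => rw [show B * B = B * (Λ * J - J * Λ) by rw [← hBdef], mul_sub, ← mul_assoc, ← mul_assoc]
    rw [e, map_sub, LinearMap.trace_mul_comm, ← mul_assoc, sub_self]
  exact LinearMap.congr_fun (sub_eq_zero.1 (hBdef ▸ hB0)) Y

/-- The coefficient `1 - x₂ / (2 x₁)` of `Λ(Y)X` on `p₂ × p₁` is nonzero. This makes `J` preserve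
both summands and be complex linear for the brackets; linearity combined with skewness then
annihilates `[p₁, p₁]_𝔭`. -/
theorem false_of_leviCivita_comm (h : M.IsWeightSplitting p₁ p₂ s)
    (hg : M.IsDiag p₁ p₂ g x₁ x₂) (h₁ : 0 < x₁) (h₂ : 0 < x₂) (hx : x₂ ≠ 2 * x₁)
    {J : Module.End ℝ M.tangent} (hJJ : ∀ X, J (J X) = -X) (hJ : ∀ X Y, g (J X) Y = -g X (J Y))
    (hΛ : ∀ X Y, M.leviCivita g X (J Y) = J (M.leviCivita g X Y)) : False := by
  have hd₁ := h.finrank_pos₁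
  have hd₂ := h.finrank_pos₂
  have ht : 1 - x₂ / x₁ / 2 ≠ 0 := fun h0 => hx (by field_simp at h0; linarith)
  have hJ₂ : ∀ Y ∈ p₂, J Y ∈ p₂ := fun Y hY => by
    obtain ⟨a, ha, b, hb, hab⟩ := h.exists_add (J Y)
    -- `Λ(Y')Y = 0`, so `Λ(Y')JY = 0`; the `p₁`-part `a` of `JY` then commutes with `p₂` modulo `𝔨`,
    -- and `coeff₁ |a|² = 0`.
    have h0 : ∀ Y' ∈ p₂, M.bracket Y' a = 0 := fun Y' hY' => by
      have := hΛ Y' Y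
      rw [h.leviCivita₂₂ hg h₁ h₂ hY' hY, map_zero, hab, map_add, h.leviCivita₂₂ hg h₁ h₂ hY' hb,
        add_zero, h.leviCivita₂₁ hg h₁ h₂ ha hY'] at this
      exact (smul_eq_zero.1 this).resolve_left ht
    obtain ⟨e, he⟩ := M.exists_isOrthonormalBasisOf p₁
    obtain ⟨f, hf⟩ := M.exists_isOrthonormalBasisOf p₂
    have hs := (h.sums he hf).1 a ha a
    simp only [h0 _ (hf.mem _), map_zero, Finset.sum_const_zero] at hs
    have hc : coeff₁ p₁ p₂ ≠ 0 := by rw [coeff₁]; positivity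
    have : a = 0 := M.Q_self_eq_zero ((mul_eq_zero.1 hs.symm).resolve_left hc)
    rw [hab, this, zero_add]
    exact hb
  have hJ₁ : ∀ X ∈ p₁, J X ∈ p₁ := fun X hX => by
    obtain ⟨a, ha, b, hb, hab⟩ := h.exists_add (J X)
    have e1 := hJ X b
    rw [hab, hg.1 X hX, h.Q_eq_zero hX (hJ₂ b hb), map_add, LinearMap.add_apply, hg.1 a ha,
      h.Q_eq_zero ha hb, hg.2 b hb, mul_zero, zero_add, neg_zero] at e1
    have : b = 0 := M.Q_self_eq_zero ((mul_eq_zero.1 e1).resolve_left h₂.ne')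
    rw [hab, this, add_zero]
    exact ha
  have hQ : ∀ X ∈ p₁, ∀ V, M.Q (J X) V = -M.Q X (J V) := fun X hX V => by
    have := hJ X V
    rw [hg.1 _ (hJ₁ X hX), hg.1 X hX, ← mul_neg] at this
    exact mul_left_cancel₀ h₁.ne' this
  have b₂₁ : ∀ X ∈ p₁, ∀ Y ∈ p₂, M.bracket (J X) Y = J (M.bracket X Y) := fun X hX Y hY => by
    have := hΛ Y X
    rw [h.leviCivita₂₁ hg h₁ h₂ (hJ₁ X hX) hY, h.leviCivita₂₁ hg h₁ h₂ hX hY, map_smul] at this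
    rw [M.bracket_swap, M.bracket_swap X, map_neg, smul_right_injective _ ht this]
  have b₁₁ : ∀ X ∈ p₁, ∀ X' ∈ p₁, M.bracket X (J X') = J (M.bracket X X') :=
    fun X hX X' hX' => by
    have := hΛ X X'
    rw [h.leviCivita₁₁ hg h₁ h₂ hX (hJ₁ X' hX'), h.leviCivita₁₁ hg h₁ h₂ hX hX', map_smul] at this
    exact smul_right_injective _ (by norm_num : (1 / 2 : ℝ) ≠ 0) this
  have key : ∀ X ∈ p₁, ∀ X' ∈ p₁, M.bracket X' (J X) = 0 := fun X hX X' hX' => by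
    have hmem := h.bracket_mem₁₁ hX' (hJ₁ X hX)
    refine M.Q_self_eq_zero ?_
    have hz : ∀ Y ∈ p₂, M.Q (M.bracket X' (J X)) Y = 0 := fun Y hY => by
      -- Moving `J` around through `Q` produces a minus sign, whereas complex linearity of the
      -- bracket produces none.
      have e1 : M.Q (M.bracket X' (J X)) Y = -M.Q (M.bracket (J X') X) Y := by
        rw [Q_bracket, b₂₁ X hX Y hY, Q_bracket, hQ X' hX', neg_neg]
      have e2 : M.bracket (J X') X = M.bracket X' (J X) := by
        rw [M.bracket_swap, b₁₁ X hX X' hX', b₁₁ X' hX' X hX, M.bracket_swap X, map_neg, neg_neg]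
      rw [e2] at e1
      linarith
    exact hz _ hmem
  obtain ⟨X, hX, X', hX', hne⟩ := h.exists_bracket_ne_zero
  have := key _ (hJ₁ X' hX') X hX
  rw [hJJ, map_neg, neg_eq_zero] at this
  exact hne this

theorem not_isInvariantKahler (h : M.IsWeightSplitting p₁ p₂ s) (hg : M.IsDiag p₁ p₂ g x₁ x₂)
    (h₁ : 0 < x₁) (h₂ : 0 < x₂) (hx : x₂ ≠ 2 * x₁) : ¬ M.IsInvariantKahler g := by
  rintro ⟨J, hJJ, hJg, -, hΛ⟩
  exact h.false_of_leviCivita_comm hg h₁ h₂ hx hJJ (skew_of_orthogonal hJJ hJg) hΛ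

theorem not_isKahler (h : M.IsWeightSplitting p₁ p₂ s) (hg : M.IsDiag p₁ p₂ g x₁ x₂)
    (h₁ : 0 < x₁) (h₂ : 0 < x₂) (hx : x₂ ≠ 2 * x₁) {ρ : ℝ} (hE : M.IsEinsteinWith g ρ)
    (hρ : ρ ≠ 0) : ¬ M.IsKahler g := by
  rintro ⟨J, hJJ, hJg, hH⟩
  have hJ := skew_of_orthogonal hJJ hJg
  exact h.false_of_leviCivita_comm hg h₁ h₂ hx hJJ hJ
    (h.leviCivita_comm_of_holonomy hg h₁ h₂ hE hρ hJ hH)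

/-- The invariant complex structure `D` on `p₁`, `½ D` on `p₂`, where `D = ad(s)`. -/
def complexStructure (M : FlagManifold L) (s : L) : Module.End ℝ M.tangent :=
  -- Interpolation in `D`: on `D² = -1` the factor is `7/6 - 1/6 = 1`, on `D² = -4` it is `7/6 - 4/6
  -- = 1/2`. A polynomial in `ad s` commutes with `Ad(K)` and `ad(𝔨)` at once.
  (7 / 6 : ℝ) • M.adProj s + (1 / 6 : ℝ) • (M.adProj s * M.adProj s * M.adProj s)

theorem complexStructure_apply₁ (h : M.IsWeightSplitting p₁ p₂ s) {X : M.tangent} (hX : X ∈ p₁) :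
    complexStructure M s X = M.adProj s X := by
  simp only [complexStructure, LinearMap.add_apply, LinearMap.smul_apply, Module.End.mul_apply,
    h.sq₁ X hX, map_neg]
  module

theorem complexStructure_apply₂ (h : M.IsWeightSplitting p₁ p₂ s) {Y : M.tangent} (hY : Y ∈ p₂) :
    complexStructure M s Y = (1 / 2 : ℝ) • M.adProj s Y := by
  simp only [complexStructure, LinearMap.add_apply, LinearMap.smul_apply, Module.End.mul_apply,
    h.sq₂ Y hY, map_smul]
  module

theorem complexStructure_sq (h : M.IsWeightSplitting p₁ p₂ s) (V : M.tangent) :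
    complexStructure M s (complexStructure M s V) = -V := by
  obtain ⟨X, hX, Y, hY, rfl⟩ := h.exists_add V
  rw [map_add, map_add, h.complexStructure_apply₁ hX, h.complexStructure_apply₂ hY,
    h.complexStructure_apply₁ (h.D_mem₁ hX), map_smul,
    h.complexStructure_apply₂ (h.D_mem₂ hY), h.sq₁ X hX, h.sq₂ Y hY]
  module

theorem complexStructure_orthogonal (h : M.IsWeightSplitting p₁ p₂ s)
    (hg : M.IsDiag p₁ p₂ g x₁ x₂) (U V : M.tangent) :
    g (complexStructure M s U) (complexStructure M s V) = g U V := by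
  obtain ⟨X, hX, Y, hY, rfl⟩ := h.exists_add U
  obtain ⟨X', hX', Y', hY', rfl⟩ := h.exists_add V
  simp only [map_add, LinearMap.add_apply, h.complexStructure_apply₁ hX,
    h.complexStructure_apply₂ hY, h.complexStructure_apply₁ hX', h.complexStructure_apply₂ hY',
    map_smul, LinearMap.smul_apply, smul_eq_mul, hg.1 _ (h.D_mem₁ hX), hg.2 _ (h.D_mem₂ hY),
    hg.1 X hX, hg.2 Y hY, h.Q_D_D₁ hX, h.Q_D_D₂ hY]
  rw [h.Q_eq_zero hX hY', h.Q_eq_zero' hX' hY]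
  ring

theorem complexStructure_Ad (h : M.IsWeightSplitting p₁ p₂ s) (k : M.isotropyGroup)
    (V : M.tangent) : complexStructure M s (M.Ad k V) = M.Ad k (complexStructure M s V) := by
  simp only [complexStructure, LinearMap.add_apply, LinearMap.smul_apply, Module.End.mul_apply,
    map_add, map_smul, M.Ad_adProj h.mem]

theorem complexStructure_adProj (h : M.IsWeightSplitting p₁ p₂ s) {Z : L}
    (hZ : Z ∈ M.isotropyAlgebra) (V : M.tangent) :
    complexStructure M s (M.adProj Z V) = M.adProj Z (complexStructure M s V) := by
  simp only [complexStructure, LinearMap.add_apply, LinearMap.smul_apply, Module.End.mul_apply,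
    map_add, map_smul, M.adProj_torus_comm h.mem hZ]

/-- At `x₂ = 2 x₁` the coefficient on `p₂ × p₁` is 0 and that on `p₁ × p₂` is 1; the other blocks
commute with `J` by the weight relations. -/
theorem complexStructure_parallel (h : M.IsWeightSplitting p₁ p₂ s)
    (hg : M.IsDiag p₁ p₂ g x₁ x₂) (h₁ : 0 < x₁) (h₂ : 0 < x₂) (hx : x₂ = 2 * x₁)
    (U V : M.tangent) : M.leviCivita g U (complexStructure M s V) =
      complexStructure M s (M.leviCivita g U V) := by
  obtain ⟨X, hX, Y, hY, rfl⟩ := h.exists_add U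
  obtain ⟨X', hX', Y', hY', rfl⟩ := h.exists_add V
  have ht : x₂ / x₁ / 2 = 1 := by rw [hx]; field_simp
  have hDD := M.adProj_bracket (M.torus_le h.mem)
  simp only [map_add, LinearMap.add_apply, h.complexStructure_apply₁ hX',
    h.complexStructure_apply₂ hY', map_smul, h.leviCivita₁₁ hg h₁ h₂ hX hX',
    h.leviCivita₁₂ hg h₁ h₂ hX hY', h.leviCivita₂₁ hg h₁ h₂ hX' hY,
    h.leviCivita₁₁ hg h₁ h₂ hX (h.D_mem₁ hX'), h.leviCivita₁₂ hg h₁ h₂ hX (h.D_mem₂ hY'),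
    h.leviCivita₂₁ hg h₁ h₂ (h.D_mem₁ hX') hY, h.leviCivita₂₂ hg h₁ h₂ hY hY',
    h.leviCivita₂₂ hg h₁ h₂ hY (h.D_mem₂ hY'), ht,
    h.complexStructure_apply₂ (h.bracket_mem₁₁ hX hX'),
    h.complexStructure_apply₁ (h.bracket_mem₁₂ hX hY'), hDD, h.bracket_D₁₁ hX hX',
    h.bracket_D₁₂ hX hY', map_zero]
  module

theorem isInvariantKahler (h : M.IsWeightSplitting p₁ p₂ s) (hg : M.IsDiag p₁ p₂ g x₁ x₂)
    (h₁ : 0 < x₁) (h₂ : 0 < x₂) (hx : x₂ = 2 * x₁) : M.IsInvariantKahler g :=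
  ⟨complexStructure M s, h.complexStructure_sq, h.complexStructure_orthogonal hg,
    h.complexStructure_Ad, h.complexStructure_parallel hg h₁ h₂ hx⟩

theorem isKahler (h : M.IsWeightSplitting p₁ p₂ s) (hg : M.IsDiag p₁ p₂ g x₁ x₂)
    (h₁ : 0 < x₁) (h₂ : 0 < x₂) (hx : x₂ = 2 * x₁) : M.IsKahler g := by
  refine ⟨complexStructure M s, h.complexStructure_sq, h.complexStructure_orthogonal hg,
    fun T hT => ?_⟩
  have hΛ := h.complexStructure_parallel hg h₁ h₂ hx
  -- The commutant of `J` contains the curvature operators, since `J` commutes with `Λ` and with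
  -- `ad(𝔨)`, and is stable under `[Λ(X), ·]`; hence it contains the holonomy algebra.
  let S : Submodule ℝ (Module.End ℝ M.tangent) :=
    { carrier := {T | ∀ X, complexStructure M s (T X) = T (complexStructure M s X)}
      add_mem' := fun hA hB X => by simp only [LinearMap.add_apply, map_add, hA X, hB X]
      zero_mem' := fun X => by simp
      smul_mem' := fun _ _ hA X => by simp only [LinearMap.smul_apply, map_smul, hA X] }
  refine Submodule.mem_sInf.1 hT S ⟨fun X Y V => ?_, fun X T hT V => ?_⟩
  · simp only [curvature_apply, map_sub, hΛ, ← h.complexStructure_adProj (M.sub_proj_mem _),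
      bracket_apply]
  · simp only [LinearMap.sub_apply, Module.End.mul_apply, map_sub, hΛ, hT _]
    rw [← hΛ, hT]

end IsWeightSplitting

end

end FlagManifold

end

/-! ### Assembly of the classification. -/

theorem mainTheorem2 {L : Type*} [LieRing L] [LieAlgebra ℝ L] [FiniteDimensional ℝ L]
    (M : FlagManifold L) (q₁ q₂ : Submodule ℝ M.tangent)
    (hq₁ : M.IsIrreducibleSummand q₁) (hq₂ : M.IsIrreducibleSummand q₂) (hq : IsCompl q₁ q₂) :
    ∃ (p₁ p₂ : Submodule ℝ M.tangent) (h : IsCompl p₁ p₂),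
      (p₁ = q₁ ∧ p₂ = q₂ ∨ p₁ = q₂ ∧ p₂ = q₁) ∧
      let d₁ : ℝ := Module.finrank ℝ p₁
      let d₂ : ℝ := Module.finrank ℝ p₂
      let c : ℝ := d₁ * d₂ / (d₁ + 4 * d₂)
      let y : ℝ := 4 * d₂ / (d₁ + 2 * d₂)
      let g : ℝ → ℝ → LinearMap.BilinForm ℝ M.tangent := M.diagMetric h
      -- the only nonzero structural constant is `[112] = d₁ d₂ / (d₁ + 4 d₂)`
      (∀ (e : Fin (Module.finrank ℝ p₁) → M.tangent) (f : Fin (Module.finrank ℝ p₂) → M.tangent),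
        M.IsOrthonormalBasisOf e p₁ → M.IsOrthonormalBasisOf f p₂ →
          M.structConst e e e = 0 ∧ M.structConst e e f = c ∧ M.structConst e f f = 0 ∧
            M.structConst f f f = 0) ∧
      -- the invariant metrics are exactly the metrics `(x₁, x₂)` with `x₁, x₂ > 0`
      (∀ b, M.IsInvariantMetric b ↔ ∃ x₁ x₂, 0 < x₁ ∧ 0 < x₂ ∧ b = g x₁ x₂) ∧
      -- Ricci eigenvalues and Lichnerowicz eigenvalue of `(x₁, x₂)`
      (∀ x₁ x₂, 0 < x₁ → 0 < x₂ →
        (∀ X ∈ p₁, ∀ Y, M.ricci (g x₁ x₂) X Y =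
          (1 / (2 * x₁) - c * x₂ / (2 * d₁ * x₁ ^ 2)) * g x₁ x₂ X Y) ∧
        (∀ X ∈ p₂, ∀ Y, M.ricci (g x₁ x₂) X Y =
          (1 / (2 * x₂) - c * (2 * x₁ ^ 2 - x₂ ^ 2) / (4 * d₂ * x₁ ^ 2 * x₂)) * g x₁ x₂ X Y) ∧
        M.lichnerowiczSpectrum (g x₁ x₂) =
          {(d₁ + d₂) * x₂ / ((d₁ + 4 * d₂) * x₁ ^ 2)} ∧
        M.lambdaMin (g x₁ x₂) = (d₁ + d₂) * x₂ / ((d₁ + 4 * d₂) * x₁ ^ 2)) ∧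
      -- exactly two Einstein metrics up to scaling: `(1, 2)` and `(1, y)`, where `0 < y ≠ 2`
      (∀ b, M.IsInvariantMetric b →
        (M.IsEinstein b ↔ ∃ s : ℝ, 0 < s ∧ (b = s • g 1 2 ∨ b = s • g 1 y))) ∧
      (0 < y ∧ ∀ s : ℝ, s • g 1 2 ≠ g 1 y) ∧
      -- every multiple of `(1, 2)` is Kähler, `G`-stable and a local maximum
      (∀ s : ℝ, 0 < s →
        M.IsInvariantKahler (s • g 1 2) ∧ M.IsKahler (s • g 1 2) ∧ M.IsGStable (s • g 1 2) ∧
        (∃ ρ, M.IsEinsteinWith (s • g 1 2) ρ ∧ 2 * ρ < M.lambdaMin (s • g 1 2)) ∧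
        M.IsLocalMaxScal (s • g 1 2)) ∧
      -- every multiple of `(1, y)` is not Kähler, `G`-unstable and a local minimum
      (∀ s : ℝ, 0 < s →
        ¬ M.IsKahler (s • g 1 y) ∧ ¬ M.IsInvariantKahler (s • g 1 y) ∧
        M.IsGUnstable (s • g 1 y) ∧
        (∃ ρ, M.IsEinsteinWith (s • g 1 y) ρ ∧ M.lambdaMin (s • g 1 y) < 2 * ρ) ∧
        M.IsLocalMinScal (s • g 1 y)) := by
  obtain ⟨p₁, p₂, hpq, s, h⟩ : ∃ p₁ p₂ : Submodule ℝ M.tangent,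
      (p₁ = q₁ ∧ p₂ = q₂ ∨ p₁ = q₂ ∧ p₂ = q₁) ∧ ∃ s, M.IsWeightSplitting p₁ p₂ s := by
    rcases M.exists_isWeightSplitting hq₁ hq₂ hq with ⟨s, h⟩ | ⟨s, h⟩
    · exact ⟨q₁, q₂, Or.inl ⟨rfl, rfl⟩, s, h⟩
    · exact ⟨q₂, q₁, Or.inr ⟨rfl, rfl⟩, s, h⟩
  refine ⟨p₁, p₂, h.compl, hpq, ?_⟩
  intro d₁ d₂ c y g
  have hd₁ : 0 < d₁ := h.finrank_pos₁
  have hd₂ : 0 < d₂ := h.finrank_pos₂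
  have hy : 0 < y := by positivity
  -- Equality would give `4 d₂ = 2 d₁ + 4 d₂`, hence `d₁ = 0`.
  have hy2 : y ≠ 2 := fun e => by
    rw [div_eq_iff (by positivity)] at e
    linarith
  have hg : ∀ x₁ x₂, M.IsDiag p₁ p₂ (g x₁ x₂) x₁ x₂ := h.diagMetric_isDiag h.compl
  have hgs : ∀ t x, M.IsDiag p₁ p₂ (t • g 1 x) t (x * t) := fun t x => by
    simpa [mul_comm] using (hg 1 x).smul t
  have hc : c = d₁ * FlagManifold.coeff₁ p₁ p₂ := by
    rw [FlagManifold.coeff₁]; ring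
  refine ⟨fun e f he hf => ?_, fun b => ⟨fun hb => ?_, ?_⟩, fun x₁ x₂ h₁ h₂ => ?_, fun b hb => ?_,
    ⟨hy, fun t ht => hy2 ?_⟩, fun t ht => ?_, fun t ht => ?_⟩
  · rw [hc]
    exact h.structConst_eq he hf
  · obtain ⟨x₁, x₂, h₁, h₂, hd⟩ := h.exists_isDiag_metric hb
    exact ⟨x₁, x₂, h₁, h₂, h.isDiag_ext hd (hg x₁ x₂)⟩
  · rintro ⟨x₁, x₂, h₁, h₂, rfl⟩
    exact h.isDiag_metric (hg x₁ x₂) h₁ h₂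
  · have hr := h.ricci_isDiag (hg x₁ x₂) h₁ h₂
    refine ⟨fun X hX Y => ?_, fun X hX Y => ?_, h.lichnerowiczSpectrum_eq (hg x₁ x₂) h₁ h₂,
      h.lambdaMin_eq (hg x₁ x₂) h₁ h₂⟩
    · rw [hr.1 X hX, (hg x₁ x₂).1 X hX, hc, ← mul_assoc]
      congr 1
      field_simp
    · rw [hr.2 X hX, (hg x₁ x₂).2 X hX, ← mul_assoc]
      congr 1
      rw [FlagManifold.coeff₂]
      change 1 / 2 + ((x₂ / x₁) ^ 2 / 4 - 1 / 2) * (d₁ / (d₁ + 4 * d₂)) =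
        (1 / (2 * x₂) - d₁ * d₂ / (d₁ + 4 * d₂) * (2 * x₁ ^ 2 - x₂ ^ 2) /
          (4 * d₂ * x₁ ^ 2 * x₂)) * x₂
      field_simp
      ring
  · obtain ⟨x₁, x₂, h₁, h₂, hd⟩ := h.exists_isDiag_metric hb
    rw [h.isEinstein_iff hd h₁ h₂]
    constructor
    · rintro (rfl | rfl)
      · exact ⟨x₁, h₁, Or.inl (h.isDiag_ext hd (hgs x₁ 2))⟩
      · exact ⟨x₁, h₁, Or.inr (h.isDiag_ext hd (hgs x₁ y))⟩
    · rintro ⟨t, ht, rfl | rfl⟩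
      · obtain ⟨rfl, rfl⟩ := h.isDiag_inj hd (hgs t 2)
        exact Or.inl rfl
      · obtain ⟨rfl, rfl⟩ := h.isDiag_inj hd (hgs t y)
        exact Or.inr rfl
  · have e := h.isDiag_inj (hg 1 y) (ht ▸ hgs t 2)
    rw [e.2, ← e.1, mul_one]
  · have hd := hgs t 2
    have h2 : 0 < 2 * t := by positivity
    have hE : M.IsEinstein (t • g 1 2) := (h.isEinstein_iff hd ht h2).2 (Or.inl rfl)
    obtain ⟨hp, hp'⟩ := h.profileDeriv_kahler ht
    refine ⟨h.isInvariantKahler hd ht h2 rfl, h.isKahler hd ht h2 rfl,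
      h.isGStable hd ht h2 hE hp hp', ?_, h.isLocalMaxScal hd ht h2 hp hp'⟩
    obtain ⟨ρ, hρ⟩ := hE
    refine ⟨ρ, hρ, ?_⟩
    have e := ((h.isEinsteinWith_iff hd ht h2 ρ).1 hρ).1
    rw [FlagManifold.coeff₁, ← div_eq_iff ht.ne'] at e
    rw [h.lambdaMin_eq hd ht h2, ← e, ← sub_pos]
    have e' : (d₁ + d₂) * (2 * t) / ((d₁ + 4 * d₂) * t ^ 2) -
        2 * ((1 / 2 - 2 * t / t / 2 * (d₂ / (d₁ + 4 * d₂))) / t) =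
        d₁ / ((d₁ + 4 * d₂) * t) := by
      field_simp
      ring
    rw [e']
    positivity
  · have hd := hgs t y
    have h2 : 0 < y * t := by positivity
    have hE : M.IsEinstein (t • g 1 y) := (h.isEinstein_iff hd ht h2).2 (Or.inr rfl)
    have hne : y * t ≠ 2 * t := fun e => hy2 (mul_right_cancel₀ ht.ne' e)
    obtain ⟨hp, hp'⟩ := h.profileDeriv_nonKahler ht
    obtain ⟨ρ, hρ⟩ := hE
    have e := ((h.isEinsteinWith_iff hd ht h2 ρ).1 hρ).1
    rw [FlagManifold.coeff₁, ← div_eq_iff ht.ne'] at e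
    have hlt : M.lambdaMin (t • g 1 y) < 2 * ρ := by
      rw [h.lambdaMin_eq hd ht h2, ← e, ← sub_pos]
      have e' : 2 * ((1 / 2 - y * t / t / 2 * (d₂ / (d₁ + 4 * d₂))) / t) -
          (d₁ + d₂) * (y * t) / ((d₁ + 4 * d₂) * t ^ 2) =
          d₁ / ((d₁ + 2 * d₂) * t) * ((d₁ + 2 * d₂) / (d₁ + 4 * d₂)) := by
        simp only [y]
        field_simp
        ring
      rw [e']
      positivity
    -- `0 ≤ λ_𝔭 < 2ρ`; a nonzero Einstein constant is what rules out complex structures that are not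
    -- assumed invariant.
    have hρ0 : ρ ≠ 0 := by
      have h0 : 0 ≤ M.lambdaMin (t • g 1 y) := by
        rw [h.lambdaMin_eq hd ht h2]
        positivity
      intro h3
      rw [h3, mul_zero] at hlt
      exact hlt.not_ge h0
    exact ⟨h.not_isKahler hd ht h2 hne hρ hρ0, h.not_isInvariantKahler hd ht h2 hne,
      h.isGUnstable hd ht h2 ⟨ρ, hρ⟩ hp hp', ⟨ρ, hρ, hlt⟩, h.isLocalMinScal hd ht h2 hp hp'⟩
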